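/- Let $n\ge 1$ and let $\Omega\subset\mathbb{R}^n$ be a bounded domain (a nonempty, connected, bounded open set). For $1\le p\le\infty$ let $W^{1,p}(\Omega)$ be the space of functions which, together with their distributional gradient, belong to $L^p(\Omega)$. Let $g\in C(\overline\Omega)\cap W^{1,\infty}(\Omega)$. For every real $p>n$ with $p\ge 2$ there is a function $u_p\in C(\overline\Omega)\cap W^{1,p}(\Omega)$ with $u_p=g$ on $\partial\Omega$ which is the unique minimizer of $\int_\Omega|\nabla v|^p\,dx$ among all $v\in C(\overline\Omega)\cap W^{1,p}(\Omega)$ with $v=g$ on $\partial\Omega$, and which is also the unique function in this class that solves the $p$-Laplace equation weakly, i.e. $\int_\Omega\langle|\nabla u_p|^{p-2}\nabla u_p,\nabla\eta\rangle\,dx=0$ for all $\eta\in C_0^\infty(\Omega)$. Every sequence of such exponents tending to $\infty$ has a subsequence $(p_j)$ for which $u_{p_j}$ converges uniformly in $\overline\Omega$ to a function $u_\infty\in C(\overline\Omega)\cap W^{1,\infty}(\Omega)$ with $u_\infty=g$ on $\partial\Omega$ (and $u_\infty$ is Lipschitz continuous in $\Omega$ if $g$ is), which has the following minimizing property: for every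 domain $D\subset\Omega$ and every $v\in C(\overline D)\cap W^{1,\infty}(D)$ with $v=u_\infty$ on $\partial D$, $$\|\nabla u_\infty\|_{L^\infty(D)}\le\|\nabla v\|_{L^\infty(D)}.$$ -/

import Mathlib

open MeasureTheory Filter Topology Set
open scoped ENNReal ContDiff

noncomputable section

namespace InfLaplace

/-- A domain: a nonempty connected open set. -/
def IsDomain {n : ℕ} (Ω : Set (EuclideanSpace ℝ (Fin n))) : Prop :=
  IsOpen Ω ∧ IsConnected Ω

/-- `φ ∈ C₀^∞(Ω)`. -/
def IsTestFunction {n : ℕ} (Ω : Set (EuclideanSpace ℝ (Fin n)))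
    (φ : EuclideanSpace ℝ (Fin n) → ℝ) : Prop :=
  ContDiff ℝ ∞ φ ∧ HasCompactSupport φ ∧ tsupport φ ⊆ Ω

/-- `G` is the distributional gradient of `u` in the open set `Ω`. -/
def HasWeakGradient {n : ℕ} (Ω : Set (EuclideanSpace ℝ (Fin n)))
    (u : EuclideanSpace ℝ (Fin n) → ℝ)
    (G : EuclideanSpace ℝ (Fin n) → EuclideanSpace ℝ (Fin n)) : Prop :=
  LocallyIntegrableOn u Ω volume ∧ LocallyIntegrableOn G Ω volume ∧
    ∀ φ : EuclideanSpace ℝ (Fin n) → ℝ, IsTestFunction Ω φ → ∀ i : Fin n,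
      ∫ x in Ω, u x * fderiv ℝ φ x (EuclideanSpace.single i 1) = - ∫ x in Ω, φ x * G x i

open Classical in
/-- The distributional gradient of `u` in `Ω` (unique almost everywhere in `Ω` when it exists;
by convention `0` when there is none). -/
def weakGrad {n : ℕ} (Ω : Set (EuclideanSpace ℝ (Fin n)))
    (u : EuclideanSpace ℝ (Fin n) → ℝ) : EuclideanSpace ℝ (Fin n) → EuclideanSpace ℝ (Fin n) :=
  if h : ∃ G, HasWeakGradient Ω u G then h.choose else 0

/-- `u ∈ W^{1,p}(Ω)`, `1 ≤ p ≤ ∞`: `u` and its distributional gradient are in `L^p(Ω)`. -/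
def MemSobolev {n : ℕ} (Ω : Set (EuclideanSpace ℝ (Fin n))) (p : ℝ≥0∞)
    (u : EuclideanSpace ℝ (Fin n) → ℝ) : Prop :=
  MemLp u p (volume.restrict Ω) ∧
    ∃ G, HasWeakGradient Ω u G ∧ MemLp G p (volume.restrict Ω)

/-- `u ∈ C(closure Ω) ∩ W^{1,p}(Ω)`. The values of `u` outside `closure Ω` play no role. -/
def MemCSobolev {n : ℕ} (Ω : Set (EuclideanSpace ℝ (Fin n))) (p : ℝ≥0∞)
    (u : EuclideanSpace ℝ (Fin n) → ℝ) : Prop :=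
  ContinuousOn u (closure Ω) ∧ MemSobolev Ω p u

/-- `u ∈ C(closure Ω) ∩ W^{1,p}(Ω)` with boundary values `u = g` on the boundary of `Ω`. -/
def IsAdmissible {n : ℕ} (Ω : Set (EuclideanSpace ℝ (Fin n))) (p : ℝ≥0∞)
    (g u : EuclideanSpace ℝ (Fin n) → ℝ) : Prop :=
  MemCSobolev Ω p u ∧ EqOn u g (frontier Ω)

/-- The variational integral `∫_Ω |∇v|^p dx`. -/
def pEnergy {n : ℕ} (Ω : Set (EuclideanSpace ℝ (Fin n))) (p : ℝ)
    (v : EuclideanSpace ℝ (Fin n) → ℝ) : ℝ :=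
  ∫ x in Ω, ‖weakGrad Ω v x‖ ^ p

/-- `u` minimizes `∫_Ω |∇v|^p dx` among the functions `v` in `C(closure Ω) ∩ W^{1,p}(Ω)` with
boundary values `g`. -/
def IsPMinimizer {n : ℕ} (Ω : Set (EuclideanSpace ℝ (Fin n))) (p : ℝ)
    (g u : EuclideanSpace ℝ (Fin n) → ℝ) : Prop :=
  IsAdmissible Ω (ENNReal.ofReal p) g u ∧
    ∀ v, IsAdmissible Ω (ENNReal.ofReal p) g v → pEnergy Ω p u ≤ pEnergy Ω p v

/-- `u`, in `C(closure Ω) ∩ W^{1,p}(Ω)` and with boundary values `g`, is a weak solution of the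
`p`-Laplace equation in `Ω`. -/
def IsPLaplaceSolution {n : ℕ} (Ω : Set (EuclideanSpace ℝ (Fin n))) (p : ℝ)
    (g u : EuclideanSpace ℝ (Fin n) → ℝ) : Prop :=
  IsAdmissible Ω (ENNReal.ofReal p) g u ∧
    ∀ η : EuclideanSpace ℝ (Fin n) → ℝ, IsTestFunction Ω η →
      ∫ x in Ω, inner ℝ (‖weakGrad Ω u x‖ ^ (p - 2) • weakGrad Ω u x) (gradient η x) = 0

/-- In each subdomain `D` of `Ω`, `u` minimizes `‖∇v‖_{L^∞(D)}` among the functions `v` in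
`C(closure D) ∩ W^{1,∞}(D)` with `v = u` on the boundary of `D`. -/
def IsAbsoluteMinimizer {n : ℕ} (Ω : Set (EuclideanSpace ℝ (Fin n)))
    (u : EuclideanSpace ℝ (Fin n) → ℝ) : Prop :=
  ∀ D : Set (EuclideanSpace ℝ (Fin n)), IsDomain D → D ⊆ Ω →
    ∀ v : EuclideanSpace ℝ (Fin n) → ℝ, IsAdmissible D ∞ u v →
      eLpNorm (weakGrad Ω u) ∞ (volume.restrict D) ≤ eLpNorm (weakGrad D v) ∞ (volume.restrict D)

end InfLaplace

end

namespace InfLaplace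

local notation "𝔼" n => EuclideanSpace ℝ (Fin n)

/-! ### Test functions and weak gradients -/

/-! The boundary of Ω may be arbitrarily bad, so every boundary argument goes through truncation. If
`w` is continuous on the closure and zero on the boundary, a smooth truncation that kills `|w| ≤ δ`
has compact support in Ω. Letting δ tend to 0 shows that `w` extends by zero to a Sobolev function
on the whole space (`HasWeakGradient.indicator`) and that test functions are dense in the gradient
norm (`exists_testFunction_approx`). Since `p > n`, Morrey's inequality for the extension bounds `w`
uniformly by the `L^p` norm of its gradient (`exists_sup_bound`).

For fixed `p`, the midpoint of two admissible functions is admissible, so Clarkson's inequality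
bounds the distance of their gradients by their excess energy (`integral_sub_le_of_le_pEnergy`).
This gives uniqueness and makes minimizing sequences converge strongly, and uniformly by Morrey.
Convexity of `|a|^p` makes minimizing equivalent to solving the equation.

As `p` tends to infinity, comparison with `g` bounds the normalized gradient norms by the sup norm
of the gradient of `g`. Morrey at the fixed exponent `n + 1` and Arzelà–Ascoli then give the uniform
limit `u`.

For the minimizing property, let `v = u` on the boundary of `D`, and let `f_p` be the `p`-minimizer
in `D` with boundary values `v`. The solution `u_p` is also `p`-harmonic in `D` and is uniformly
close to `u`, hence to `f_p`, on the boundary of `D`. The comparison principle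
`abs_sub_le_of_isPHarmonicField` makes them close throughout `D`, so `f_p` tends to `u` uniformly in
`D`. The gradients of the `f_p` have normalized norms bounded by the sup norm of the gradient of
`v`, a bound that survives the limit by the lower semicontinuity result
`exists_hasWeakGradient_of_approx`. That result avoids weak compactness: almost norm-minimal
elements of decreasing convex sets in `L²` form a Cauchy sequence. -/

theorem IsTestFunction.mono {n : ℕ} {Ω Ω' : Set (𝔼 n)} {φ : (𝔼 n) → ℝ}
    (hφ : IsTestFunction Ω φ) (h : Ω ⊆ Ω') : IsTestFunction Ω' φ :=
  ⟨hφ.1, hφ.2.1, hφ.2.2.trans h⟩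

theorem IsTestFunction.mul_contDiff {n : ℕ} {Ω : Set (𝔼 n)} {φ ψ : (𝔼 n) → ℝ}
    (hφ : IsTestFunction Ω φ) (hψ : ContDiff ℝ ∞ ψ) : IsTestFunction Ω (fun x => φ x * ψ x) :=
  ⟨hφ.1.mul hψ, hφ.2.1.mul_right, (tsupport_mul_subset_left).trans hφ.2.2⟩

theorem IsTestFunction.neg {n : ℕ} {Ω : Set (𝔼 n)} {φ : (𝔼 n) → ℝ}
    (hφ : IsTestFunction Ω φ) : IsTestFunction Ω (-φ) := by
  refine ⟨hφ.1.neg, hφ.2.1.neg, ?_⟩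
  have : tsupport (-φ) = tsupport φ := by simp [tsupport]
  rw [this]; exact hφ.2.2

theorem IsTestFunction.continuous_fderiv_apply {n : ℕ} {Ω : Set (𝔼 n)} {φ : (𝔼 n) → ℝ}
    (hφ : IsTestFunction Ω φ) (v : 𝔼 n) : Continuous (fun x => fderiv ℝ φ x v) :=
  (hφ.1.continuous_fderiv (by simp)).clm_apply continuous_const

theorem tsupport_fderiv_apply_subset {n : ℕ} (φ : (𝔼 n) → ℝ) (v : 𝔼 n) :
    tsupport (fun x => fderiv ℝ φ x v) ⊆ tsupport φ := by
  refine closure_minimal (fun x hx => ?_) (isClosed_tsupport φ)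
  refine support_fderiv_subset ℝ (f := φ) ?_
  intro h0
  exact hx (by simp [h0])

theorem IsTestFunction.hasCompactSupport_fderiv_apply {n : ℕ} {Ω : Set (𝔼 n)} {φ : (𝔼 n) → ℝ}
    (hφ : IsTestFunction Ω φ) (v : 𝔼 n) : HasCompactSupport (fun x => fderiv ℝ φ x v) :=
  hφ.2.1.of_isClosed_subset (isClosed_tsupport _) (tsupport_fderiv_apply_subset φ v)

theorem gradient_apply {n : ℕ} (η : (𝔼 n) → ℝ) (x : 𝔼 n) (i : Fin n) :
    gradient η x i = fderiv ℝ η x (EuclideanSpace.single i 1) := by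
  have h : inner ℝ (gradient η x) (EuclideanSpace.single i (1 : ℝ)) =
      fderiv ℝ η x (EuclideanSpace.single i 1) := by
    simp [gradient, InnerProductSpace.toDual_symm_apply]
  rw [← h, EuclideanSpace.inner_single_right]
  simp

theorem norm_gradient {n : ℕ} (η : (𝔼 n) → ℝ) (x : 𝔼 n) : ‖gradient η x‖ = ‖fderiv ℝ η x‖ := by
  simp [gradient]

theorem integrable_smul_of_tsupport_subset {n : ℕ} {F : Type*} [NormedAddCommGroup F]
    [NormedSpace ℝ F] {Ω : Set (𝔼 n)} {f : (𝔼 n) → F} {ψ : (𝔼 n) → ℝ}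
    (hf : LocallyIntegrableOn f Ω volume) (hψ : Continuous ψ) (hc : HasCompactSupport ψ)
    (hs : tsupport ψ ⊆ Ω) : Integrable (fun x => ψ x • f x) volume := by
  have h1 := (hf.integrableOn_compact_subset hs hc).continuousOn_smul hψ.continuousOn hc
  refine (integrableOn_iff_integrable_of_support_subset ?_).1 h1
  intro x hx
  by_contra h
  exact hx (by simp [image_eq_zero_of_notMem_tsupport h])

theorem setIntegral_smul_eq_integral {n : ℕ} {F : Type*} [NormedAddCommGroup F]
    [NormedSpace ℝ F] {Ω : Set (𝔼 n)} (f : (𝔼 n) → F) {ψ : (𝔼 n) → ℝ}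
    (hs : tsupport ψ ⊆ Ω) : ∫ x in Ω, ψ x • f x = ∫ x, ψ x • f x := by
  refine setIntegral_eq_integral_of_forall_compl_eq_zero fun x hx => ?_
  simp [image_eq_zero_of_notMem_tsupport (fun h => hx (hs h))]

/-- The coordinate functions of a locally integrable vector field are locally integrable. -/
theorem locallyIntegrableOn_coord {n : ℕ} {Ω : Set (𝔼 n)} {G : (𝔼 n) → (𝔼 n)}
    (hG : LocallyIntegrableOn G Ω volume) (i : Fin n) :
    LocallyIntegrableOn (fun x => G x i) Ω volume := by
  intro x hx
  obtain ⟨s, hs, h⟩ := hG x hx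
  exact ⟨s, hs, (EuclideanSpace.proj (𝕜 := ℝ) i).integrable_comp h⟩

namespace HasWeakGradient

variable {n : ℕ} {Ω Ω' : Set (EuclideanSpace ℝ (Fin n))} {u v : EuclideanSpace ℝ (Fin n) → ℝ}
  {G H : EuclideanSpace ℝ (Fin n) → EuclideanSpace ℝ (Fin n)}

/-- The test function vanishes off Ω, so all integrals may be taken over the whole space. With this
form, passing to a smaller set costs nothing. -/
theorem integral_eq (h : HasWeakGradient Ω u G) {φ : (𝔼 n) → ℝ} (hφ : IsTestFunction Ω φ)
    (i : Fin n) :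
    ∫ x, fderiv ℝ φ x (EuclideanSpace.single i 1) * u x = - ∫ x, φ x * G x i := by
  have h1 := h.2.2 φ hφ i
  have h2 := setIntegral_smul_eq_integral (fun x => G x i) hφ.2.2
  have h3 := setIntegral_smul_eq_integral u
    ((tsupport_fderiv_apply_subset φ (EuclideanSpace.single i 1)).trans hφ.2.2)
  simp only [smul_eq_mul] at h2 h3
  rw [← h2, ← h3, ← h1]
  simp only [mul_comm]

theorem of_integral_eq (hu : LocallyIntegrableOn u Ω volume) (hG : LocallyIntegrableOn G Ω volume)
    (h : ∀ φ : (𝔼 n) → ℝ, IsTestFunction Ω φ → ∀ i : Fin n,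
      ∫ x, fderiv ℝ φ x (EuclideanSpace.single i 1) * u x = - ∫ x, φ x * G x i) :
    HasWeakGradient Ω u G := by
  refine ⟨hu, hG, fun φ hφ i => ?_⟩
  have h2 := setIntegral_smul_eq_integral (fun x => G x i) hφ.2.2
  have h3 := setIntegral_smul_eq_integral u
    ((tsupport_fderiv_apply_subset φ (EuclideanSpace.single i 1)).trans hφ.2.2)
  simp only [smul_eq_mul] at h2 h3
  rw [h2, ← h φ hφ i, ← h3]
  simp only [mul_comm]

theorem mono (h : HasWeakGradient Ω u G) (hs : Ω' ⊆ Ω) : HasWeakGradient Ω' u G :=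
  of_integral_eq (h.1.mono_set hs) (h.2.1.mono_set hs)
    fun _ hφ i => h.integral_eq (hφ.mono hs) i

/-- The fundamental lemma of the calculus of variations, applied to each coordinate of `G - H`. -/
theorem ae_eq (hΩ : IsOpen Ω) (h : HasWeakGradient Ω u G) (h' : HasWeakGradient Ω u H) :
    G =ᵐ[volume.restrict Ω] H := by
  have key : ∀ i : Fin n, ∀ᵐ x ∂(volume : Measure (𝔼 n)), x ∈ Ω → G x i - H x i = 0 := by
    intro i
    refine hΩ.ae_eq_zero_of_integral_contDiff_smul_eq_zero
      ((locallyIntegrableOn_coord h.2.1 i).sub (locallyIntegrableOn_coord h'.2.1 i)) ?_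
    intro φ h1 h2 h3
    have e1 := h.integral_eq ⟨h1, h2, h3⟩ i
    have e2 := h'.integral_eq ⟨h1, h2, h3⟩ i
    have i1 := integrable_smul_of_tsupport_subset (locallyIntegrableOn_coord h.2.1 i)
      h1.continuous h2 h3
    have i2 := integrable_smul_of_tsupport_subset (locallyIntegrableOn_coord h'.2.1 i)
      h1.continuous h2 h3
    simp only [smul_eq_mul] at i1 i2
    simp only [smul_eq_mul, mul_sub]
    rw [integral_sub i1 i2]
    linarith
  rw [EventuallyEq, ae_restrict_iff' hΩ.measurableSet]
  filter_upwards [ae_all_iff.2 key] with x hx hxΩ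
  ext i
  linarith [hx i hxΩ]

theorem congr (hΩ : MeasurableSet Ω) (h : HasWeakGradient Ω u G) (huv : EqOn u v Ω)
    (hGH : G =ᵐ[volume.restrict Ω] H) : HasWeakGradient Ω v H := by
  have hu : u =ᵐ[volume.restrict Ω] v := (ae_restrict_mem hΩ).mono fun x hx => huv hx
  refine ⟨?_, ?_, fun φ hφ i => ?_⟩
  · intro x hx
    obtain ⟨s, hs, hi⟩ := h.1 x hx
    refine ⟨s ∩ Ω, inter_mem hs self_mem_nhdsWithin, ?_⟩
    have := hi.mono_set (t := s) (s := s ∩ Ω) inter_subset_left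
    exact this.congr_fun_ae (hu.filter_mono (ae_mono (Measure.restrict_mono_set _ inter_subset_right)))
  · intro x hx
    obtain ⟨s, hs, hi⟩ := h.2.1 x hx
    refine ⟨s ∩ Ω, inter_mem hs self_mem_nhdsWithin, ?_⟩
    have := hi.mono_set (t := s) (s := s ∩ Ω) inter_subset_left
    exact this.congr_fun_ae (hGH.filter_mono (ae_mono (Measure.restrict_mono_set _ inter_subset_right)))
  · have h1 := h.2.2 φ hφ i
    rw [integral_congr_ae (g := fun x => u x * fderiv ℝ φ x (EuclideanSpace.single i 1))
      (hu.symm.mono fun x hx => by simp [hx]), h1]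
    rw [integral_congr_ae (f := fun x => φ x * G x i) (g := fun x => φ x * H x i)
      (hGH.mono fun x hx => by simp [hx])]

theorem add (h : HasWeakGradient Ω u G) (h' : HasWeakGradient Ω v H) :
    HasWeakGradient Ω (u + v) (G + H) := by
  refine of_integral_eq (h.1.add h'.1) (h.2.1.add h'.2.1) fun φ hφ i => ?_
  have e1 := h.integral_eq hφ i
  have e2 := h'.integral_eq hφ i
  have i1 := integrable_smul_of_tsupport_subset (locallyIntegrableOn_coord h.2.1 i)
      hφ.1.continuous hφ.2.1 hφ.2.2
  have i2 := integrable_smul_of_tsupport_subset (locallyIntegrableOn_coord h'.2.1 i)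
      hφ.1.continuous hφ.2.1 hφ.2.2
  have hs := (tsupport_fderiv_apply_subset φ (EuclideanSpace.single i 1)).trans hφ.2.2
  have j1 := integrable_smul_of_tsupport_subset h.1 (hφ.continuous_fderiv_apply _)
    (hφ.hasCompactSupport_fderiv_apply (EuclideanSpace.single i 1)) hs
  have j2 := integrable_smul_of_tsupport_subset h'.1 (hφ.continuous_fderiv_apply _)
    (hφ.hasCompactSupport_fderiv_apply (EuclideanSpace.single i 1)) hs
  simp only [smul_eq_mul] at i1 i2 j1 j2
  simp only [Pi.add_apply, PiLp.add_apply, mul_add]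
  rw [integral_add j1 j2, integral_add i1 i2, e1, e2]
  ring

theorem const_smul (h : HasWeakGradient Ω u G) (c : ℝ) :
    HasWeakGradient Ω (c • u) (c • G) := by
  refine of_integral_eq (h.1.smul c) (h.2.1.smul c) fun φ hφ i => ?_
  have e1 := h.integral_eq hφ i
  simp only [Pi.smul_apply, PiLp.smul_apply, smul_eq_mul, mul_left_comm _ c]
  rw [integral_const_mul, integral_const_mul, e1]
  ring

theorem sub (h : HasWeakGradient Ω u G) (h' : HasWeakGradient Ω v H) :
    HasWeakGradient Ω (u - v) (G - H) := by
  have := h.add (h'.const_smul (-1))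
  simpa [sub_eq_add_neg] using this

/-- Weak gradients are stable under convergence of the integrals against test functions. -/
theorem of_tendsto {w : ℕ → (𝔼 n) → ℝ} {F : ℕ → (𝔼 n) → (𝔼 n)}
    (h : ∀ k, HasWeakGradient Ω (w k) (F k))
    (hu : LocallyIntegrableOn u Ω volume) (hG : LocallyIntegrableOn G Ω volume)
    (h1 : ∀ ψ : (𝔼 n) → ℝ, Continuous ψ → HasCompactSupport ψ → tsupport ψ ⊆ Ω →
      Tendsto (fun k => ∫ x, ψ x * w k x) atTop (𝓝 (∫ x, ψ x * u x)))
    (h2 : ∀ ψ : (𝔼 n) → ℝ, Continuous ψ → HasCompactSupport ψ → tsupport ψ ⊆ Ω → ∀ i,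
      Tendsto (fun k => ∫ x, ψ x * F k x i) atTop (𝓝 (∫ x, ψ x * G x i))) :
    HasWeakGradient Ω u G := by
  refine of_integral_eq hu hG fun φ hφ i => ?_
  have a1 := h1 _ (hφ.continuous_fderiv_apply _)
    (hφ.hasCompactSupport_fderiv_apply (EuclideanSpace.single i 1))
    ((tsupport_fderiv_apply_subset φ (EuclideanSpace.single i 1)).trans hφ.2.2)
  have a2 := (h2 φ hφ.1.continuous hφ.2.1 hφ.2.2 i).neg
  refine tendsto_nhds_unique a1 (a2.congr fun k => ?_)
  exact ((h k).integral_eq hφ i).symm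

theorem of_contDiff {η : (𝔼 n) → ℝ} (hη : ContDiff ℝ ∞ η) :
    HasWeakGradient Ω η (gradient η) := by
  have hc : Continuous (gradient η) :=
    (LinearIsometryEquiv.continuous _).comp (hη.continuous_fderiv (by simp))
  refine of_integral_eq (hη.continuous.locallyIntegrable.locallyIntegrableOn _)
    (hc.locallyIntegrable.locallyIntegrableOn _) fun φ hφ i => ?_
  simp only [gradient_apply]
  have c1 : Continuous fun x => fderiv ℝ η x (EuclideanSpace.single i 1) :=
    (hη.continuous_fderiv (by simp)).clm_apply continuous_const
  have i1 := integrable_smul_of_tsupport_subset (c1.locallyIntegrable.locallyIntegrableOn Ω)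
    hφ.1.continuous hφ.2.1 hφ.2.2
  have hs := (tsupport_fderiv_apply_subset φ (EuclideanSpace.single i 1)).trans hφ.2.2
  have j1 := integrable_smul_of_tsupport_subset
    (hη.continuous.locallyIntegrable.locallyIntegrableOn Ω) (hφ.continuous_fderiv_apply _)
    (hφ.hasCompactSupport_fderiv_apply (EuclideanSpace.single i 1)) hs
  have k1 := integrable_smul_of_tsupport_subset
    (hη.continuous.locallyIntegrable.locallyIntegrableOn Ω) hφ.1.continuous hφ.2.1 hφ.2.2
  simp only [smul_eq_mul] at i1 j1 k1
  have := integral_mul_fderiv_eq_neg_fderiv_mul_of_integrable (𝕜 := ℝ) j1 i1 k1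
    (fun x _ => hφ.1.differentiable (by simp) x) (fun x _ => hη.differentiable (by simp) x)
  linarith

end HasWeakGradient

theorem weakGrad_spec {n : ℕ} {Ω : Set (𝔼 n)} {u : (𝔼 n) → ℝ} {G : (𝔼 n) → (𝔼 n)}
    (h : HasWeakGradient Ω u G) : HasWeakGradient Ω u (weakGrad Ω u) := by
  have h' : ∃ G, HasWeakGradient Ω u G := ⟨G, h⟩
  rw [weakGrad, dif_pos h']
  exact h'.choose_spec

theorem weakGrad_ae_eq {n : ℕ} {Ω : Set (𝔼 n)} (hΩ : IsOpen Ω) {u : (𝔼 n) → ℝ}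
    {G : (𝔼 n) → (𝔼 n)} (h : HasWeakGradient Ω u G) :
    weakGrad Ω u =ᵐ[volume.restrict Ω] G :=
  (weakGrad_spec h).ae_eq hΩ h

/-- Smooth cutoff functions. -/
theorem exists_cutoff {n : ℕ} {K U : Set (𝔼 n)} (hK : IsCompact K) (hU : IsOpen U) (hKU : K ⊆ U) :
    ∃ χ : (𝔼 n) → ℝ, IsTestFunction U χ ∧ ∃ V, IsOpen V ∧ K ⊆ V ∧ ∀ x ∈ V, χ x = 1 := by
  obtain ⟨L, hL, hKL, hLU⟩ := exists_compact_between hK hU hKU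
  obtain ⟨f, hf1, hf0, -⟩ := exists_contMDiffMap_one_nhds_of_subset_interior (n := ⊤)
    (modelWithCornersSelf ℝ (𝔼 n)) hK.isClosed hKL
  have hts : tsupport f ⊆ L := closure_minimal (fun x hx => by
    by_contra h
    exact hx (hf0 x h)) hL.isClosed
  -- A whole neighbourhood `V` is kept because there the derivative of the cutoff vanishes too.
  obtain ⟨V, hV, hKV, hV1⟩ := eventually_nhdsSet_iff_exists.1 hf1
  exact ⟨f, ⟨f.contMDiff.contDiff, hL.of_isClosed_subset (isClosed_tsupport _) hts,
    hts.trans hLU⟩, V, hV, hKV, hV1⟩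

/-! ### Mollification -/

section Mollification

variable {n : ℕ} {F : Type*} [NormedAddCommGroup F] [NormedSpace ℝ F]

theorem convolution_normed_eq (ρ : ContDiffBump (0 : 𝔼 n)) (f : (𝔼 n) → F) (x : 𝔼 n) :
    (convolution (ρ.normed volume) f (ContinuousLinearMap.lsmul ℝ ℝ) volume) x =
      ∫ t, ρ.normed volume t • f (x - t) := rfl

theorem lintegral_ofReal_normed (ρ : ContDiffBump (0 : 𝔼 n)) :
    ∫⁻ t, ENNReal.ofReal (ρ.normed volume t) = 1 := by
  rw [← ofReal_integral_eq_lintegral_ofReal ρ.integrable_normed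
    (ae_of_all _ fun x => ρ.nonneg_normed x), ρ.integral_normed]
  simp

/-- The probability measure with density `ρ`. -/
noncomputable def bumpMeasure (ρ : ContDiffBump (0 : 𝔼 n)) : Measure (𝔼 n) :=
  volume.withDensity fun t => ENNReal.ofReal (ρ.normed volume t)

instance (ρ : ContDiffBump (0 : 𝔼 n)) : IsProbabilityMeasure (bumpMeasure ρ) :=
  ⟨by simp [bumpMeasure, lintegral_ofReal_normed]⟩

/-- A mollification is an average against a probability measure. Sup bounds are then immediate, and
`L^p` bounds follow from the monotonicity of norms in the exponent. -/
theorem convolution_normed_eq_integral (ρ : ContDiffBump (0 : 𝔼 n)) (f : (𝔼 n) → F) (x : 𝔼 n) :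
    (convolution (ρ.normed volume) f (ContinuousLinearMap.lsmul ℝ ℝ) volume) x =
      ∫ t, f (x - t) ∂(bumpMeasure ρ) := by
  have hm : Measurable fun t => (ρ.normed volume t).toNNReal :=
    (ρ.continuous_normed.measurable).real_toNNReal
  have := integral_withDensity_eq_integral_smul (μ := volume) hm fun t => f (x - t)
  rw [bumpMeasure, convolution_normed_eq]
  refine Eq.trans ?_ this.symm
  refine integral_congr_ae (ae_of_all _ fun t => ?_)
  simp only [NNReal.smul_def, Real.coe_toNNReal _ (ρ.nonneg_normed t)]

theorem norm_convolution_normed_le (ρ : ContDiffBump (0 : 𝔼 n)) {f : (𝔼 n) → F} {L : ℝ}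
    (h : ∀ᵐ x, ‖f x‖ ≤ L) (x : 𝔼 n) :
    ‖(convolution (ρ.normed volume) f (ContinuousLinearMap.lsmul ℝ ℝ) volume) x‖ ≤ L := by
  rw [convolution_normed_eq_integral]
  have h1 : ∀ᵐ t ∂(bumpMeasure ρ), ‖f (x - t)‖ ≤ L := by
    refine (withDensity_absolutelyContinuous _ _).ae_le ?_
    exact (quasiMeasurePreserving_sub_left volume x).ae h
  have := norm_integral_le_of_norm_le_const h1
  simpa using this

/-- Jensen's inequality for the averaging measure holds at each point; Tonelli and translation
invariance then integrate it. Strong measurability is assumed so that Tonelli applies to `f (x -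
t)`. -/
theorem eLpNorm_convolution_normed_le_aux (ρ : ContDiffBump (0 : 𝔼 n)) {f : (𝔼 n) → F}
    (hf : StronglyMeasurable f) {p : ℝ≥0∞} (hp1 : 1 ≤ p) (hp : p ≠ ⊤) :
    eLpNorm (convolution (ρ.normed volume) f (ContinuousLinearMap.lsmul ℝ ℝ) volume) p volume ≤
      eLpNorm f p volume := by
  have hp0 : p ≠ 0 := (lt_of_lt_of_le one_pos hp1).ne'
  have hpr : 0 < p.toReal := ENNReal.toReal_pos hp0 hp
  have hpt : ∀ x, ‖(convolution (ρ.normed volume) f (ContinuousLinearMap.lsmul ℝ ℝ) volume) x‖ₑ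
      ^ p.toReal ≤ ∫⁻ t, ‖f (x - t)‖ₑ ^ p.toReal ∂(bumpMeasure ρ) := by
    intro x
    have hm : AEStronglyMeasurable (fun t => f (x - t)) (bumpMeasure ρ) :=
      (hf.comp_measurable (measurable_const.sub measurable_id)).aestronglyMeasurable
    have h1 := eLpNorm_le_eLpNorm_of_exponent_le (μ := bumpMeasure ρ) hp1 hm
    rw [eLpNorm_one_eq_lintegral_enorm, eLpNorm_eq_lintegral_rpow_enorm_toReal hp0 hp] at h1
    have h2 : ‖(convolution (ρ.normed volume) f (ContinuousLinearMap.lsmul ℝ ℝ) volume) x‖ₑ ≤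
        (∫⁻ t, ‖f (x - t)‖ₑ ^ p.toReal ∂(bumpMeasure ρ)) ^ (1 / p.toReal) := by
      rw [convolution_normed_eq_integral]
      exact (enorm_integral_le_lintegral_enorm _).trans h1
    calc _ ≤ ((∫⁻ t, ‖f (x - t)‖ₑ ^ p.toReal ∂(bumpMeasure ρ)) ^ (1 / p.toReal)) ^ p.toReal :=
          ENNReal.rpow_le_rpow h2 hpr.le
      _ = _ := by rw [← ENNReal.rpow_mul, one_div_mul_cancel hpr.ne', ENNReal.rpow_one]
  rw [eLpNorm_eq_lintegral_rpow_enorm_toReal hp0 hp, eLpNorm_eq_lintegral_rpow_enorm_toReal hp0 hp]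
  refine ENNReal.rpow_le_rpow ?_ (by positivity)
  calc _ ≤ ∫⁻ x, ∫⁻ t, ‖f (x - t)‖ₑ ^ p.toReal ∂(bumpMeasure ρ) := lintegral_mono hpt
    _ = ∫⁻ t, (∫⁻ x, ‖f (x - t)‖ₑ ^ p.toReal) ∂(bumpMeasure ρ) := by
        refine lintegral_lintegral_swap (Measurable.aemeasurable ?_)
        exact ((hf.comp_measurable (measurable_fst.sub measurable_snd)).enorm).pow_const _
    _ = ∫⁻ t, (∫⁻ x, ‖f x‖ₑ ^ p.toReal) ∂(bumpMeasure ρ) := by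
        refine lintegral_congr fun t => ?_
        exact lintegral_sub_right_eq_self (fun x => ‖f x‖ₑ ^ p.toReal) t
    _ = _ := by simp

/-- Young's inequality for mollifiers. -/
theorem eLpNorm_convolution_normed_le (ρ : ContDiffBump (0 : 𝔼 n)) {f : (𝔼 n) → F}
    (hf : AEStronglyMeasurable f volume) {p : ℝ≥0∞} (hp1 : 1 ≤ p) (hp : p ≠ ⊤) :
    eLpNorm (convolution (ρ.normed volume) f (ContinuousLinearMap.lsmul ℝ ℝ) volume) p volume ≤
      eLpNorm f p volume := by
  rw [eLpNorm_congr_ae hf.ae_eq_mk,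
    convolution_congr (ContinuousLinearMap.lsmul ℝ ℝ) (EventuallyEq.refl _ (ρ.normed volume)) hf.ae_eq_mk]
  exact eLpNorm_convolution_normed_le_aux ρ hf.stronglyMeasurable_mk hp1 hp

theorem convolution_normed_eq_zero (ρ : ContDiffBump (0 : 𝔼 n)) {f : (𝔼 n) → F} {ε : ℝ}
    (hε : ρ.rOut ≤ ε) {x : 𝔼 n} (hx : x ∉ Metric.cthickening ε (tsupport f)) :
    (convolution (ρ.normed volume) f (ContinuousLinearMap.lsmul ℝ ℝ) volume) x = 0 := by
  rw [convolution_normed_eq]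
  refine integral_eq_zero_of_ae (ae_of_all _ fun t => ?_)
  by_cases ht : t ∈ Metric.ball (0 : 𝔼 n) ρ.rOut
  · have : f (x - t) = 0 := by
      by_contra h
      apply hx
      refine Metric.mem_cthickening_of_dist_le x (x - t) ε _
        (subset_tsupport f h) ?_
      rw [dist_eq_norm, sub_sub_cancel]
      exact (mem_ball_zero_iff.1 ht).le.trans hε
    simp [this]
  · have : ρ.normed volume t = 0 := by
      rw [← Function.notMem_support, ρ.support_normed_eq]; exact ht
    simp [this]

/-- Mollifications converge uniformly for continuous functions with compact support. -/
theorem exists_dist_convolution_normed_le [CompleteSpace F] {f : (𝔼 n) → F} (hf : Continuous f)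
    (hc : HasCompactSupport f) {ε : ℝ} (hε : 0 < ε) :
    ∃ δ > 0, ∀ ρ : ContDiffBump (0 : 𝔼 n), ρ.rOut ≤ δ → ∀ x,
      dist ((convolution (ρ.normed volume) f (ContinuousLinearMap.lsmul ℝ ℝ) volume) x) (f x)
        ≤ ε := by
  obtain ⟨δ, hδ, h⟩ := Metric.uniformContinuous_iff.1 (hc.uniformContinuous_of_continuous hf) ε hε
  refine ⟨δ, hδ, fun ρ hρ x => ?_⟩
  refine ContDiffBump.dist_normed_convolution_le hf.aestronglyMeasurable fun y hy => ?_
  exact (h ((Metric.mem_ball.1 hy).trans_le hρ)).le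

theorem exists_eLpNorm_convolution_normed_sub_le_of_continuous [CompleteSpace F] {f : (𝔼 n) → F} (hf : Continuous f)
    (hc : HasCompactSupport f) {p : ℝ≥0∞} {ε : ℝ} (hε : 0 < ε) :
    ∃ δ > 0, ∀ ρ : ContDiffBump (0 : 𝔼 n), ρ.rOut ≤ δ →
      eLpNorm (fun x => (convolution (ρ.normed volume) f (ContinuousLinearMap.lsmul ℝ ℝ) volume) x
        - f x) p volume ≤ ENNReal.ofReal ε := by
  -- For radii at most 1 all mollifications live in this fixed compact set, so uniform smallness
  -- gives smallness in `L^p`.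
  set K := Metric.cthickening 1 (tsupport f) with hK
  have hKc : IsCompact K := hc.isCompact.cthickening
  set A : ℝ≥0∞ := volume K ^ p.toReal⁻¹ with hA
  have hAfin : A ≠ ⊤ := ENNReal.rpow_ne_top_of_nonneg (by positivity) hKc.measure_lt_top.ne
  obtain ⟨δ, hδ, h⟩ := exists_dist_convolution_normed_le hf hc
    (ε := ε / (A.toReal + 1)) (by positivity)
  refine ⟨min δ 1, by positivity, fun ρ hρ => ?_⟩
  have hsupp : Function.support (fun x => (convolution (ρ.normed volume) f
      (ContinuousLinearMap.lsmul ℝ ℝ) volume) x - f x) ⊆ K := by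
    intro x hx
    by_contra hxK
    apply hx
    have h1 := convolution_normed_eq_zero ρ (hρ.trans (min_le_right _ _)) hxK
    have h2 : f x = 0 := image_eq_zero_of_notMem_tsupport
      fun h' => hxK (Metric.self_subset_cthickening _ h')
    simp [h1, h2]
  rw [← eLpNorm_restrict_eq_of_support_subset hsupp]
  have := eLpNorm_le_of_ae_bound (μ := volume.restrict K) (p := p) (C := ε / (A.toReal + 1))
    (f := fun x => (convolution (ρ.normed volume) f
      (ContinuousLinearMap.lsmul ℝ ℝ) volume) x - f x)
    (ae_of_all _ fun x => by
      have := h ρ (hρ.trans (min_le_left _ _)) x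
      rwa [dist_eq_norm] at this)
  refine this.trans ?_
  rw [Measure.restrict_apply_univ, ← hA]
  nth_rewrite 1 [← ENNReal.ofReal_toReal hAfin]
  rw [← ENNReal.ofReal_mul ENNReal.toReal_nonneg]
  refine ENNReal.ofReal_le_ofReal ?_
  rw [mul_div_assoc', div_le_iff₀ (by positivity)]
  nlinarith [ENNReal.toReal_nonneg (a := A)]

/-- Mollifications converge in `L^p`. -/
theorem exists_eLpNorm_convolution_normed_sub_le [CompleteSpace F] {f : (𝔼 n) → F} {p : ℝ≥0∞} (hp1 : 1 ≤ p)
    (hp : p ≠ ⊤) (hf : MemLp f p volume) {ε : ℝ} (hε : 0 < ε) :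
    ∃ δ > 0, ∀ ρ : ContDiffBump (0 : 𝔼 n), ρ.rOut ≤ δ →
      eLpNorm (fun x => (convolution (ρ.normed volume) f (ContinuousLinearMap.lsmul ℝ ℝ) volume) x
        - f x) p volume ≤ ENNReal.ofReal ε := by
  -- A three-term estimate through a continuous compactly supported `g`; Young's inequality controls
  -- the mollification of `f - g`.
  obtain ⟨g, hgc, hfg, hg, hgp⟩ := hf.exists_hasCompactSupport_eLpNorm_sub_le hp
    (ε := ENNReal.ofReal (ε / 3)) (by simpa using hε)
  obtain ⟨δ, hδ, h⟩ := exists_eLpNorm_convolution_normed_sub_le_of_continuous hg hgc (p := p)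
    (ε := ε / 3) (by positivity)
  refine ⟨δ, hδ, fun ρ hρ => ?_⟩
  have hfl : LocallyIntegrable f volume := hf.locallyIntegrable hp1
  have e : (fun x => (convolution (ρ.normed volume) f (ContinuousLinearMap.lsmul ℝ ℝ) volume) x
        - f x) = (convolution (ρ.normed volume) (f - g) (ContinuousLinearMap.lsmul ℝ ℝ) volume)
      + ((fun x => (convolution (ρ.normed volume) g (ContinuousLinearMap.lsmul ℝ ℝ) volume) x - g x)
        + (g - f)) := by
    have h1 : ConvolutionExists (ρ.normed volume) (f - g) (ContinuousLinearMap.lsmul ℝ ℝ) volume :=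
      ρ.hasCompactSupport_normed.convolutionExists_left _ ρ.continuous_normed
        (hfl.sub hg.locallyIntegrable)
    have h2 : ConvolutionExists (ρ.normed volume) g (ContinuousLinearMap.lsmul ℝ ℝ) volume :=
      ρ.hasCompactSupport_normed.convolutionExists_left _ ρ.continuous_normed
        hg.locallyIntegrable
    have h3 := h1.distrib_add h2
    rw [sub_add_cancel] at h3
    ext x
    simp [h3, add_sub_assoc]
  have m0 := hf.1
  have m1 : AEStronglyMeasurable (convolution (ρ.normed volume) (f - g)
      (ContinuousLinearMap.lsmul ℝ ℝ) volume) volume :=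
    (ρ.hasCompactSupport_normed.continuous_convolution_left _ ρ.continuous_normed
        (hfl.sub hg.locallyIntegrable)).aestronglyMeasurable
  have m2 : AEStronglyMeasurable (fun x => (convolution (ρ.normed volume) g
      (ContinuousLinearMap.lsmul ℝ ℝ) volume) x - g x) volume :=
    ((ρ.hasCompactSupport_normed.continuous_convolution_left _ ρ.continuous_normed
        hg.locallyIntegrable).sub hg).aestronglyMeasurable
  have m3 : AEStronglyMeasurable (g - f) volume := hgp.1.sub hf.1
  rw [e]
  calc _ ≤ ENNReal.ofReal (ε / 3) + (ENNReal.ofReal (ε / 3) + ENNReal.ofReal (ε / 3)) := by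
        refine (eLpNorm_add_le m1 (m2.add m3) hp1).trans (add_le_add ?_ ?_)
        · exact (eLpNorm_convolution_normed_le ρ (hf.1.sub hgp.1) hp1 hp).trans hfg
        · refine (eLpNorm_add_le m2 m3 hp1).trans (add_le_add (h ρ hρ) ?_)
          rwa [eLpNorm_sub_comm]
    _ = ENNReal.ofReal ε := by
        rw [← ENNReal.ofReal_add (by positivity) (by positivity),
          ← ENNReal.ofReal_add (by positivity) (by positivity)]
        congr 1; ring

/-- The gradient of a mollification is the mollification of the weak gradient. -/
theorem gradient_convolution_normed (ρ : ContDiffBump (0 : 𝔼 n)) {w : (𝔼 n) → ℝ}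
    {G : (𝔼 n) → (𝔼 n)} (h : HasWeakGradient univ w G) (x : 𝔼 n) :
    gradient (convolution (ρ.normed volume) w (ContinuousLinearMap.lsmul ℝ ℝ) volume) x =
      (convolution (ρ.normed volume) G (ContinuousLinearMap.lsmul ℝ ℝ) volume) x := by
  have hw : LocallyIntegrable w volume := locallyIntegrableOn_univ.1 h.1
  have hG : LocallyIntegrable G volume := locallyIntegrableOn_univ.1 h.2.1
  have hρ : ContDiff ℝ ∞ (ρ.normed volume) := ρ.contDiff_normed
  have hd := ρ.hasCompactSupport_normed.hasFDerivAt_convolution_left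
    (ContinuousLinearMap.lsmul ℝ ℝ) (hρ.of_le (by simp)) hw x
  ext i
  rw [gradient_apply, hd.fderiv]
  -- The derivative falls on the kernel, and this reflected kernel is itself a test function. The
  -- sign from the reflection cancels the one from integration by parts.
  set φ : (𝔼 n) → ℝ := fun y => ρ.normed volume (x - y) with hφ
  have hφt : IsTestFunction univ φ := by
    refine ⟨hρ.comp (contDiff_const.sub contDiff_id), ?_, subset_univ _⟩
    exact ρ.hasCompactSupport_normed.comp_homeomorph (Homeomorph.subLeft x)
  have hφd : ∀ y v, fderiv ℝ φ y v = - fderiv ℝ (ρ.normed volume) (x - y) v := by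
    intro y v
    have h1 : HasFDerivAt φ ((fderiv ℝ (ρ.normed volume) (x - y)).comp
        (-(ContinuousLinearMap.id ℝ (𝔼 n)))) y := by
      have h2 : HasFDerivAt (fun y : 𝔼 n => x - y) (-(ContinuousLinearMap.id ℝ (𝔼 n))) y :=
        (hasFDerivAt_id y).const_sub x
      exact ((hρ.differentiable (by simp) (x - y)).hasFDerivAt).comp y h2
    rw [h1.fderiv]; simp
  have key := h.integral_eq hφt i
  have e1 : (convolution (fderiv ℝ (ρ.normed volume)) w
      (ContinuousLinearMap.precompL (𝔼 n) (ContinuousLinearMap.lsmul ℝ ℝ)) volume x)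
        (EuclideanSpace.single i 1) =
      ∫ t, fderiv ℝ (ρ.normed volume) t (EuclideanSpace.single i 1) * w (x - t) := by
    have hex : ConvolutionExistsAt (fderiv ℝ (ρ.normed volume)) w x
        (ContinuousLinearMap.precompL (𝔼 n) (ContinuousLinearMap.lsmul ℝ ℝ)) volume :=
      (ρ.hasCompactSupport_normed.fderiv ℝ).convolutionExists_left _
        (hρ.continuous_fderiv (by simp)) hw x
    rw [convolution_def, ContinuousLinearMap.integral_apply hex]
    refine integral_congr_ae (ae_of_all _ fun t => ?_)
    simp [ContinuousLinearMap.precompL_apply]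
  have e2 : (convolution (ρ.normed volume) G (ContinuousLinearMap.lsmul ℝ ℝ) volume) x i =
      ∫ t, ρ.normed volume t * G (x - t) i := by
    have hex : ConvolutionExistsAt (ρ.normed volume) G x (ContinuousLinearMap.lsmul ℝ ℝ) volume :=
      ρ.hasCompactSupport_normed.convolutionExists_left _ ρ.continuous_normed hG x
    have := (EuclideanSpace.proj (𝕜 := ℝ) i).integral_comp_comm hex
    simpa [convolution_def] using this.symm
  rw [e1, e2, ← integral_sub_left_eq_self _ volume x, ← integral_sub_left_eq_self
    (fun t => ρ.normed volume t * G (x - t) i) volume x]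
  simp only [sub_sub_cancel]
  simp only [hφd, neg_mul, integral_neg, neg_inj] at key
  exact key

/-- Smooth approximation of a continuous Sobolev function with compact support. -/
theorem exists_smooth_approx {w : (𝔼 n) → ℝ} {G : (𝔼 n) → (𝔼 n)} (hw : Continuous w)
    (hc : HasCompactSupport w) (h : HasWeakGradient univ w G) {p : ℝ≥0∞} (hp1 : 1 ≤ p)
    (hp : p ≠ ⊤) (hGp : MemLp G p volume) {ε : ℝ} (hε : 0 < ε) :
    ∃ η : (𝔼 n) → ℝ, ContDiff ℝ ∞ η ∧ HasCompactSupport η ∧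
      tsupport η ⊆ Metric.cthickening ε (tsupport w) ∧ (∀ x, |η x - w x| ≤ ε) ∧
      eLpNorm (fun x => gradient η x - G x) p volume ≤ ENNReal.ofReal ε ∧
      ∀ L, (∀ᵐ x, ‖G x‖ ≤ L) → ∀ x, ‖gradient η x‖ ≤ L := by
  obtain ⟨δ₁, hδ₁, h1⟩ := exists_dist_convolution_normed_le hw hc hε
  obtain ⟨δ₂, hδ₂, h2⟩ := exists_eLpNorm_convolution_normed_sub_le hp1 hp hGp hε
  set δ := min ε (min δ₁ δ₂) with hδ
  have hδ0 : 0 < δ := by positivity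
  let ρ : ContDiffBump (0 : 𝔼 n) := ⟨δ / 2, δ, by positivity, by linarith⟩
  have hr : ρ.rOut = δ := rfl
  have hw' : LocallyIntegrable w volume := hw.locallyIntegrable
  have hts : tsupport (convolution (ρ.normed volume) w (ContinuousLinearMap.lsmul ℝ ℝ) volume) ⊆
      Metric.cthickening ε (tsupport w) := by
    refine closure_minimal (fun x hx => ?_) Metric.isClosed_cthickening
    by_contra h'
    exact hx (convolution_normed_eq_zero ρ (min_le_left _ _) h')
  refine ⟨convolution (ρ.normed volume) w (ContinuousLinearMap.lsmul ℝ ℝ) volume,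
    ρ.hasCompactSupport_normed.contDiff_convolution_left _ ρ.contDiff_normed hw', ?_, hts, ?_, ?_, ?_⟩
  · exact hc.isCompact.cthickening.of_isClosed_subset (isClosed_tsupport _) hts
  · exact fun x => h1 ρ ((min_le_right _ _).trans (min_le_left _ _)) x
  · simp only [gradient_convolution_normed ρ h]
    exact h2 ρ ((min_le_right _ _).trans (min_le_right _ _))
  · intro L hL x
    rw [gradient_convolution_normed ρ h]
    exact norm_convolution_normed_le ρ hL x

end Mollification

/-! ### Smooth truncations -/

/-- A smooth nondecreasing function that vanishes on `[-1,1]` and is the identity far away. -/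
noncomputable def smoothTrunc (t : ℝ) : ℝ := t * Real.smoothTransition (t ^ 2 - 1)

theorem contDiff_smoothTrunc : ContDiff ℝ ∞ smoothTrunc :=
  contDiff_id.mul (Real.smoothTransition.contDiff.comp ((contDiff_id.pow 2).sub contDiff_const))

theorem smoothTrunc_eq_zero {t : ℝ} (h : |t| ≤ 1) : smoothTrunc t = 0 := by
  rw [smoothTrunc, Real.smoothTransition.zero_of_nonpos, mul_zero]
  have := (sq_le_one_iff_abs_le_one t).2 h
  linarith

theorem smoothTrunc_eq_self {t : ℝ} (h : 2 ≤ |t|) : smoothTrunc t = t := by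
  rw [smoothTrunc, Real.smoothTransition.one_of_one_le, mul_one]
  rw [← sq_abs]; nlinarith

/-- The zero set is exactly `[-1,1]`. The comparison principle needs this direction, to read off a
bound from a vanishing truncation. -/
theorem abs_le_one_of_smoothTrunc_eq_zero {t : ℝ} (h : smoothTrunc t = 0) : |t| ≤ 1 := by
  rcases mul_eq_zero.1 h with h | h
  · simp [h]
  · have := Real.smoothTransition.zero_iff_nonpos.1 h
    exact (sq_le_one_iff_abs_le_one t).1 (by linarith)

theorem abs_smoothTrunc_sub_le (t : ℝ) : |smoothTrunc t - t| ≤ 2 := by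
  by_cases h : 2 ≤ |t|
  · simp [smoothTrunc_eq_self h]
  · push Not at h
    have h0 := Real.smoothTransition.nonneg (t ^ 2 - 1)
    have h1 := Real.smoothTransition.le_one (t ^ 2 - 1)
    have : smoothTrunc t - t = t * (Real.smoothTransition (t ^ 2 - 1) - 1) := by
      rw [smoothTrunc]; ring
    rw [this, abs_mul]
    have h2 : |Real.smoothTransition (t ^ 2 - 1) - 1| ≤ 1 := abs_le.2 ⟨by linarith, by linarith⟩
    nlinarith [abs_nonneg t]

theorem deriv_smoothTrunc_nonneg (t : ℝ) : 0 ≤ deriv smoothTrunc t := by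
  have hd : HasDerivAt smoothTrunc (1 * Real.smoothTransition (t ^ 2 - 1) +
      t * (deriv Real.smoothTransition (t ^ 2 - 1) * (2 * t))) t := by
    have h1 : HasDerivAt (fun t : ℝ => t ^ 2 - 1) (2 * t) t := by
      simpa using (hasDerivAt_pow 2 t).sub_const 1
    have h2 : HasDerivAt Real.smoothTransition (deriv Real.smoothTransition (t ^ 2 - 1))
        (t ^ 2 - 1) :=
      ((Real.smoothTransition.contDiff (n := 1)).differentiable (by simp) _).hasDerivAt
    exact (hasDerivAt_id t).mul (HasDerivAt.comp t (h₂ := Real.smoothTransition) h2 h1)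
  rw [hd.deriv]
  have h3 : 0 ≤ deriv Real.smoothTransition (t ^ 2 - 1) :=
    Real.smoothTransition.monotone.deriv_nonneg
  have h0 := Real.smoothTransition.nonneg (t ^ 2 - 1)
  nlinarith [mul_nonneg h3 (sq_nonneg t)]

theorem deriv_smoothTrunc_eq_zero {t : ℝ} (h : |t| < 1) : deriv smoothTrunc t = 0 := by
  have : smoothTrunc =ᶠ[𝓝 t] fun _ => 0 := by
    filter_upwards [continuous_abs.continuousAt.eventually_lt_const h] with s hs
    exact smoothTrunc_eq_zero hs.le
  rw [this.deriv_eq]; simp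

theorem deriv_smoothTrunc_eq_one {t : ℝ} (h : 2 < |t|) : deriv smoothTrunc t = 1 := by
  have : smoothTrunc =ᶠ[𝓝 t] fun s => s := by
    filter_upwards [continuous_abs.continuousAt.eventually_const_lt h] with s hs
    exact smoothTrunc_eq_self hs.le
  rw [this.deriv_eq]; simp

theorem exists_abs_deriv_smoothTrunc_le : ∃ C, ∀ t, |deriv smoothTrunc t| ≤ C := by
  obtain ⟨C, hC⟩ := (isCompact_Icc (a := (-2 : ℝ)) (b := 2)).exists_bound_of_continuousOn
    (contDiff_smoothTrunc.continuous_deriv (by simp)).continuousOn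
  refine ⟨max C 1, fun t => ?_⟩
  by_cases h : 2 < |t|
  · simp [deriv_smoothTrunc_eq_one h]
  · exact (hC t (abs_le.1 (not_lt.1 h))).trans (le_max_left _ _)

/-- The rescaled truncation, vanishing exactly on `[-δ,δ]`. -/
noncomputable def trunc (δ t : ℝ) : ℝ := δ * smoothTrunc (t / δ)

theorem contDiff_trunc (δ : ℝ) : ContDiff ℝ ∞ (trunc δ) :=
  contDiff_const.mul (contDiff_smoothTrunc.comp (contDiff_id.div_const δ))

theorem deriv_trunc {δ : ℝ} (hδ : 0 < δ) (t : ℝ) :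
    deriv (trunc δ) t = deriv smoothTrunc (t / δ) := by
  have h1 : HasDerivAt (fun t : ℝ => t / δ) (1 / δ) t := (hasDerivAt_id t).div_const δ
  have h2 := (contDiff_smoothTrunc.differentiable (by simp) (t / δ)).hasDerivAt
  have h3 : HasDerivAt (trunc δ) (δ * (deriv smoothTrunc (t / δ) * (1 / δ))) t :=
    (HasDerivAt.comp t (h₂ := smoothTrunc) h2 h1).const_mul δ
  rw [h3.deriv]; field_simp

theorem trunc_eq_zero {δ t : ℝ} (hδ : 0 < δ) (h : |t| ≤ δ) : trunc δ t = 0 := by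
  rw [trunc, smoothTrunc_eq_zero, mul_zero]
  rwa [abs_div, abs_of_pos hδ, div_le_one hδ]

theorem abs_le_of_trunc_eq_zero {δ t : ℝ} (hδ : 0 < δ) (h : trunc δ t = 0) : |t| ≤ δ := by
  have := abs_le_one_of_smoothTrunc_eq_zero ((mul_eq_zero.1 h).resolve_left hδ.ne')
  rwa [abs_div, abs_of_pos hδ, div_le_one hδ] at this

theorem abs_trunc_sub_le {δ : ℝ} (hδ : 0 < δ) (t : ℝ) : |trunc δ t - t| ≤ 2 * δ := by
  have h : trunc δ t - t = δ * (smoothTrunc (t / δ) - t / δ) := by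
    rw [trunc, mul_sub, mul_div_cancel₀ _ hδ.ne']
  rw [h, abs_mul, abs_of_pos hδ]
  nlinarith [abs_smoothTrunc_sub_le (t / δ)]

theorem deriv_trunc_nonneg {δ : ℝ} (hδ : 0 < δ) (t : ℝ) : 0 ≤ deriv (trunc δ) t := by
  rw [deriv_trunc hδ]; exact deriv_smoothTrunc_nonneg _

theorem deriv_trunc_eq_zero {δ t : ℝ} (hδ : 0 < δ) (h : |t| < δ) : deriv (trunc δ) t = 0 := by
  rw [deriv_trunc hδ]
  apply deriv_smoothTrunc_eq_zero
  rwa [abs_div, abs_of_pos hδ, div_lt_one hδ]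

theorem deriv_trunc_eq_one {δ t : ℝ} (hδ : 0 < δ) (h : 2 * δ < |t|) : deriv (trunc δ) t = 1 := by
  rw [deriv_trunc hδ]
  apply deriv_smoothTrunc_eq_one
  rwa [abs_div, abs_of_pos hδ, lt_div_iff₀ hδ]

theorem exists_abs_deriv_trunc_le : ∃ C, ∀ δ > 0, ∀ t, |deriv (trunc δ) t| ≤ C := by
  obtain ⟨C, hC⟩ := exists_abs_deriv_smoothTrunc_le
  refine ⟨C, fun δ hδ t => ?_⟩
  rw [deriv_trunc hδ]; exact hC _

/-- The limit at `t = 0` is 0 although the truncations tend to the identity. This defect is what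
forces weak gradients to vanish on the zero set. -/
theorem tendsto_deriv_trunc (t : ℝ) :
    Tendsto (fun k : ℕ => deriv (trunc (1 / ((k : ℝ) + 1))) t) atTop
      (𝓝 (if t = 0 then 0 else 1)) := by
  split_ifs with h
  · refine tendsto_const_nhds.congr fun k => ?_
    rw [deriv_trunc_eq_zero (by positivity) (by rw [h, abs_zero]; positivity)]
  · have h1 : Tendsto (fun k : ℕ => 2 * (1 / ((k : ℝ) + 1))) atTop (𝓝 0) := by
      simpa using (tendsto_one_div_add_atTop_nhds_zero_nat (𝕜 := ℝ)).const_mul 2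
    refine tendsto_const_nhds.congr' ?_
    filter_upwards [h1.eventually_lt_const (abs_pos.2 h)] with k hk
    rw [deriv_trunc_eq_one (by positivity) hk]

/-! ### The chain rule -/

section Chain

variable {n : ℕ} {Ω : Set (EuclideanSpace ℝ (Fin n))} {u : EuclideanSpace ℝ (Fin n) → ℝ}
  {G : EuclideanSpace ℝ (Fin n) → EuclideanSpace ℝ (Fin n)}

theorem continuous_mul_of_tsupport_subset (hΩ : IsOpen Ω) (hu : ContinuousOn u Ω)
    {χ : (𝔼 n) → ℝ} (hχ : Continuous χ) (hs : tsupport χ ⊆ Ω) :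
    Continuous (fun x => χ x * u x) := by
  refine continuous_of_tsupport fun x hx => ?_
  have hxΩ : x ∈ Ω := hs (tsupport_mul_subset_left hx)
  exact hχ.continuousAt.mul (hu.continuousAt (hΩ.mem_nhds hxΩ))

theorem continuous_gradient {η : (𝔼 n) → ℝ} (hη : ContDiff ℝ ∞ η) : Continuous (gradient η) :=
  (LinearIsometryEquiv.continuous _).comp (hη.continuous_fderiv (by simp))

theorem continuous_smul_gradient (hΩ : IsOpen Ω) (hu : ContinuousOn u Ω)
    {χ : (𝔼 n) → ℝ} (hχ : IsTestFunction Ω χ) :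
    Continuous (fun x => u x • gradient χ x) ∧ Integrable (fun x => u x • gradient χ x) := by
  have hsub : tsupport (fun x => u x • gradient χ x) ⊆ tsupport χ := by
    refine closure_minimal (fun x hx => ?_) (isClosed_tsupport χ)
    refine support_fderiv_subset ℝ (f := χ) fun h0 => hx ?_
    have : gradient χ x = 0 := by rw [← norm_eq_zero, norm_gradient, h0, norm_zero]
    simp [this]
  have c2 : Continuous (fun x => u x • gradient χ x) := by
    refine continuous_of_tsupport fun x hx => ?_
    exact (hu.continuousAt (hΩ.mem_nhds (hχ.2.2 (hsub hx)))).smul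
      (continuous_gradient hχ.1).continuousAt
  exact ⟨c2, c2.integrable_of_hasCompactSupport
    (hχ.2.1.of_isClosed_subset (isClosed_tsupport _) hsub)⟩

/-- Localization: after a cutoff the function is defined on the whole space and can be mollified
freely. The product rule comes from testing the gradient of `u` with `χ * ψ`. -/
theorem HasWeakGradient.mul_cutoff (hΩ : IsOpen Ω) (hu : ContinuousOn u Ω)
    (h : HasWeakGradient Ω u G) {χ : (𝔼 n) → ℝ} (hχ : IsTestFunction Ω χ) :
    Integrable (fun x => χ x • G x + u x • gradient χ x) ∧
    HasWeakGradient univ (fun x => χ x * u x) (fun x => χ x • G x + u x • gradient χ x) := by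
  have i1 : Integrable (fun x => χ x • G x) :=
    integrable_smul_of_tsupport_subset h.2.1 hχ.1.continuous hχ.2.1 hχ.2.2
  obtain ⟨c2, i2⟩ := continuous_smul_gradient hΩ hu hχ
  refine ⟨i1.add i2, HasWeakGradient.of_integral_eq
    ((continuous_mul_of_tsupport_subset hΩ hu hχ.1.continuous
      hχ.2.2).locallyIntegrable.locallyIntegrableOn _)
    ((i1.add i2).locallyIntegrable.locallyIntegrableOn _) fun ψ hψ i => ?_⟩
  have key := h.integral_eq (hχ.mul_contDiff hψ.1) i
  have hd : ∀ x, fderiv ℝ (fun x => χ x * ψ x) x (EuclideanSpace.single i 1) =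
      χ x * fderiv ℝ ψ x (EuclideanSpace.single i 1) +
        ψ x * fderiv ℝ χ x (EuclideanSpace.single i 1) := by
    intro x
    rw [fderiv_fun_mul (hχ.1.differentiable (by simp) x) (hψ.1.differentiable (by simp) x)]
    simp
  have j1 : Integrable (fun x => fderiv ℝ ψ x (EuclideanSpace.single i 1) * (χ x * u x)) := by
    refine Continuous.integrable_of_hasCompactSupport ?_
      (hψ.hasCompactSupport_fderiv_apply _).mul_right
    exact (hψ.continuous_fderiv_apply _).mul
      (continuous_mul_of_tsupport_subset hΩ hu hχ.1.continuous hχ.2.2)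
  have j2 : Integrable (fun x => ψ x * (u x * gradient χ x i)) := by
    have : Continuous fun x => (u x • gradient χ x) i :=
      (EuclideanSpace.proj (𝕜 := ℝ) i).continuous.comp c2
    refine Continuous.integrable_of_hasCompactSupport (hψ.1.continuous.mul ?_) hψ.2.1.mul_right
    simpa using this
  have j3 : Integrable (fun x => ψ x * (χ x * G x i)) := by
    have := integrable_smul_of_tsupport_subset (locallyIntegrableOn_coord h.2.1 i)
      (ψ := fun x => χ x * ψ x) (hχ.1.continuous.mul hψ.1.continuous) hχ.2.1.mul_right
      (tsupport_mul_subset_left.trans hχ.2.2)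
    refine this.congr (ae_of_all _ fun x => ?_)
    simp only [smul_eq_mul]; ring
  simp only [PiLp.add_apply, PiLp.smul_apply, smul_eq_mul, mul_add]
  rw [integral_add j3 j2]
  have e1 : ∫ x, fderiv ℝ (fun x => χ x * ψ x) x (EuclideanSpace.single i 1) * u x =
      (∫ x, fderiv ℝ ψ x (EuclideanSpace.single i 1) * (χ x * u x)) +
        ∫ x, ψ x * (u x * gradient χ x i) := by
    rw [← integral_add j1 j2]
    refine integral_congr_ae (ae_of_all _ fun x => ?_)
    simp only [hd, gradient_apply]; ring
  have e2 : ∫ x, χ x * ψ x * G x i = ∫ x, ψ x * (χ x * G x i) :=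
    integral_congr_ae (ae_of_all _ fun x => by simp only; ring)
  rw [e1, e2] at key
  linarith

theorem fderiv_eq_zero_of_eqOn {χ : (𝔼 n) → ℝ} {V : Set (𝔼 n)} (hV : IsOpen V) {c : ℝ}
    (h : ∀ x ∈ V, χ x = c) {x : 𝔼 n} (hx : x ∈ V) : fderiv ℝ χ x = 0 := by
  have : χ =ᶠ[𝓝 x] fun _ => c := by
    filter_upwards [hV.mem_nhds hx] with y hy using h y hy
  rw [this.fderiv_eq]; simp

/-- Integration by parts for a smooth function of a continuous compactly supported Sobolev
function. -/
theorem integral_comp_eq {w : (𝔼 n) → ℝ} {W : (𝔼 n) → (𝔼 n)} (hw : Continuous w)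
    (hc : HasCompactSupport w) (h : HasWeakGradient univ w W) (hW : Integrable W)
    {T : ℝ → ℝ} (hT : ContDiff ℝ ∞ T) {C : ℝ} (hC : ∀ t, |deriv T t| ≤ C)
    {φ : (𝔼 n) → ℝ} (hφ : IsTestFunction univ φ) (i : Fin n) :
    ∫ x, fderiv ℝ φ x (EuclideanSpace.single i 1) * T (w x) =
      - ∫ x, φ x * (deriv T (w x) * W x i) := by
  have hlip : ∀ a b, |T a - T b| ≤ C * |a - b| := fun a b =>
    Convex.norm_image_sub_le_of_norm_deriv_le (s := univ)
      (fun x _ => hT.differentiable (by simp) x) (fun x _ => hC x) convex_univ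
      (mem_univ b) (mem_univ a)
  have hC0 : 0 ≤ C := (abs_nonneg _).trans (hC 0)
  have hdT : Continuous (deriv T) := hT.continuous_deriv (by simp)
  -- The classical chain rule holds for smooth approximations that converge uniformly, with
  -- gradients converging in `L¹`; it remains to pass to the limit.
  choose η h1 _ _ h4 h5 _ using fun k : ℕ => exists_smooth_approx hw hc h le_rfl
    ENNReal.one_ne_top (memLp_one_iff_integrable.2 hW) (ε := 1 / ((k : ℝ) + 1)) (by positivity)
  have hlim := tendsto_one_div_add_atTop_nhds_zero_nat (𝕜 := ℝ)
  have hpt : ∀ x, Tendsto (fun k => η k x) atTop (𝓝 (w x)) := fun x => by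
    rw [tendsto_iff_dist_tendsto_zero]
    exact squeeze_zero (fun _ => dist_nonneg) (fun k => h4 k x) hlim
  set e : 𝔼 n := EuclideanSpace.single i 1
  have hWi : Integrable (fun x => W x i) := (EuclideanSpace.proj (𝕜 := ℝ) i).integrable_comp hW
  obtain ⟨B, hB⟩ := hφ.2.1.exists_bound_of_continuous hφ.1.continuous
  have hB0 : 0 ≤ B := (norm_nonneg _).trans (hB 0)
  have hk : ∀ k, ∫ x, fderiv ℝ φ x e * T (η k x) =
      - ∫ x, φ x * (deriv T (η k x) * gradient (η k) x i) := by
    intro k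
    have := (HasWeakGradient.of_contDiff (Ω := univ) (hT.comp (h1 k))).integral_eq hφ i
    rw [show (∫ x, fderiv ℝ φ x e * T (η k x)) = ∫ x, fderiv ℝ φ x e * (T ∘ η k) x from rfl, this]
    congr 1
    refine integral_congr_ae (ae_of_all _ fun x => ?_)
    simp only [gradient_apply]
    rw [fderiv_comp x (hT.differentiable (by simp) _) ((h1 k).differentiable (by simp) x)]
    simp [mul_comm]
  have l1 : Tendsto (fun k => ∫ x, fderiv ℝ φ x e * T (η k x)) atTop
      (𝓝 (∫ x, fderiv ℝ φ x e * T (w x))) := by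
    refine tendsto_integral_of_dominated_convergence
      (fun x => ‖fderiv ℝ φ x e‖ * (|T (w x)| + C)) (fun k => ?_) ?_ (fun k => ?_) ?_
    · exact ((hφ.continuous_fderiv_apply e).mul
        (hT.continuous.comp (h1 k).continuous)).aestronglyMeasurable
    · refine Continuous.integrable_of_hasCompactSupport
        ((hφ.continuous_fderiv_apply e).norm.mul
          ((hT.continuous.comp hw).abs.add continuous_const)) ?_
      exact (hφ.hasCompactSupport_fderiv_apply e).norm.mul_right
    · refine ae_of_all _ fun x => ?_
      rw [norm_mul]
      refine mul_le_mul_of_nonneg_left ?_ (norm_nonneg _)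
      have a1 := hlip (η k x) (w x)
      have a2 : |η k x - w x| ≤ 1 := (h4 k x).trans (by
        rw [div_le_one (by positivity)]; linarith [Nat.cast_nonneg (α := ℝ) k])
      have a3 : |T (η k x)| ≤ |T (w x)| + |T (η k x) - T (w x)| := by
        have := abs_add_le (T (w x)) (T (η k x) - T (w x))
        rwa [add_sub_cancel] at this
      rw [Real.norm_eq_abs]
      nlinarith
    · exact ae_of_all _ fun x => ((hT.continuous.tendsto _).comp (hpt x)).const_mul _
  -- The gradient term splits into `T'(η_k) W`, treated by dominated convergence, and `T'(η_k)(∇η_k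
  -- - W)`, which is small in `L¹` because `T'` is bounded.
  have l2 : Tendsto (fun k => ∫ x, φ x * (deriv T (η k x) * W x i)) atTop
      (𝓝 (∫ x, φ x * (deriv T (w x) * W x i))) := by
    refine tendsto_integral_of_dominated_convergence
      (fun x => B * (C * ‖W x i‖)) (fun k => ?_) ?_ (fun k => ?_) ?_
    · exact hφ.1.continuous.aestronglyMeasurable.mul
        ((hdT.comp (h1 k).continuous).aestronglyMeasurable.mul hWi.1)
    · exact (hWi.norm.const_mul C).const_mul B
    · refine ae_of_all _ fun x => ?_
      rw [norm_mul, norm_mul]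
      exact mul_le_mul (hB x) (mul_le_mul_of_nonneg_right (hC _) (norm_nonneg _)) (by positivity) hB0
    · exact ae_of_all _ fun x => (((hdT.tendsto _).comp (hpt x)).mul_const _).const_mul _
  have l3 : Tendsto (fun k => ∫ x, φ x * (deriv T (η k x) * (gradient (η k) x i - W x i))) atTop
      (𝓝 0) := by
    have hb : ∀ k, ‖∫ x, φ x * (deriv T (η k x) * (gradient (η k) x i - W x i))‖ ≤
        B * C * (1 / ((k : ℝ) + 1)) := by
      intro k
      have hgi : Integrable (fun x => gradient (η k) x - W x) := by
        refine memLp_one_iff_integrable.1 ⟨?_, (h5 k).trans_lt ENNReal.ofReal_lt_top⟩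
        exact (continuous_gradient (h1 k)).aestronglyMeasurable.sub hW.1
      have hgn : ∫ x, ‖gradient (η k) x - W x‖ ≤ 1 / ((k : ℝ) + 1) := by
        have := h5 k
        rw [eLpNorm_one_eq_lintegral_enorm] at this
        rw [integral_norm_eq_lintegral_enorm hgi.1]
        exact ENNReal.toReal_le_of_le_ofReal (by positivity) this
      calc _ ≤ ∫ x, B * C * ‖gradient (η k) x - W x‖ := by
            refine norm_integral_le_of_norm_le (hgi.norm.const_mul _) (ae_of_all _ fun x => ?_)
            rw [norm_mul, norm_mul, mul_assoc]
            refine mul_le_mul (hB x) (mul_le_mul (hC _) ?_ (norm_nonneg _) hC0) (by positivity) hB0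
            exact PiLp.norm_apply_le (gradient (η k) x - W x) i
        _ = B * C * ∫ x, ‖gradient (η k) x - W x‖ := integral_const_mul _ _
        _ ≤ _ := mul_le_mul_of_nonneg_left hgn (by positivity)
    refine squeeze_zero_norm hb ?_
    simpa using hlim.const_mul (B * C)
  have l4 := (l2.add l3).neg
  rw [add_zero] at l4
  refine tendsto_nhds_unique l1 (l4.congr fun k => ?_)
  rw [hk k, ← integral_add]
  · congr 1
    refine integral_congr_ae (ae_of_all _ fun x => ?_)
    simp only; ring
  · refine Integrable.mono' ((hWi.norm.const_mul C).const_mul B)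
      (hφ.1.continuous.aestronglyMeasurable.mul
        ((hdT.comp (h1 k).continuous).aestronglyMeasurable.mul hWi.1)) (ae_of_all _ fun x => ?_)
    rw [norm_mul, norm_mul]
    exact mul_le_mul (hB x) (mul_le_mul_of_nonneg_right (hC _) (norm_nonneg _)) (by positivity) hB0
  · have hgi : Integrable (fun x => gradient (η k) x i - W x i) := by
      have : Integrable (fun x => gradient (η k) x - W x) := by
        refine memLp_one_iff_integrable.1 ⟨?_, (h5 k).trans_lt ENNReal.ofReal_lt_top⟩
        exact (continuous_gradient (h1 k)).aestronglyMeasurable.sub hW.1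
      simpa using (EuclideanSpace.proj (𝕜 := ℝ) i).integrable_comp this
    refine Integrable.mono' ((hgi.norm.const_mul C).const_mul B)
      (hφ.1.continuous.aestronglyMeasurable.mul
        ((hdT.comp (h1 k).continuous).aestronglyMeasurable.mul hgi.1)) (ae_of_all _ fun x => ?_)
    rw [norm_mul, norm_mul]
    exact mul_le_mul (hB x) (mul_le_mul_of_nonneg_right (hC _) (norm_nonneg _)) (by positivity) hB0

/-- The chain rule for weak gradients of continuous functions. -/
theorem HasWeakGradient.comp (hΩ : IsOpen Ω) (hu : ContinuousOn u Ω) (h : HasWeakGradient Ω u G)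
    {T : ℝ → ℝ} (hT : ContDiff ℝ ∞ T) {C : ℝ} (hC : ∀ t, |deriv T t| ≤ C) :
    HasWeakGradient Ω (fun x => T (u x)) (fun x => deriv T (u x) • G x) := by
  have hdT : Continuous (deriv T) := hT.continuous_deriv (by simp)
  refine HasWeakGradient.of_integral_eq
    ((hT.continuous.comp_continuousOn hu).locallyIntegrableOn hΩ.measurableSet)
    (h.2.1.continuousOn_smul hΩ.isLocallyClosed (hdT.comp_continuousOn hu)) fun φ hφ i => ?_
  -- Near the support of `φ` the cutoff is 1, so the identity for `χ * u` is the one wanted for `u`.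
  obtain ⟨χ, hχ, V, hV, hKV, hV1⟩ := exists_cutoff hφ.2.1.isCompact hΩ hφ.2.2
  obtain ⟨hWi, hw⟩ := h.mul_cutoff hΩ hu hχ
  have key := integral_comp_eq (continuous_mul_of_tsupport_subset hΩ hu hχ.1.continuous hχ.2.2)
    hχ.2.1.mul_right hw hWi hT hC (hφ.mono (subset_univ _)) i
  refine Eq.trans (integral_congr_ae (ae_of_all _ fun x => ?_)) (key.trans ?_)
  · by_cases hx : x ∈ tsupport φ
    · simp [hV1 x (hKV hx)]
    · have h0 : fderiv ℝ φ x = 0 := by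
        by_contra h0
        exact hx (support_fderiv_subset ℝ (f := φ) h0)
      simp [h0]
  · congr 1
    refine integral_congr_ae (ae_of_all _ fun x => ?_)
    by_cases hx : x ∈ tsupport φ
    · simp [hV1 x (hKV hx), gradient_apply, fderiv_eq_zero_of_eqOn hV hV1 (hKV hx)]
    · simp [image_eq_zero_of_notMem_tsupport hx]

end Chain

/-! ### Extension by zero and density of test functions -/

theorem tendsto_eLpNorm_zero_of_dominated {α F : Type*} [MeasurableSpace α] {μ : Measure α}
    [NormedAddCommGroup F] {p : ℝ≥0∞} (hp0 : p ≠ 0) (hp : p ≠ ⊤) {f : ℕ → α → F} {b : α → ℝ}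
    (hf : ∀ k, AEStronglyMeasurable (f k) μ) (hb : MemLp b p μ)
    (hfb : ∀ k, ∀ᵐ x ∂μ, ‖f k x‖ ≤ b x)
    (h : ∀ᵐ x ∂μ, Tendsto (fun k => f k x) atTop (𝓝 0)) :
    Tendsto (fun k => eLpNorm (f k) p μ) atTop (𝓝 0) := by
  have hpr : 0 < p.toReal := ENNReal.toReal_pos hp0 hp
  have h1 : Tendsto (fun k => ∫⁻ x, ‖f k x‖ₑ ^ p.toReal ∂μ) atTop (𝓝 (∫⁻ _, 0 ∂μ)) := by
    refine tendsto_lintegral_of_dominated_convergence' (fun x => ‖b x‖ₑ ^ p.toReal)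
      (fun k => ((hf k).enorm).pow_const _) (fun k => ?_) ?_ ?_
    · filter_upwards [hfb k] with x hx
      refine ENNReal.rpow_le_rpow ?_ hpr.le
      exact enorm_le_iff_norm_le.2 (hx.trans (le_abs_self _))
    · have := hb.2
      rw [eLpNorm_lt_top_iff_lintegral_rpow_enorm_lt_top hp0 hp] at this
      exact this.ne
    · filter_upwards [h] with x hx
      have := ((ENNReal.continuous_rpow_const (y := p.toReal)).tendsto _).comp hx.enorm
      simpa [hpr, Function.comp_def] using this
  have h2 := ((ENNReal.continuous_rpow_const (y := 1 / p.toReal)).tendsto _).comp h1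
  simp only [lintegral_zero] at h2
  rw [ENNReal.zero_rpow_of_pos (by positivity)] at h2
  refine h2.congr fun k => ?_
  rw [eLpNorm_eq_lintegral_rpow_enorm_toReal hp0 hp]; rfl

section ZeroExtension

variable {n : ℕ} {Ω : Set (EuclideanSpace ℝ (Fin n))} {w : EuclideanSpace ℝ (Fin n) → ℝ}
  {G : EuclideanSpace ℝ (Fin n) → EuclideanSpace ℝ (Fin n)}

/-- The zero extension agrees with `χ * w` for a cutoff equal to 1 near `K`, so `mul_cutoff`
applies. -/
theorem HasWeakGradient.indicator_of_compact (hΩ : IsOpen Ω) (hw : ContinuousOn w Ω)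
    (h : HasWeakGradient Ω w G) {K : Set (𝔼 n)} (hK : IsCompact K) (hKΩ : K ⊆ Ω)
    (hw0 : ∀ x ∈ Ω, x ∉ K → w x = 0) (hG0 : ∀ x ∈ Ω, x ∉ K → G x = 0) :
    HasWeakGradient univ (Ω.indicator w) (Ω.indicator G) := by
  obtain ⟨χ, hχ, V, hV, hKV, hV1⟩ := exists_cutoff hK hΩ hKΩ
  have key := (h.mul_cutoff hΩ hw hχ).2
  refine key.congr MeasurableSet.univ (fun x _ => ?_) (ae_of_all _ fun x => ?_)
  · by_cases hxK : x ∈ K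
    · simp [hV1 x (hKV hxK), hKΩ hxK]
    · by_cases hx : x ∈ Ω
      · simp [hx, hw0 x hx hxK]
      · simp [hx, image_eq_zero_of_notMem_tsupport (fun h' => hx (hχ.2.2 h'))]
  · by_cases hxK : x ∈ K
    · have h0 : gradient χ x = 0 := by
        rw [← norm_eq_zero, norm_gradient, fderiv_eq_zero_of_eqOn hV hV1 (hKV hxK), norm_zero]
      simp [hV1 x (hKV hxK), hKΩ hxK, h0]
    · by_cases hx : x ∈ Ω
      · simp [hx, hw0 x hx hxK, hG0 x hx hxK]
      · have h1 : x ∉ tsupport χ := fun h' => hx (hχ.2.2 h')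
        have h0 : gradient χ x = 0 := by
          rw [← norm_eq_zero, norm_gradient]
          by_contra h0
          exact h1 (support_fderiv_subset ℝ (f := χ) (fun h2 => h0 (by rw [h2, norm_zero])))
        simp [hx, image_eq_zero_of_notMem_tsupport h1, h0]

/-- The set where `|w| ≥ δ` is a compact subset of `Ω`. -/
theorem isCompact_superlevel (hΩ : IsOpen Ω) (hb : Bornology.IsBounded Ω)
    (hw : ContinuousOn w (closure Ω)) {m δ : ℝ} (hw0 : ∀ x ∈ frontier Ω, |w x| ≤ m) (hδ : m < δ) :
    IsCompact {x ∈ closure Ω | δ ≤ |w x|} ∧ {x ∈ closure Ω | δ ≤ |w x|} ⊆ Ω := by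
  constructor
  · refine hb.isCompact_closure.of_isClosed_subset ?_ (sep_subset _ _)
    exact hw.abs.preimage_isClosed_of_isClosed isClosed_closure isClosed_Ici
  · rintro x ⟨hx, hx'⟩
    by_contra hxΩ
    have : x ∈ frontier Ω := by rw [hΩ.frontier_eq]; exact ⟨hx, hxΩ⟩
    linarith [hw0 x this]

/-- Continuity up to the boundary confines `|w| ≥ δ` to a compact subset of Ω, outside which the
truncation and its gradient vanish. This takes the place of any regularity of the boundary. -/
theorem HasWeakGradient.indicator_trunc (hΩ : IsOpen Ω) (hb : Bornology.IsBounded Ω)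
    (hw : ContinuousOn w (closure Ω)) (hw0 : ∀ x ∈ frontier Ω, w x = 0)
    (h : HasWeakGradient Ω w G) {δ : ℝ} (hδ : 0 < δ) :
    HasWeakGradient univ (Ω.indicator fun x => trunc δ (w x))
      (Ω.indicator fun x => deriv (trunc δ) (w x) • G x) := by
  obtain ⟨C, hC⟩ := exists_abs_deriv_trunc_le
  have hwΩ := hw.mono subset_closure
  have h1 := h.comp hΩ hwΩ (contDiff_trunc δ) (hC δ hδ)
  obtain ⟨hK, hKΩ⟩ := isCompact_superlevel hΩ hb hw (m := 0)
    (fun x hx => by simp [hw0 x hx]) hδ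
  have hlt : ∀ x ∈ Ω, x ∉ {x ∈ closure Ω | δ ≤ |w x|} → |w x| < δ := by
    intro x hx hxK
    by_contra h'
    exact hxK ⟨subset_closure hx, not_lt.1 h'⟩
  refine h1.indicator_of_compact hΩ ((contDiff_trunc δ).continuous.comp_continuousOn hwΩ) hK hKΩ
    (fun x hx hxK => trunc_eq_zero hδ (hlt x hx hxK).le) fun x hx hxK => ?_
  rw [deriv_trunc_eq_zero hδ (hlt x hx hxK), zero_smul]

theorem continuous_indicator_zero (hw : ContinuousOn w (closure Ω))
    (hw0 : ∀ x ∈ frontier Ω, w x = 0) : Continuous (Ω.indicator w) :=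
  continuous_indicator hw0 hw

theorem hasCompactSupport_indicator {F : Type*} [Zero F] (hb : Bornology.IsBounded Ω)
    (f : (𝔼 n) → F) : HasCompactSupport (Ω.indicator f) :=
  hb.isCompact_closure.of_isClosed_subset (isClosed_tsupport _)
    (closure_mono (fun x hx => by
      by_contra h
      exact hx (by simp [h])))

/-- The limit δ → 0 of `indicator_trunc`, with the factor inherited from `tendsto_deriv_trunc`.
Inside Ω, uniqueness of the weak gradient then shows that `G` vanishes a.e. on the zero set, so the
factor can be dropped. -/
theorem HasWeakGradient.indicator_aux (hΩ : IsOpen Ω) (hb : Bornology.IsBounded Ω)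
    (hw : ContinuousOn w (closure Ω)) (hw0 : ∀ x ∈ frontier Ω, w x = 0)
    (h : HasWeakGradient Ω w G) (hG : IntegrableOn G Ω volume) :
    HasWeakGradient univ (Ω.indicator w)
      (Ω.indicator fun x => (if w x = 0 then (0 : ℝ) else 1) • G x) := by
  obtain ⟨C, hC⟩ := exists_abs_deriv_trunc_le
  set d : ℕ → ℝ := fun k => 1 / ((k : ℝ) + 1) with hd
  have hd0 : ∀ k, 0 < d k := fun k => by positivity
  have hd1 : ∀ k, d k ≤ 1 := fun k => by
    rw [hd, div_le_one (by positivity)]; linarith [Nat.cast_nonneg (α := ℝ) k]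
  have hdlim : Tendsto d atTop (𝓝 0) := tendsto_one_div_add_atTop_nhds_zero_nat
  have hk := fun k => h.indicator_trunc hΩ hb hw hw0 (hd0 k)
  have hw' := continuous_indicator_zero hw hw0
  have hGi : Integrable (Ω.indicator G) := hG.integrable_indicator hΩ.measurableSet
  have hwΩ := hw.mono subset_closure
  have hFi : ∀ k, Integrable (Ω.indicator fun x => deriv (trunc (d k)) (w x) • G x) := fun k => by
    refine IntegrableOn.integrable_indicator (Integrable.mono' (hG.norm.const_mul C) ?_ ?_)
      hΩ.measurableSet
    · exact ((((contDiff_trunc (d k)).continuous_deriv (by simp)).comp_continuousOn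
        hwΩ).aestronglyMeasurable hΩ.measurableSet).smul hG.1
    · refine ae_of_all _ fun x => ?_
      rw [norm_smul]
      exact mul_le_mul_of_nonneg_right (hC _ (hd0 k) _) (norm_nonneg _)
  have hFlim : ∀ x, Tendsto (fun k => Ω.indicator (fun x => deriv (trunc (d k)) (w x) • G x) x)
      atTop (𝓝 (Ω.indicator (fun x => (if w x = 0 then (0 : ℝ) else 1) • G x) x)) := by
    intro x
    by_cases hx : x ∈ Ω
    · simp only [indicator_of_mem hx]
      exact (tendsto_deriv_trunc (w x)).smul_const _
    · simp only [indicator_of_notMem hx]; exact tendsto_const_nhds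
  have hFint : Integrable (Ω.indicator fun x => (if w x = 0 then (0 : ℝ) else 1) • G x) := by
    refine hGi.mono (aestronglyMeasurable_of_tendsto_ae atTop (fun k => (hFi k).1)
      (ae_of_all _ hFlim)) (ae_of_all _ fun x => ?_)
    by_cases hx : x ∈ Ω
    · simp only [indicator_of_mem hx]
      split_ifs <;> simp
    · simp [indicator_of_notMem hx]
  refine HasWeakGradient.of_tendsto hk (hw'.locallyIntegrable.locallyIntegrableOn _)
    (hFint.locallyIntegrable.locallyIntegrableOn _) ?_ ?_
  · intro ψ hψ hψc _
    refine tendsto_integral_of_dominated_convergence (fun x => ‖ψ x‖ * (|Ω.indicator w x| + 2))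
      (fun k => ?_) ?_ (fun k => ?_) ?_
    · refine hψ.aestronglyMeasurable.mul (continuous_indicator_zero (Ω := Ω) ?_ ?_).aestronglyMeasurable
      · exact (contDiff_trunc (d k)).continuous.comp_continuousOn hw
      · intro x hx
        exact trunc_eq_zero (hd0 k) (by rw [hw0 x hx, abs_zero]; exact (hd0 k).le)
    · exact Continuous.integrable_of_hasCompactSupport
        (hψ.norm.mul (hw'.abs.add continuous_const)) hψc.norm.mul_right
    · refine ae_of_all _ fun x => ?_
      rw [norm_mul]
      refine mul_le_mul_of_nonneg_left ?_ (norm_nonneg _)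
      by_cases hx : x ∈ Ω
      · simp only [indicator_of_mem hx, Real.norm_eq_abs]
        have a1 := abs_trunc_sub_le (hd0 k) (w x)
        have a2 := abs_add_le (w x) (trunc (d k) (w x) - w x)
        rw [add_sub_cancel] at a2
        linarith [hd1 k]
      · simp [indicator_of_notMem hx]
    · refine ae_of_all _ fun x => Tendsto.const_mul _ ?_
      by_cases hx : x ∈ Ω
      · simp only [indicator_of_mem hx]
        rw [tendsto_iff_dist_tendsto_zero]
        refine squeeze_zero (fun _ => dist_nonneg) (fun k => abs_trunc_sub_le (hd0 k) (w x)) ?_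
        simpa using hdlim.const_mul 2
      · simp only [indicator_of_notMem hx]; exact tendsto_const_nhds
  · intro ψ hψ hψc _ i
    obtain ⟨B, hB⟩ := hψc.exists_bound_of_continuous hψ
    have hB0 : 0 ≤ B := (norm_nonneg _).trans (hB 0)
    have hC0 : 0 ≤ C := (abs_nonneg _).trans (hC 1 one_pos 0)
    refine tendsto_integral_of_dominated_convergence (fun x => B * (C * ‖Ω.indicator G x‖))
      (fun k => ?_) ((hGi.norm.const_mul C).const_mul B) (fun k => ?_) ?_
    · exact hψ.aestronglyMeasurable.mul
        ((EuclideanSpace.proj (𝕜 := ℝ) i).continuous.comp_aestronglyMeasurable (hFi k).1)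
    · refine ae_of_all _ fun x => ?_
      rw [norm_mul]
      refine mul_le_mul (hB x) ?_ (norm_nonneg _) hB0
      refine (PiLp.norm_apply_le _ i).trans ?_
      by_cases hx : x ∈ Ω
      · simp only [indicator_of_mem hx, norm_smul]
        exact mul_le_mul_of_nonneg_right (hC _ (hd0 k) _) (norm_nonneg _)
      · simp [indicator_of_notMem hx]
    · exact ae_of_all _ fun x => Tendsto.const_mul _
        (((EuclideanSpace.proj (𝕜 := ℝ) i).continuous.tendsto _).comp (hFlim x))

/-- The weak gradient vanishes a.e. on the zero set. -/
theorem HasWeakGradient.ae_eq_zero (hΩ : IsOpen Ω) (hb : Bornology.IsBounded Ω)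
    (hw : ContinuousOn w (closure Ω)) (hw0 : ∀ x ∈ frontier Ω, w x = 0)
    (h : HasWeakGradient Ω w G) (hG : IntegrableOn G Ω volume) :
    ∀ᵐ x ∂(volume.restrict Ω), w x = 0 → G x = 0 := by
  have h1 := ((h.indicator_aux hΩ hb hw hw0 hG).mono (subset_univ Ω)).congr hΩ.measurableSet
    (v := w) (fun x hx => indicator_of_mem hx _) (EventuallyEq.refl _ _)
  filter_upwards [h1.ae_eq hΩ h, ae_restrict_mem hΩ.measurableSet] with x hx hxΩ h0
  rw [← hx, indicator_of_mem hxΩ, if_pos h0, zero_smul]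

/-- Extension by zero of a Sobolev function that is continuous up to the boundary and vanishes
there. -/
theorem HasWeakGradient.indicator (hΩ : IsOpen Ω) (hb : Bornology.IsBounded Ω)
    (hw : ContinuousOn w (closure Ω)) (hw0 : ∀ x ∈ frontier Ω, w x = 0)
    (h : HasWeakGradient Ω w G) (hG : IntegrableOn G Ω volume) :
    HasWeakGradient univ (Ω.indicator w) (Ω.indicator G) := by
  refine (h.indicator_aux hΩ hb hw hw0 hG).congr MeasurableSet.univ (fun _ _ => rfl) ?_
  rw [Measure.restrict_univ]
  have := (ae_restrict_iff' hΩ.measurableSet).1 (h.ae_eq_zero hΩ hb hw hw0 hG)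
  filter_upwards [this] with x hx
  by_cases hxΩ : x ∈ Ω
  · simp only [indicator_of_mem hxΩ]
    split_ifs with h0
    · rw [hx hxΩ h0, smul_zero]
    · rw [one_smul]
  · simp [indicator_of_notMem hxΩ]

theorem MemLp.integrableOn_of_isBounded {F : Type*} [NormedAddCommGroup F] {f : (𝔼 n) → F}
    (hb : Bornology.IsBounded Ω) {p : ℝ≥0∞} (hp1 : 1 ≤ p) (hf : MemLp f p (volume.restrict Ω)) :
    IntegrableOn f Ω volume := by
  have : IsFiniteMeasure (volume.restrict Ω) := ⟨by simpa using hb.measure_lt_top⟩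
  exact hf.integrable hp1

/-- Test functions are dense, for the `L^p` distance of gradients, among the Sobolev functions that
are continuous up to the boundary and vanish there. -/
theorem exists_testFunction_approx (hΩ : IsOpen Ω) (hb : Bornology.IsBounded Ω)
    (hw : ContinuousOn w (closure Ω)) (hw0 : ∀ x ∈ frontier Ω, w x = 0)
    (h : HasWeakGradient Ω w G) {p : ℝ≥0∞} (hp1 : 1 ≤ p) (hp : p ≠ ⊤)
    (hG : MemLp G p (volume.restrict Ω)) {ε : ℝ} (hε : 0 < ε) :
    ∃ η : (𝔼 n) → ℝ, IsTestFunction Ω η ∧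
      eLpNorm (fun x => gradient η x - G x) p (volume.restrict Ω) ≤ ENNReal.ofReal ε := by
  obtain ⟨C, hC⟩ := exists_abs_deriv_trunc_le
  have hGi := MemLp.integrableOn_of_isBounded hb hp1 hG
  set d : ℕ → ℝ := fun k => 1 / ((k : ℝ) + 1) with hd
  have hd0 : ∀ k, 0 < d k := fun k => by positivity
  have hwΩ := hw.mono subset_closure
  have hmeas : ∀ k, AEStronglyMeasurable (fun x => deriv (trunc (d k)) (w x))
      (volume.restrict Ω) := fun k =>
    (((contDiff_trunc (d k)).continuous_deriv (by simp)).comp_continuousOn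
        hwΩ).aestronglyMeasurable hΩ.measurableSet
  have hlim : Tendsto (fun k => eLpNorm (fun x => deriv (trunc (d k)) (w x) • G x - G x) p
      (volume.restrict Ω)) atTop (𝓝 0) := by
    refine tendsto_eLpNorm_zero_of_dominated (b := fun x => (C + 1) * ‖G x‖)
      (lt_of_lt_of_le one_pos hp1).ne' hp
      (fun k => ((hmeas k).smul hG.1).sub hG.1) (hG.norm.const_mul _) (fun k => ?_) ?_
    · refine ae_of_all _ fun x => ?_
      refine (norm_sub_le _ _).trans ?_
      rw [norm_smul, add_mul, one_mul]
      gcongr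
      exact hC _ (hd0 k) _
    · filter_upwards [h.ae_eq_zero hΩ hb hw hw0 hGi] with x hx
      by_cases h0 : w x = 0
      · simp [hx h0]
      · have := ((tendsto_deriv_trunc (w x)).smul_const (G x)).sub_const (G x)
        simpa only [h0, if_false, one_smul, sub_self] using this
  -- Half of the error is spent on truncation, which gives compact support, and half on
  -- mollification.
  obtain ⟨k, hk⟩ := (hlim.eventually_lt_const
    (show (0 : ℝ≥0∞) < ENNReal.ofReal (ε / 2) by simpa using hε)).exists
  set f := fun x => trunc (d k) (w x) with hf
  set F := fun x => deriv (trunc (d k)) (w x) • G x with hF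
  have hind : HasWeakGradient univ (Ω.indicator f) (Ω.indicator F) :=
    h.indicator_trunc hΩ hb hw hw0 (hd0 k)
  have hfc : Continuous (Ω.indicator f) := by
    refine continuous_indicator_zero ((contDiff_trunc (d k)).continuous.comp_continuousOn hw) ?_
    intro x hx
    exact trunc_eq_zero (hd0 k) (by rw [hw0 x hx, abs_zero]; exact (hd0 k).le)
  have hFp : MemLp (Ω.indicator F) p volume := by
    rw [memLp_indicator_iff_restrict hΩ.measurableSet]
    exact hG.of_le_mul (c := C) ((hmeas k).smul hG.1) (ae_of_all _ fun x => by
      rw [norm_smul]; exact mul_le_mul_of_nonneg_right (hC _ (hd0 k) _) (norm_nonneg _))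
  obtain ⟨hK, hKΩ⟩ := isCompact_superlevel hΩ hb hw (m := 0)
    (fun x hx => by simp [hw0 x hx]) (hd0 k)
  have hts : tsupport (Ω.indicator f) ⊆ {x ∈ closure Ω | d k ≤ |w x|} := by
    refine closure_minimal (fun x hx => ?_) hK.isClosed
    have hxΩ : x ∈ Ω := by
      by_contra h'
      exact hx (by simp [h'])
    refine ⟨subset_closure hxΩ, ?_⟩
    by_contra h'
    refine hx ?_
    rw [indicator_of_mem hxΩ]
    exact trunc_eq_zero (hd0 k) (not_le.1 h').le
  -- Mollifying at a scale below `r` keeps the support inside Ω.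
  obtain ⟨r, hr, hrΩ⟩ := hK.exists_cthickening_subset_open hΩ hKΩ
  obtain ⟨η, e1, e2, e3, -, e5, -⟩ := exists_smooth_approx hfc (hasCompactSupport_indicator hb f)
    hind hp1 hp hFp (ε := min r (ε / 2)) (by positivity)
  refine ⟨η, ⟨e1, e2, e3.trans ((Metric.cthickening_mono (min_le_left _ _) _).trans
    ((Metric.cthickening_subset_of_subset _ hts).trans hrΩ))⟩, ?_⟩
  have a1 : eLpNorm (fun x => gradient η x - F x) p (volume.restrict Ω) ≤
      ENNReal.ofReal (ε / 2) := by
    calc _ = eLpNorm (fun x => gradient η x - Ω.indicator F x) p (volume.restrict Ω) := by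
          refine eLpNorm_congr_ae ((ae_restrict_mem hΩ.measurableSet).mono fun x hx => ?_)
          simp only [indicator_of_mem hx]
      _ ≤ eLpNorm (fun x => gradient η x - Ω.indicator F x) p volume :=
          eLpNorm_mono_measure _ Measure.restrict_le_self
      _ ≤ _ := e5.trans (ENNReal.ofReal_le_ofReal (min_le_right _ _))
  have m1 : AEStronglyMeasurable (fun x => gradient η x - F x) (volume.restrict Ω) :=
    (continuous_gradient e1).aestronglyMeasurable.sub ((hmeas k).smul hG.1)
  have m2 : AEStronglyMeasurable (fun x => F x - G x) (volume.restrict Ω) :=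
    ((hmeas k).smul hG.1).sub hG.1
  calc _ = eLpNorm ((fun x => gradient η x - F x) + fun x => F x - G x) p (volume.restrict Ω) := by
        congr 1; ext1 x; simp
    _ ≤ ENNReal.ofReal (ε / 2) + ENNReal.ofReal (ε / 2) :=
        (eLpNorm_add_le m1 m2 hp1).trans (add_le_add a1 hk.le)
    _ = ENNReal.ofReal ε := by
        rw [← ENNReal.ofReal_add (by positivity) (by positivity), add_halves]

/-- Hölder's inequality for the integral of the inner product of two vector fields. -/
theorem integrable_inner_and_norm_integral_le {α : Type*} [MeasurableSpace α] {μ : Measure α}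
    {p q : ℝ≥0∞} [p.HolderConjugate q] {A B : α → (𝔼 n)} (hA : MemLp A p μ) (hB : MemLp B q μ) :
    Integrable (fun x => inner ℝ (A x) (B x)) μ ∧
      |∫ x, inner ℝ (A x) (B x) ∂μ| ≤ (eLpNorm A p μ).toReal * (eLpNorm B q μ).toReal := by
  have hle := eLpNorm_le_eLpNorm_mul_eLpNorm'_of_norm (p := p) (q := q) (r := 1) hA.1 hB.1
    (fun a b => (inner ℝ a b : ℝ)) 1 (ae_of_all _ fun x => by
      simpa using norm_inner_le_norm (𝕜 := ℝ) (A x) (B x))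
  have hm : AEStronglyMeasurable (fun x => (inner ℝ (A x) (B x) : ℝ)) μ := hA.1.inner hB.1
  have hfin : eLpNorm A p μ * eLpNorm B q μ ≠ ⊤ := ENNReal.mul_ne_top hA.2.ne hB.2.ne
  simp only [ENNReal.coe_one, one_mul] at hle
  have hi : Integrable (fun x => (inner ℝ (A x) (B x) : ℝ)) μ :=
    memLp_one_iff_integrable.1 ⟨hm, hle.trans_lt hfin.lt_top⟩
  refine ⟨hi, ?_⟩
  rw [← ENNReal.toReal_mul]
  calc _ ≤ ∫ x, ‖(inner ℝ (A x) (B x) : ℝ)‖ ∂μ := norm_integral_le_integral_norm _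
    _ = (eLpNorm (fun x => (inner ℝ (A x) (B x) : ℝ)) 1 μ).toReal := by
        rw [integral_norm_eq_lintegral_enorm hm, eLpNorm_one_eq_lintegral_enorm]
    _ ≤ _ := ENNReal.toReal_mono hfin hle

theorem memLp_gradient {η : (𝔼 n) → ℝ} (hη : IsTestFunction Ω η) (p : ℝ≥0∞) (μ : Measure (𝔼 n))
    [IsFiniteMeasureOnCompacts μ] : MemLp (gradient η) p μ := by
  refine (continuous_gradient hη.1).memLp_of_hasCompactSupport ?_
  refine hη.2.1.of_isClosed_subset (isClosed_tsupport _) (closure_minimal (fun x hx => ?_)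
    (isClosed_tsupport η))
  refine support_fderiv_subset ℝ (f := η) fun h0 => hx ?_
  rw [← norm_eq_zero, norm_gradient, h0, norm_zero]

/-- A divergence free field is orthogonal to the gradients of Sobolev functions vanishing on the
boundary. -/
theorem integral_inner_eq_zero (hΩ : IsOpen Ω) (hb : Bornology.IsBounded Ω)
    {p q : ℝ≥0∞} [q.HolderConjugate p] (hp1 : 1 ≤ p) (hp : p ≠ ⊤)
    {A : (𝔼 n) → (𝔼 n)} (hA : MemLp A q (volume.restrict Ω))
    (hdiv : ∀ η, IsTestFunction Ω η → ∫ x in Ω, inner ℝ (A x) (gradient η x) = 0)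
    (hw : ContinuousOn w (closure Ω)) (hw0 : ∀ x ∈ frontier Ω, w x = 0)
    (h : HasWeakGradient Ω w G) (hG : MemLp G p (volume.restrict Ω)) :
    ∫ x in Ω, inner ℝ (A x) (G x) = 0 := by
  set a := (eLpNorm A q (volume.restrict Ω)).toReal with ha
  have ha0 : 0 ≤ a := ENNReal.toReal_nonneg
  have key : ∀ ε > 0, |∫ x in Ω, inner ℝ (A x) (G x)| ≤ a * ε := by
    intro ε hε
    obtain ⟨η, hη, hle⟩ := exists_testFunction_approx hΩ hb hw hw0 h hp1 hp hG hε
    have hηp : MemLp (gradient η) p (volume.restrict Ω) := memLp_gradient hη p _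
    have i1 := (integrable_inner_and_norm_integral_le hA hηp).1
    have i2 := (integrable_inner_and_norm_integral_le hA hG).1
    have h3 := (integrable_inner_and_norm_integral_le hA (hηp.sub hG)).2
    simp only [Pi.sub_apply, inner_sub_right] at h3
    rw [integral_sub i1 i2, hdiv η hη, zero_sub, abs_neg] at h3
    refine h3.trans (mul_le_mul_of_nonneg_left ?_ ha0)
    exact ENNReal.toReal_le_of_le_ofReal hε.le hle
  have h0 : |∫ x in Ω, inner ℝ (A x) (G x)| ≤ 0 := by
    refine le_of_forall_pos_le_add fun ε hε => ?_
    refine (key (ε / (a + 1)) (by positivity)).trans ?_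
    rw [zero_add, mul_div_assoc', div_le_iff₀ (by positivity)]
    nlinarith
  exact abs_eq_zero.1 (le_antisymm h0 (abs_nonneg _))

end ZeroExtension

/-! ### Morrey's inequality -/

section Morrey

variable {n : ℕ}

theorem enorm_sub_le_lintegral_gradient {w : (𝔼 n) → ℝ} (hw : ContDiff ℝ ∞ w) (x z : 𝔼 n) {r : ℝ}
    (hr : 0 < r) (hz : ‖z‖ ≤ 1) :
    ‖w (x + r • z) - w x‖ₑ ≤ ∫⁻ s in Ioc 0 r, ‖gradient w (x + s • z)‖ₑ := by
  have hd : ∀ s ∈ uIcc 0 r, HasDerivAt (fun s : ℝ => w (x + s • z))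
      (fderiv ℝ w (x + s • z) z) s := by
    intro s _
    have h1 : HasDerivAt (fun s : ℝ => x + s • z) z s := by
      simpa using ((hasDerivAt_id s).smul_const z).const_add x
    exact ((hw.differentiable (by simp) (x + s • z)).hasFDerivAt).comp_hasDerivAt s h1
  have hc : Continuous fun s : ℝ => fderiv ℝ w (x + s • z) z :=
    ((hw.continuous_fderiv (by simp)).comp (by fun_prop)).clm_apply continuous_const
  have key := intervalIntegral.integral_eq_sub_of_hasDerivAt hd (hc.intervalIntegrable 0 r)
  simp only [zero_smul, add_zero] at key
  rw [← key, intervalIntegral.integral_of_le hr.le]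
  refine (enorm_integral_le_lintegral_enorm _).trans (lintegral_mono fun s => ?_)
  rw [enorm_le_iff_norm_le, norm_gradient]
  exact ((fderiv ℝ w (x + s • z)).le_opNorm z).trans
    (mul_le_of_le_one_right (norm_nonneg _) hz)

theorem eLpNorm_comp_add_smul {F : Type*} [NormedAddCommGroup F] {f : (𝔼 n) → F}
    (hf : Continuous f) (x : 𝔼 n) {s : ℝ} (hs : 0 < s) {p : ℝ} (hp : 0 < p) :
    eLpNorm (fun z => f (x + s • z)) (ENNReal.ofReal p) volume =
      ENNReal.ofReal (s ^ (-(n : ℝ) / p)) * eLpNorm f (ENNReal.ofReal p) volume := by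
  have hp0 : ENNReal.ofReal p ≠ 0 := by simpa using hp
  rw [eLpNorm_eq_lintegral_rpow_enorm_toReal hp0 ENNReal.ofReal_ne_top,
    eLpNorm_eq_lintegral_rpow_enorm_toReal hp0 ENNReal.ofReal_ne_top, ENNReal.toReal_ofReal hp.le]
  have h1 : ∫⁻ z, ‖f (x + s • z)‖ₑ ^ p = ENNReal.ofReal (s ^ (-(n : ℝ))) * ∫⁻ z, ‖f z‖ₑ ^ p := by
    have hm : Measurable fun z => ‖f (x + z)‖ₑ ^ p :=
      (Continuous.measurable (by fun_prop :
        Continuous fun z => ‖f (x + z)‖ₑ)).pow_const _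
    have h2 := lintegral_map (μ := volume) hm (measurable_const_smul s)
    rw [← h2, Measure.map_addHaar_smul volume hs.ne', lintegral_smul_measure,
      lintegral_add_left_eq_self (fun z => ‖f z‖ₑ ^ p) x, smul_eq_mul]
    congr 2
    rw [finrank_euclideanSpace_fin, abs_of_pos (by positivity), Real.rpow_neg hs.le,
      Real.rpow_natCast]
  rw [h1, ENNReal.mul_rpow_of_nonneg _ _ (by positivity),
    ENNReal.ofReal_rpow_of_pos (by positivity), ← Real.rpow_mul hs.le]
  congr 3
  ring

theorem lintegral_ball_gradient_le {w : (𝔼 n) → ℝ} (hw : ContDiff ℝ ∞ w) (x : 𝔼 n) {s : ℝ}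
    (hs : 0 < s) {p : ℝ} (hp : 1 ≤ p) :
    ∫⁻ z in Metric.ball 0 1, ‖gradient w (x + s • z)‖ₑ ≤
      ENNReal.ofReal (s ^ (-(n : ℝ) / p)) * (eLpNorm (gradient w) (ENNReal.ofReal p) volume *
        volume (Metric.ball (0 : 𝔼 n) 1) ^ (1 - 1 / p)) := by
  have hc : Continuous fun z => gradient w (x + s • z) :=
    (continuous_gradient hw).comp (by fun_prop)
  have hp1 : 1 ≤ ENNReal.ofReal p := by simpa using hp
  have h1 := eLpNorm_le_eLpNorm_mul_rpow_measure_univ (μ := volume.restrict (Metric.ball (0 : 𝔼 n) 1))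
    hp1 (hc.aestronglyMeasurable)
  rw [eLpNorm_one_eq_lintegral_enorm, Measure.restrict_apply_univ,
    ENNReal.toReal_ofReal (by linarith), ENNReal.toReal_one, div_one] at h1
  refine h1.trans ?_
  rw [← mul_assoc, ← eLpNorm_comp_add_smul (continuous_gradient hw) x hs (by linarith)]
  gcongr
  exact Measure.restrict_le_self

theorem lintegral_Ioc_rpow {a r : ℝ} (ha : -1 < a) (hr : 0 < r) :
    ∫⁻ s in Ioc 0 r, ENNReal.ofReal (s ^ a) = ENNReal.ofReal (r ^ (a + 1) / (a + 1)) := by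
  have hi : IntervalIntegrable (fun s : ℝ => s ^ a) volume 0 r :=
    intervalIntegral.intervalIntegrable_rpow' ha
  rw [← ofReal_integral_eq_lintegral_ofReal
    ((intervalIntegrable_iff_integrableOn_Ioc_of_le hr.le).1 hi)
    ((ae_restrict_mem measurableSet_Ioc).mono fun s hs => Real.rpow_nonneg hs.1.le _),
    ← intervalIntegral.integral_of_le hr.le, integral_rpow (Or.inl ha),
    Real.zero_rpow (by linarith), sub_zero]

/-- The fundamental theorem of calculus along segments is averaged over directions. After Tonelli,
Hölder and scaling leave the factor `s ^ (-n / p)`, integrable at 0 because `p > n`. -/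
theorem lintegral_ball_sub_le {w : (𝔼 n) → ℝ} (hw : ContDiff ℝ ∞ w) (x : 𝔼 n) {r : ℝ}
    (hr : 0 < r) {p : ℝ} (hp : 1 ≤ p) (hnp : (n : ℝ) < p) :
    ∫⁻ z in Metric.ball 0 1, ‖w (x + r • z) - w x‖ₑ ≤
      ENNReal.ofReal (r ^ (1 - (n : ℝ) / p) / (1 - (n : ℝ) / p)) *
        (eLpNorm (gradient w) (ENNReal.ofReal p) volume *
          volume (Metric.ball (0 : 𝔼 n) 1) ^ (1 - 1 / p)) := by
  have hp0 : 0 < p := by linarith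
  have ha : -1 < -(n : ℝ) / p := by
    rw [lt_div_iff₀ hp0]; linarith
  have hea : -(n : ℝ) / p + 1 = 1 - (n : ℝ) / p := by ring
  rw [← hea, ← lintegral_Ioc_rpow ha hr]
  calc _ ≤ ∫⁻ z in Metric.ball 0 1, ∫⁻ s in Ioc 0 r, ‖gradient w (x + s • z)‖ₑ := by
        refine setLIntegral_mono' Metric.isOpen_ball.measurableSet fun z hz => ?_
        exact enorm_sub_le_lintegral_gradient hw x z hr (mem_ball_zero_iff.1 hz).le
    _ = ∫⁻ s in Ioc 0 r, ∫⁻ z in Metric.ball 0 1, ‖gradient w (x + s • z)‖ₑ := by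
        refine lintegral_lintegral_swap (Continuous.aemeasurable ?_)
        exact ((continuous_gradient hw).comp (by fun_prop)).enorm
    _ ≤ ∫⁻ s in Ioc 0 r, ENNReal.ofReal (s ^ (-(n : ℝ) / p)) *
          (eLpNorm (gradient w) (ENNReal.ofReal p) volume *
            volume (Metric.ball (0 : 𝔼 n) 1) ^ (1 - 1 / p)) :=
        setLIntegral_mono' measurableSet_Ioc fun s hs => lintegral_ball_gradient_le hw x hs.1 hp
    _ = _ := lintegral_mul_const _ (by fun_prop)

/-- The ball of radius `r / 2` about the midpoint lies in the ball of radius `r` about `x`, and by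
symmetry in the one about `y`. In rescaled coordinates the inclusion is a translation by `e`. -/
theorem lintegral_half_ball_le {w : (𝔼 n) → ℝ} (x y : 𝔼 n) {r : ℝ} (hr : 0 < r)
    (hxy : ‖y - x‖ ≤ r) :
    ∫⁻ z in Metric.ball 0 (1 / 2), ‖w ((1 / 2 : ℝ) • (x + y) + r • z) - w x‖ₑ ≤
      ∫⁻ z in Metric.ball 0 1, ‖w (x + r • z) - w x‖ₑ := by
  set e : 𝔼 n := (1 / (2 * r)) • (y - x) with he
  have hne : ‖e‖ ≤ 1 / 2 := by
    rw [he, norm_smul, Real.norm_of_nonneg (by positivity), div_mul_eq_mul_div, one_mul,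
      div_le_iff₀ (by positivity)]
    linarith
  have hre : r • e = (1 / 2 : ℝ) • (y - x) := by
    rw [he, smul_smul]; congr 1; field_simp
  rw [← lintegral_indicator Metric.isOpen_ball.measurableSet,
    ← lintegral_indicator Metric.isOpen_ball.measurableSet,
    ← lintegral_add_right_eq_self ((Metric.ball (0 : 𝔼 n) 1).indicator _) e]
  refine lintegral_mono fun z => ?_
  by_cases hz : z ∈ Metric.ball (0 : 𝔼 n) (1 / 2)
  · have hz' : z + e ∈ Metric.ball (0 : 𝔼 n) 1 := by
      rw [mem_ball_zero_iff] at hz ⊢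
      linarith [norm_add_le z e]
    rw [indicator_of_mem hz, indicator_of_mem hz']
    have : (1 / 2 : ℝ) • (x + y) + r • z = x + r • (z + e) := by
      rw [smul_add r z e, hre]; module
    rw [this]
  · rw [indicator_of_notMem hz]; exact zero_le

/-- Morrey's inequality for smooth functions. -/
theorem exists_morrey_smooth (n : ℕ) {p : ℝ} (hp : 1 ≤ p) (hnp : (n : ℝ) < p) :
    ∃ M : ℝ, 0 ≤ M ∧ ∀ w : (𝔼 n) → ℝ, ContDiff ℝ ∞ w →
      eLpNorm (gradient w) (ENNReal.ofReal p) volume ≠ ⊤ → ∀ x y,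
        |w x - w y| ≤ M * ‖x - y‖ ^ (1 - (n : ℝ) / p) *
          (eLpNorm (gradient w) (ENNReal.ofReal p) volume).toReal := by
  set β : ℝ≥0∞ := volume (Metric.ball (0 : 𝔼 n) (1 / 2)) with hβ
  set γ : ℝ≥0∞ := volume (Metric.ball (0 : 𝔼 n) 1) ^ (1 - 1 / p) with hγ
  have hβ0 : β ≠ 0 := (Metric.measure_ball_pos _ _ (by norm_num)).ne'
  have hβt : β ≠ ⊤ := measure_ball_lt_top.ne
  have hp0 : 0 < p := by linarith
  have hγt : γ ≠ ⊤ := by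
    refine ENNReal.rpow_ne_top_of_nonneg ?_ measure_ball_lt_top.ne
    rw [sub_nonneg, div_le_one hp0]; exact hp
  have ha : 0 < 1 - (n : ℝ) / p := by
    rw [sub_pos, div_lt_one hp0]; exact hnp
  -- Both `w x` and `w y` are compared with the values of `w` on the common half ball: two
  -- estimates, divided by the volume `β` of that ball.
  refine ⟨2 * γ.toReal / (1 - (n : ℝ) / p) / β.toReal, by positivity, fun w hw hN x y => ?_⟩
  set N := eLpNorm (gradient w) (ENNReal.ofReal p) volume with hNdef
  by_cases hxy : x = y
  · subst hxy
    simp only [sub_self, abs_zero, norm_zero]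
    positivity
  set r := ‖x - y‖ with hr
  have hr0 : 0 < r := norm_pos_iff.2 (sub_ne_zero.2 hxy)
  have h1 := (lintegral_half_ball_le (w := w) x y hr0 (by rw [norm_sub_rev])).trans
    (lintegral_ball_sub_le hw x hr0 hp hnp)
  have h2 := (lintegral_half_ball_le (w := w) y x hr0 le_rfl).trans
    (lintegral_ball_sub_le hw y hr0 hp hnp)
  rw [add_comm y x] at h2
  set R : ℝ := r ^ (1 - (n : ℝ) / p) / (1 - (n : ℝ) / p) with hR
  have hR0 : 0 ≤ R := by positivity
  have h3 : ‖w x - w y‖ₑ * β ≤ 2 * (ENNReal.ofReal R * (N * γ)) := by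
    calc ‖w x - w y‖ₑ * β = ∫⁻ _ in Metric.ball (0 : 𝔼 n) (1 / 2), ‖w x - w y‖ₑ := by
          rw [setLIntegral_const]
      _ ≤ ∫⁻ z in Metric.ball (0 : 𝔼 n) (1 / 2), (‖w ((1 / 2 : ℝ) • (x + y) + r • z) - w x‖ₑ +
            ‖w ((1 / 2 : ℝ) • (x + y) + r • z) - w y‖ₑ) := by
          refine lintegral_mono fun z => ?_
          have : w x - w y = (w ((1 / 2 : ℝ) • (x + y) + r • z) - w y) -
            (w ((1 / 2 : ℝ) • (x + y) + r • z) - w x) := by ring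
          rw [this]
          exact enorm_sub_le.trans_eq (add_comm _ _)
      _ = _ + _ := lintegral_add_left (Continuous.measurable
            (((hw.continuous.comp (by fun_prop)).sub continuous_const).enorm)) _
      _ ≤ _ := (add_le_add h1 h2).trans_eq (two_mul _).symm
  have h4 := ENNReal.toReal_mono (by finiteness) h3
  simp only [ENNReal.toReal_mul, toReal_enorm, Real.norm_eq_abs, ENNReal.toReal_ofNat,
    ENNReal.toReal_ofReal hR0] at h4
  have hβp : 0 < β.toReal := ENNReal.toReal_pos hβ0 hβt
  rw [← le_div_iff₀ hβp] at h4
  refine h4.trans_eq ?_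
  rw [hR]; ring

/-- Morrey's inequality. -/
theorem exists_morrey (n : ℕ) {p : ℝ} (hp : 1 ≤ p) (hnp : (n : ℝ) < p) :
    ∃ M : ℝ, 0 ≤ M ∧ ∀ (w : (𝔼 n) → ℝ) (G : (𝔼 n) → (𝔼 n)), Continuous w → HasCompactSupport w →
      HasWeakGradient univ w G → MemLp G (ENNReal.ofReal p) volume → ∀ x y,
        |w x - w y| ≤ M * ‖x - y‖ ^ (1 - (n : ℝ) / p) *
          (eLpNorm G (ENNReal.ofReal p) volume).toReal := by
  obtain ⟨M, hM, h⟩ := exists_morrey_smooth n hp hnp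
  refine ⟨M, hM, fun w G hw hc hwG hG x y => ?_⟩
  have hp1 : 1 ≤ ENNReal.ofReal p := by simpa using hp
  set A := M * ‖x - y‖ ^ (1 - (n : ℝ) / p) with hA
  have hA0 : 0 ≤ A := by positivity
  set N := (eLpNorm G (ENNReal.ofReal p) volume).toReal with hN
  have key : ∀ ε > 0, |w x - w y| ≤ A * (N + ε) + 2 * ε := by
    intro ε hε
    obtain ⟨η, e1, e2, -, e4, e5, -⟩ := exists_smooth_approx hw hc hwG hp1 ENNReal.ofReal_ne_top
      hG hε
    have hle : eLpNorm (gradient η) (ENNReal.ofReal p) volume ≤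
        eLpNorm G (ENNReal.ofReal p) volume + ENNReal.ofReal ε := by
      calc _ = eLpNorm (G + fun x => gradient η x - G x) (ENNReal.ofReal p) volume := by
            congr 1; ext1 x; simp
        _ ≤ _ := (eLpNorm_add_le hG.1 ((continuous_gradient e1).aestronglyMeasurable.sub hG.1)
            hp1).trans (add_le_add_right e5 _)
    have hfin : eLpNorm G (ENNReal.ofReal p) volume + ENNReal.ofReal ε ≠ ⊤ :=
      ENNReal.add_ne_top.2 ⟨hG.2.ne, ENNReal.ofReal_ne_top⟩
    have h1 := h η e1 (ne_top_of_le_ne_top hfin hle) x y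
    have h2 := ENNReal.toReal_mono hfin hle
    rw [ENNReal.toReal_add hG.2.ne ENNReal.ofReal_ne_top, ENNReal.toReal_ofReal hε.le] at h2
    have h3 := h1.trans (mul_le_mul_of_nonneg_left h2 hA0)
    have a1 := abs_le.1 (e4 x)
    have a2 := abs_le.1 (e4 y)
    have a3 := abs_le.1 h3
    rw [abs_le]
    constructor <;> linarith [a1.1, a1.2, a2.1, a2.2, a3.1, a3.2]
  -- The total error in `key` is `(A + 2) * ε`, whence the divisor.
  refine le_of_forall_pos_le_add fun ε hε => (key (ε / (A + 2)) (by positivity)).trans_eq ?_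
  field_simp
  ring

/-- A continuous compactly supported function with bounded weak gradient is Lipschitz. -/
theorem abs_sub_le_of_weakGradient_bounded {w : (𝔼 n) → ℝ} {G : (𝔼 n) → (𝔼 n)} (hw : Continuous w)
    (hc : HasCompactSupport w) (h : HasWeakGradient univ w G) (hG : Integrable G) {L : ℝ}
    (hL : ∀ᵐ x, ‖G x‖ ≤ L) (x y : 𝔼 n) : |w x - w y| ≤ L * ‖x - y‖ := by
  refine le_of_forall_pos_le_add fun ε hε => ?_
  obtain ⟨η, e1, -, -, e4, -, e6⟩ := exists_smooth_approx hw hc h le_rfl ENNReal.one_ne_top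
    (memLp_one_iff_integrable.2 hG) (ε := ε / 2) (by positivity)
  have h1 : |η x - η y| ≤ L * ‖x - y‖ := Convex.norm_image_sub_le_of_norm_fderiv_le (𝕜 := ℝ)
    (s := univ) (fun x _ => e1.differentiable (by simp) x)
    (fun x _ => by rw [← norm_gradient]; exact e6 L hL x) convex_univ (mem_univ y) (mem_univ x)
  have a1 := abs_le.1 (e4 x)
  have a2 := abs_le.1 (e4 y)
  have a3 := abs_le.1 h1
  rw [abs_le]
  constructor <;> linarith [a1.1, a1.2, a2.1, a2.2, a3.1, a3.2]

end Morrey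

/-! ### Pointwise inequalities for the `p`-Laplace operator -/

section Pointwise

variable {V : Type*} [NormedAddCommGroup V] [InnerProductSpace ℝ V] {p : ℝ}

/-- Clarkson's inequality for `p ≥ 2` in an inner product space. -/
theorem clarkson (hp : 2 ≤ p) (a b : V) :
    ‖(1 / 2 : ℝ) • (a + b)‖ ^ p + ‖(1 / 2 : ℝ) • (a - b)‖ ^ p ≤ (‖a‖ ^ p + ‖b‖ ^ p) / 2 := by
  have hsq : ∀ x : V, ‖x‖ ^ p = (‖x‖ ^ 2) ^ (p / 2) := fun x => by
    rw [← Real.rpow_natCast, ← Real.rpow_mul (norm_nonneg _)]; congr 1; push_cast; ring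
  have h1 : ‖(1 / 2 : ℝ) • (a + b)‖ ^ 2 + ‖(1 / 2 : ℝ) • (a - b)‖ ^ 2 =
      (1 / 2) * ‖a‖ ^ 2 + (1 / 2) * ‖b‖ ^ 2 := by
    have := parallelogram_law_with_norm ℝ a b
    rw [norm_smul, norm_smul, Real.norm_of_nonneg (by norm_num)]
    linarith
  rw [hsq, hsq, hsq a, hsq b]
  -- Here `p ≥ 2` enters: the power `p / 2` is superadditive, which combines the squares for the
  -- parallelogram law, and it is convex, which separates them again.
  refine (Real.add_rpow_le_rpow_add (by positivity) (by positivity) (by linarith)).trans ?_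
  rw [h1]
  have h2 := (convexOn_rpow (p := p / 2) (by linarith)).2 (mem_Ici.2 (sq_nonneg ‖a‖))
    (mem_Ici.2 (sq_nonneg ‖b‖)) (show (0 : ℝ) ≤ 1 / 2 by norm_num)
    (show (0 : ℝ) ≤ 1 / 2 by norm_num) (by norm_num)
  simp only [smul_eq_mul] at h2
  linarith

/-- The field `|a|^{p-2} a`. -/
noncomputable def pField (p : ℝ) (a : V) : V := ‖a‖ ^ (p - 2) • a

theorem continuous_pField (hp : 2 ≤ p) : Continuous (pField p : V → V) :=
  (continuous_norm.rpow_const fun _ => Or.inr (by linarith)).smul continuous_id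

theorem norm_pField (hp : 2 ≤ p) (a : V) : ‖pField p a‖ = ‖a‖ ^ (p - 1) := by
  rw [pField, norm_smul, Real.norm_of_nonneg (by positivity)]
  by_cases ha : a = 0
  · rw [ha, norm_zero, mul_zero, Real.zero_rpow (by linarith)]
  · rw [← Real.rpow_add_one (norm_ne_zero_iff.2 ha)]; congr 1; ring

theorem inner_pField_self (hp : 2 ≤ p) (a : V) : inner ℝ (pField p a) a = ‖a‖ ^ p := by
  rw [pField, real_inner_smul_left, real_inner_self_eq_norm_sq]
  by_cases ha : a = 0
  · rw [ha, norm_zero, Real.zero_rpow (show p ≠ 0 by linarith)]; simp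
  · rw [← Real.rpow_natCast, ← Real.rpow_add (norm_pos_iff.2 ha)]; congr 1; push_cast; ring

/-- The tangent-plane inequality for `|·|^p`, obtained from Cauchy–Schwarz and Young rather than by
differentiation. -/
theorem rpow_convexity (hp : 2 ≤ p) (a b : V) :
    ‖a‖ ^ p + p * inner ℝ (pField p a) (b - a) ≤ ‖b‖ ^ p := by
  have hc : p.HolderConjugate (p / (p - 1)) := Real.HolderConjugate.conjExponent (by linarith)
  have h1 := Real.young_inequality_of_nonneg (norm_nonneg b)
    (show 0 ≤ ‖a‖ ^ (p - 1) by positivity) hc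
  have h2 : (‖a‖ ^ (p - 1)) ^ (p / (p - 1)) = ‖a‖ ^ p := by
    rw [← Real.rpow_mul (norm_nonneg _)]; congr 1; field_simp [show p - 1 ≠ 0 by linarith]
  have h3 : inner ℝ (pField p a) b ≤ ‖a‖ ^ (p - 1) * ‖b‖ := by
    have := real_inner_le_norm (pField p a) b
    rwa [norm_pField hp] at this
  rw [h2] at h1
  have h4 : p * (‖b‖ ^ p / p + ‖a‖ ^ p / (p / (p - 1))) = ‖b‖ ^ p + (p - 1) * ‖a‖ ^ p := by
    field_simp
  rw [inner_sub_right, inner_pField_self hp]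
  have h5 : p * inner ℝ (pField p a) b ≤ ‖b‖ ^ p + (p - 1) * ‖a‖ ^ p := by
    rw [← h4]
    refine mul_le_mul_of_nonneg_left (h3.trans ?_) (by linarith)
    linarith
  linarith

/-- Strong monotonicity. -/
theorem pField_monotone (hp : 2 ≤ p) (a b : V) :
    4 * ‖(1 / 2 : ℝ) • (a - b)‖ ^ p ≤ p * inner ℝ (pField p a - pField p b) (a - b) := by
  -- The tangent planes at `a` and at `b` are both evaluated at the midpoint and summed; Clarkson
  -- bounds the midpoint from above and leaves the gain.
  have h1 := rpow_convexity hp a ((1 / 2 : ℝ) • (a + b))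
  have h2 := rpow_convexity hp b ((1 / 2 : ℝ) • (a + b))
  have h3 := clarkson hp a b
  have e1 : (1 / 2 : ℝ) • (a + b) - a = (-1 / 2 : ℝ) • (a - b) := by module
  have e2 : (1 / 2 : ℝ) • (a + b) - b = (1 / 2 : ℝ) • (a - b) := by module
  rw [e1, inner_smul_right] at h1
  rw [e2, inner_smul_right] at h2
  rw [inner_sub_left]
  linarith

theorem pField_inner_nonneg (hp : 2 ≤ p) (a b : V) :
    0 ≤ inner ℝ (pField p a - pField p b) (a - b) := by
  have h := pField_monotone hp a b
  have h0 : 0 ≤ ‖(1 / 2 : ℝ) • (a - b)‖ ^ p := by positivity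
  have : 0 ≤ p * inner ℝ (pField p a - pField p b) (a - b) := by linarith
  exact nonneg_of_mul_nonneg_right this (by linarith)

theorem eq_of_pField_inner_eq_zero (hp : 2 ≤ p) {a b : V}
    (h0 : inner ℝ (pField p a - pField p b) (a - b) = 0) : a = b := by
  have h := pField_monotone hp a b
  rw [h0, mul_zero] at h
  have h1 : ‖(1 / 2 : ℝ) • (a - b)‖ ^ p = 0 := le_antisymm (by linarith) (by positivity)
  rw [Real.rpow_eq_zero (norm_nonneg _) (by linarith), norm_eq_zero, smul_eq_zero] at h1
  exact sub_eq_zero.1 (h1.resolve_left (by norm_num))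

end Pointwise

/-! ### Sobolev functions with prescribed boundary values -/

section Admissible

variable {n : ℕ} {Ω : Set (EuclideanSpace ℝ (Fin n))} {g u v : EuclideanSpace ℝ (Fin n) → ℝ}
  {G : EuclideanSpace ℝ (Fin n) → EuclideanSpace ℝ (Fin n)}

theorem MemCSobolev.hasWeakGradient {p : ℝ≥0∞} (h : MemCSobolev Ω p u) :
    HasWeakGradient Ω u (weakGrad Ω u) :=
  let ⟨_, hG, _⟩ := h.2.2
  weakGrad_spec hG

theorem MemCSobolev.memLp (hΩ : IsOpen Ω) {p : ℝ≥0∞} (h : MemCSobolev Ω p u) :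
    MemLp (weakGrad Ω u) p (volume.restrict Ω) := by
  obtain ⟨G, hG, hGp⟩ := h.2.2
  exact (memLp_congr_ae (weakGrad_ae_eq hΩ hG)).2 hGp

theorem isFiniteMeasure_restrict (hb : Bornology.IsBounded Ω) :
    IsFiniteMeasure (volume.restrict Ω : Measure (𝔼 n)) :=
  ⟨by simpa using hb.measure_lt_top⟩

theorem memCSobolev_of_hasWeakGradient (hΩ : IsOpen Ω) (hb : Bornology.IsBounded Ω) {p : ℝ≥0∞}
    (hu : ContinuousOn u (closure Ω)) (h : HasWeakGradient Ω u G)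
    (hG : MemLp G p (volume.restrict Ω)) : MemCSobolev Ω p u := by
  have := isFiniteMeasure_restrict hb
  obtain ⟨C, hC⟩ := hb.isCompact_closure.exists_bound_of_continuousOn hu
  refine ⟨hu, MemLp.of_bound ((hu.mono subset_closure).aestronglyMeasurable hΩ.measurableSet) C ?_,
    G, h, hG⟩
  exact (ae_restrict_mem hΩ.measurableSet).mono fun x hx => hC x (subset_closure hx)

theorem exists_notMem_of_isBounded (hn : 1 ≤ n) (hb : Bornology.IsBounded Ω) :
    ∃ y : 𝔼 n, y ∉ Ω := by
  by_contra! h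
  have : Nonempty (Fin n) := ⟨⟨0, hn⟩⟩
  have hne : Nontrivial (𝔼 n) := inferInstance
  have : NoncompactSpace (𝔼 n) := NormedSpace.noncompactSpace ℝ (𝔼 n)
  have hu : Ω = univ := eq_univ_of_forall h
  have := hb.isCompact_closure
  rw [hu, closure_univ] at this
  exact noncompact_univ _ this

/-- Morrey's inequality for functions vanishing on the boundary. -/
theorem exists_morrey_zero (n : ℕ) {p : ℝ} (hp : 1 ≤ p) (hnp : (n : ℝ) < p) :
    ∃ M : ℝ, 0 ≤ M ∧ ∀ (Ω : Set (𝔼 n)) (w : (𝔼 n) → ℝ) (G : (𝔼 n) → (𝔼 n)), IsOpen Ω →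
      Bornology.IsBounded Ω → ContinuousOn w (closure Ω) → (∀ x ∈ frontier Ω, w x = 0) →
      HasWeakGradient Ω w G → MemLp G (ENNReal.ofReal p) (volume.restrict Ω) → ∀ x y,
        |Ω.indicator w x - Ω.indicator w y| ≤ M * ‖x - y‖ ^ (1 - (n : ℝ) / p) *
          (eLpNorm G (ENNReal.ofReal p) (volume.restrict Ω)).toReal := by
  obtain ⟨M, hM, h⟩ := exists_morrey n hp hnp
  refine ⟨M, hM, fun Ω w G hΩ hb hw hw0 hwG hG x y => ?_⟩
  have hp1 : 1 ≤ ENNReal.ofReal p := by simpa using hp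
  have := h _ _ (continuous_indicator_zero hw hw0) (hasCompactSupport_indicator hb w)
    (hwG.indicator hΩ hb hw hw0 (MemLp.integrableOn_of_isBounded hb hp1 hG))
    ((memLp_indicator_iff_restrict hΩ.measurableSet).2 hG) x y
  rwa [eLpNorm_indicator_eq_eLpNorm_restrict hΩ.measurableSet] at this

/-- Morrey's inequality between a point of Ω and a fixed point outside, where the zero extension
vanishes. Such a point exists because `n ≥ 1` and Ω is bounded. -/
theorem exists_sup_bound (hn : 1 ≤ n) (hΩ : IsOpen Ω) (hb : Bornology.IsBounded Ω) {p : ℝ}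
    (hp : 1 ≤ p) (hnp : (n : ℝ) < p) :
    ∃ M : ℝ, 0 ≤ M ∧ ∀ (w : (𝔼 n) → ℝ) (G : (𝔼 n) → (𝔼 n)),
      ContinuousOn w (closure Ω) → (∀ x ∈ frontier Ω, w x = 0) →
      HasWeakGradient Ω w G → MemLp G (ENNReal.ofReal p) (volume.restrict Ω) → ∀ x ∈ closure Ω,
        |w x| ≤ M * (eLpNorm G (ENNReal.ofReal p) (volume.restrict Ω)).toReal := by
  obtain ⟨M, hM, h⟩ := exists_morrey_zero n hp hnp
  obtain ⟨y, hy⟩ := exists_notMem_of_isBounded hn hb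
  obtain ⟨R, hR⟩ := hb.subset_closedBall y
  have ha : 0 < 1 - (n : ℝ) / p := by
    rw [sub_pos, div_lt_one (by linarith)]; exact hnp
  refine ⟨M * (max R 0) ^ (1 - (n : ℝ) / p), by positivity, fun w G hw hw0 hwG hG x hx => ?_⟩
  by_cases hxΩ : x ∈ Ω
  · have := h Ω w G hΩ hb hw hw0 hwG hG x y
    rw [indicator_of_mem hxΩ, indicator_of_notMem hy, sub_zero] at this
    refine this.trans ?_
    gcongr
    have := hR hxΩ
    rw [Metric.mem_closedBall, dist_eq_norm] at this
    exact this.trans (le_max_left _ _)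
  · have : x ∈ frontier Ω := by rw [hΩ.frontier_eq]; exact ⟨hx, hxΩ⟩
    rw [hw0 x this, abs_zero]
    positivity

/-- A Sobolev function vanishing on the boundary whose gradient vanishes is zero. -/
theorem eq_zero_of_weakGradient_eq_zero (hn : 1 ≤ n) (hΩ : IsOpen Ω) (hb : Bornology.IsBounded Ω)
    (hu : ContinuousOn u (closure Ω)) (hu0 : ∀ x ∈ frontier Ω, u x = 0)
    (h : HasWeakGradient Ω u G) (hG : G =ᵐ[volume.restrict Ω] 0) : ∀ x ∈ closure Ω, u x = 0 := by
  -- A zero gradient lies in every `L^p`, so any exponent above `n` would do.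
  have hp : (1 : ℝ) ≤ (n : ℝ) + 1 := by linarith [Nat.cast_nonneg (α := ℝ) n]
  obtain ⟨M, -, hM⟩ := exists_sup_bound hn hΩ hb hp (lt_add_one _)
  intro x hx
  have := hM u G hu hu0 h ((memLp_congr_ae hG).2 MemLp.zero) x hx
  rw [eLpNorm_congr_ae hG, eLpNorm_zero, ENNReal.toReal_zero, mul_zero] at this
  exact abs_eq_zero.1 (le_antisymm this (abs_nonneg _))

/-- Uniform limits of Sobolev functions whose gradients converge in mean. -/
theorem HasWeakGradient.of_tendstoUniformlyOn (hΩ : IsOpen Ω) {w : ℕ → (𝔼 n) → ℝ}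
    {F : ℕ → (𝔼 n) → (𝔼 n)} (h : ∀ k, HasWeakGradient Ω (w k) (F k))
    (hu : ContinuousOn u Ω) (hwu : TendstoUniformlyOn w u atTop Ω)
    (hF : ∀ k, IntegrableOn (F k) Ω volume) (hG : IntegrableOn G Ω volume)
    (hFG : Tendsto (fun k => eLpNorm (F k - G) 1 (volume.restrict Ω)) atTop (𝓝 0)) :
    HasWeakGradient Ω u G := by
  refine HasWeakGradient.of_tendsto h (hu.locallyIntegrableOn hΩ.measurableSet)
    hG.locallyIntegrableOn ?_ ?_
  · intro ψ hψ hψc hψs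
    have hψu := continuous_mul_of_tsupport_subset hΩ hu hψ hψs
    refine tendsto_integral_filter_of_dominated_convergence (fun x => |ψ x * u x| + |ψ x|)
      (Eventually.of_forall fun k => ?_) ?_ ?_ ?_
    · exact (integrable_smul_of_tsupport_subset (h k).1 hψ hψc hψs).1
    · filter_upwards [Metric.tendstoUniformlyOn_iff.1 hwu 1 one_pos] with k hk
      refine ae_of_all _ fun x => ?_
      by_cases hx : x ∈ Ω
      · have h1 := hk x hx
        rw [dist_comm, Real.dist_eq] at h1
        have h2 : ψ x * w k x = ψ x * u x + ψ x * (w k x - u x) := by ring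
        rw [h2, Real.norm_eq_abs]
        refine (abs_add_le _ _).trans ?_
        rw [abs_mul (ψ x) (w k x - u x)]
        nlinarith [abs_nonneg (ψ x)]
      · simp [image_eq_zero_of_notMem_tsupport (fun h' => hx (hψs h'))]
    · exact (Continuous.integrable_of_hasCompactSupport hψu hψc.mul_right).abs.add
        (hψ.integrable_of_hasCompactSupport hψc).abs
    · refine ae_of_all _ fun x => ?_
      by_cases hx : x ∈ Ω
      · exact (hwu.tendsto_at hx).const_mul _
      · simp [image_eq_zero_of_notMem_tsupport (fun h' => hx (hψs h'))]
  · intro ψ hψ hψc hψs i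
    obtain ⟨B, hB⟩ := hψc.exists_bound_of_continuous hψ
    have hB0 : 0 ≤ B := (norm_nonneg _).trans (hB 0)
    rw [tendsto_iff_norm_sub_tendsto_zero]
    have hlim : Tendsto (fun k => B * (eLpNorm (F k - G) 1 (volume.restrict Ω)).toReal) atTop
        (𝓝 0) := by
      simpa using ((ENNReal.tendsto_toReal ENNReal.zero_ne_top).comp hFG).const_mul B
    refine squeeze_zero (fun _ => norm_nonneg _) (fun k => ?_) hlim
    have i1 := integrable_smul_of_tsupport_subset (locallyIntegrableOn_coord (h k).2.1 i) hψ hψc hψs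
    have i2 := integrable_smul_of_tsupport_subset
      (locallyIntegrableOn_coord hG.locallyIntegrableOn i) hψ hψc hψs
    simp only [smul_eq_mul] at i1 i2
    rw [← integral_sub i1 i2]
    have hi : Integrable (F k - G) (volume.restrict Ω) := (hF k).sub hG
    have e : ∫ x, (ψ x * F k x i - ψ x * G x i) = ∫ x in Ω, ψ x * ((F k - G) x i) := by
      have := setIntegral_smul_eq_integral (fun x => (F k - G) x i) hψs
      simp only [smul_eq_mul] at this
      rw [this]
      refine integral_congr_ae (ae_of_all _ fun x => ?_)
      simp [mul_sub]
    rw [e, eLpNorm_one_eq_lintegral_enorm, ← integral_norm_eq_lintegral_enorm hi.1,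
      ← integral_const_mul]
    refine norm_integral_le_of_norm_le (hi.norm.const_mul _) (ae_of_all _ fun x => ?_)
    rw [norm_mul]
    exact mul_le_mul (hB x) (PiLp.norm_apply_le _ i) (norm_nonneg _) hB0

end Admissible

/-! ### Minimizers of the `p`-energy -/

theorem integral_norm_rpow_eq {α F : Type*} [MeasurableSpace α] {μ : Measure α}
    [NormedAddCommGroup F] {f : α → F} {p : ℝ} (hp : 0 < p) (hf : MemLp f (ENNReal.ofReal p) μ) :
    ∫ x, ‖f x‖ ^ p ∂μ = (eLpNorm f (ENNReal.ofReal p) μ).toReal ^ p := by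
  have h := hf.eLpNorm_eq_integral_rpow_norm (by simpa using hp) ENNReal.ofReal_ne_top
  rw [ENNReal.toReal_ofReal hp.le] at h
  have h0 : 0 ≤ ∫ x, ‖f x‖ ^ p ∂μ := integral_nonneg fun x => by positivity
  rw [h, ENNReal.toReal_ofReal (by positivity), ← Real.rpow_mul h0, inv_mul_cancel₀ hp.ne',
    Real.rpow_one]

theorem integrable_norm_rpow_ofReal {α F : Type*} [MeasurableSpace α] {μ : Measure α}
    [NormedAddCommGroup F] {f : α → F} {p : ℝ} (hp : 0 < p) (hf : MemLp f (ENNReal.ofReal p) μ) :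
    Integrable (fun x => ‖f x‖ ^ p) μ := by
  have := hf.integrable_norm_rpow (by simpa using hp) ENNReal.ofReal_ne_top
  rwa [ENNReal.toReal_ofReal hp.le] at this

section Minimizers

variable {n : ℕ} {Ω : Set (EuclideanSpace ℝ (Fin n))} {g u v : EuclideanSpace ℝ (Fin n) → ℝ}
  {G : EuclideanSpace ℝ (Fin n) → EuclideanSpace ℝ (Fin n)} {p : ℝ}

theorem pEnergy_eq (hΩ : IsOpen Ω) (h : HasWeakGradient Ω u G) :
    pEnergy Ω p u = ∫ x in Ω, ‖G x‖ ^ p :=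
  integral_congr_ae ((weakGrad_ae_eq hΩ h).mono fun x hx => by simp only [hx])

theorem pEnergy_eq_rpow (hΩ : IsOpen Ω) (hp : 0 < p) (h : MemCSobolev Ω (ENNReal.ofReal p) u) :
    pEnergy Ω p u = (eLpNorm (weakGrad Ω u) (ENNReal.ofReal p) (volume.restrict Ω)).toReal ^ p :=
  integral_norm_rpow_eq hp (h.memLp hΩ)

/-- The midpoint of `u` and `v` is admissible, so its energy is at least `m`, and integrated
Clarkson leaves only the excess for the difference. With `m` the minimum this gives uniqueness;
along a minimizing sequence it gives the Cauchy property. -/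
theorem integral_sub_le_of_le_pEnergy (hΩ : IsOpen Ω) (hb : Bornology.IsBounded Ω) (hp : 2 ≤ p)
    {m : ℝ} (hm : ∀ v, IsAdmissible Ω (ENNReal.ofReal p) g v → m ≤ pEnergy Ω p v)
    (hu : IsAdmissible Ω (ENNReal.ofReal p) g u) (hv : IsAdmissible Ω (ENNReal.ofReal p) g v) :
    ∫ x in Ω, ‖weakGrad Ω u x - weakGrad Ω v x‖ ^ p ≤
      2 ^ p * ((pEnergy Ω p u + pEnergy Ω p v) / 2 - m) := by
  have hp0 : 0 < p := by linarith
  have hw : HasWeakGradient Ω ((1 / 2 : ℝ) • (u + v))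
      ((1 / 2 : ℝ) • (weakGrad Ω u + weakGrad Ω v)) :=
    (hu.1.hasWeakGradient.add hv.1.hasWeakGradient).const_smul _
  have hwp : MemLp ((1 / 2 : ℝ) • (weakGrad Ω u + weakGrad Ω v)) (ENNReal.ofReal p)
      (volume.restrict Ω) := ((hu.1.memLp hΩ).add (hv.1.memLp hΩ)).const_smul _
  have hwp' : MemLp ((1 / 2 : ℝ) • (weakGrad Ω u - weakGrad Ω v)) (ENNReal.ofReal p)
      (volume.restrict Ω) := ((hu.1.memLp hΩ).sub (hv.1.memLp hΩ)).const_smul _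
  have hadm : IsAdmissible Ω (ENNReal.ofReal p) g ((1 / 2 : ℝ) • (u + v)) := by
    refine ⟨memCSobolev_of_hasWeakGradient hΩ hb ((hu.1.1.add hv.1.1).const_smul _) hw hwp,
      fun x hx => ?_⟩
    simp only [Pi.smul_apply, Pi.add_apply, hu.2 hx, hv.2 hx, smul_eq_mul]
    ring
  have h1 := hm _ hadm
  rw [pEnergy_eq hΩ hw] at h1
  have i1 := integrable_norm_rpow_ofReal hp0 hwp
  have i2 := integrable_norm_rpow_ofReal hp0 hwp'
  have i3 := integrable_norm_rpow_ofReal hp0 (hu.1.memLp hΩ)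
  have i4 := integrable_norm_rpow_ofReal hp0 (hv.1.memLp hΩ)
  have h2 : (∫ x in Ω, ‖((1 / 2 : ℝ) • (weakGrad Ω u + weakGrad Ω v)) x‖ ^ p) +
      ∫ x in Ω, ‖((1 / 2 : ℝ) • (weakGrad Ω u - weakGrad Ω v)) x‖ ^ p ≤
      (pEnergy Ω p u + pEnergy Ω p v) / 2 := by
    rw [← integral_add i1 i2, pEnergy, pEnergy, ← integral_add i3 i4, ← integral_div]
    exact integral_mono (i1.add i2) ((i3.add i4).div_const 2) fun x => clarkson hp _ _
  have h3 : ∫ x in Ω, ‖weakGrad Ω u x - weakGrad Ω v x‖ ^ p =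
      2 ^ p * ∫ x in Ω, ‖((1 / 2 : ℝ) • (weakGrad Ω u - weakGrad Ω v)) x‖ ^ p := by
    rw [← integral_const_mul]
    refine integral_congr_ae (ae_of_all _ fun x => ?_)
    simp only [Pi.smul_apply, Pi.sub_apply, norm_smul]
    rw [← Real.mul_rpow (by norm_num) (by positivity), Real.norm_of_nonneg (by norm_num)]
    congr 1; ring
  rw [h3]
  refine mul_le_mul_of_nonneg_left ?_ (by positivity)
  linarith

theorem sub_boundary_zero (hu : EqOn u g (frontier Ω)) (hv : EqOn v g (frontier Ω)) :
    ∀ x ∈ frontier Ω, (u - v) x = 0 := fun x hx => by simp [hu hx, hv hx]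

theorem eqOn_of_weakGradient_ae_eq (hn : 1 ≤ n) (hΩ : IsOpen Ω) (hb : Bornology.IsBounded Ω)
    {q : ℝ≥0∞} (hu : IsAdmissible Ω q g u) (hv : IsAdmissible Ω q g v)
    (h : weakGrad Ω u =ᵐ[volume.restrict Ω] weakGrad Ω v) : EqOn u v (closure Ω) := by
  intro x hx
  have := eq_zero_of_weakGradient_eq_zero hn hΩ hb (hu.1.1.sub hv.1.1)
    (sub_boundary_zero hu.2 hv.2) (hu.1.hasWeakGradient.sub hv.1.hasWeakGradient)
    (h.mono fun x hx => by simp [hx]) x hx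
  exact sub_eq_zero.1 this

theorem IsPMinimizer.eqOn (hn : 1 ≤ n) (hΩ : IsOpen Ω) (hb : Bornology.IsBounded Ω) (hp : 2 ≤ p)
    (hu : IsPMinimizer Ω p g u) (hv : IsPMinimizer Ω p g v) : EqOn u v (closure Ω) := by
  have hp0 : 0 < p := by linarith
  have he : pEnergy Ω p u = pEnergy Ω p v := le_antisymm (hu.2 v hv.1) (hv.2 u hu.1)
  have h1 := integral_sub_le_of_le_pEnergy hΩ hb hp hu.2 hu.1 hv.1
  rw [← he, add_self_div_two, sub_self, mul_zero] at h1
  have hm : MemLp (fun x => weakGrad Ω u x - weakGrad Ω v x) (ENNReal.ofReal p)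
    (volume.restrict Ω) := (hu.1.1.memLp hΩ).sub (hv.1.1.memLp hΩ)
  have h2 : ∫ x in Ω, ‖weakGrad Ω u x - weakGrad Ω v x‖ ^ p = 0 :=
    le_antisymm h1 (integral_nonneg fun x => by positivity)
  rw [integral_eq_zero_iff_of_nonneg (fun x => by positivity)
    (integrable_norm_rpow_ofReal hp0 hm)] at h2
  refine eqOn_of_weakGradient_ae_eq hn hΩ hb hu.1 hv.1 (h2.mono fun x hx => ?_)
  simp only [Pi.zero_apply] at hx
  rw [Real.rpow_eq_zero (norm_nonneg _) hp0.ne', norm_eq_zero] at hx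
  exact sub_eq_zero.1 hx

/-- Existence of minimizers for `p > n`, `p ≥ 2`. -/
theorem exists_isPMinimizer (hn : 1 ≤ n) (hΩ : IsOpen Ω) (hb : Bornology.IsBounded Ω) (hp : 2 ≤ p)
    (hnp : (n : ℝ) < p) (hne : ∃ v, IsAdmissible Ω (ENNReal.ofReal p) g v) :
    ∃ u, IsPMinimizer Ω p g u := by
  have hp0 : 0 < p := by linarith
  have hp1 : 1 ≤ ENNReal.ofReal p := by simpa using (by linarith : (1 : ℝ) ≤ p)
  have := isFiniteMeasure_restrict hb
  set S : Set ℝ := {e | ∃ v, IsAdmissible Ω (ENNReal.ofReal p) g v ∧ pEnergy Ω p v = e} with hS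
  have hSne : S.Nonempty := let ⟨v, hv⟩ := hne; ⟨_, v, hv, rfl⟩
  have hSb : BddBelow S := ⟨0, by
    rintro _ ⟨v, -, rfl⟩
    exact integral_nonneg fun x => by positivity⟩
  set m := sInf S with hm
  have hml : ∀ v, IsAdmissible Ω (ENNReal.ofReal p) g v → m ≤ pEnergy Ω p v :=
    fun v hv => csInf_le hSb ⟨v, hv, rfl⟩
  have hm0 : 0 ≤ m := le_csInf hSne (by
    rintro _ ⟨v, -, rfl⟩
    exact integral_nonneg fun x => by positivity)
  -- The rate is summable, as completeness of `L^p` is used for summable bounds. The energy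
  -- tolerance `(r k / 4) ^ p` becomes `(r N / 2) ^ p` after the factor `2 ^ p`, leaving room for
  -- the strict bound by `r N`.
  set r : ℕ → ℝ := fun k => (1 / 2 : ℝ) ^ k with hr
  have hr0 : ∀ k, 0 < r k := fun k => by positivity
  have hra : ∀ {k l}, k ≤ l → r l ≤ r k := fun h =>
    pow_le_pow_of_le_one (by norm_num) (by norm_num) h
  have hrlim : Tendsto r atTop (𝓝 0) :=
    tendsto_pow_atTop_nhds_zero_of_lt_one (by norm_num) (by norm_num)
  have hex : ∀ k, ∃ v, IsAdmissible Ω (ENNReal.ofReal p) g v ∧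
      pEnergy Ω p v < m + (r k / 4) ^ p := by
    intro k
    obtain ⟨_, ⟨v, hv, rfl⟩, hlt⟩ := exists_lt_of_csInf_lt hSne
      (show sInf S < m + (r k / 4) ^ p by
        rw [← hm]; exact lt_add_of_pos_right _ (Real.rpow_pos_of_pos (by have := hr0 k; positivity) _))
    exact ⟨v, hv, hlt⟩
  choose w hw hwe using hex
  set F : ℕ → (𝔼 n) → (𝔼 n) := fun k => weakGrad Ω (w k) with hF
  have hFp : ∀ k, MemLp (F k) (ENNReal.ofReal p) (volume.restrict Ω) := fun k => (hw k).1.memLp hΩ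
  have hcau : ∀ N k l, N ≤ k → N ≤ l →
      (eLpNorm (F k - F l) (ENNReal.ofReal p) (volume.restrict Ω)).toReal ≤ r N / 2 := by
    intro N k l hk hl
    have h1 := integral_sub_le_of_le_pEnergy hΩ hb hp hml (hw k) (hw l)
    have h2 := integral_norm_rpow_eq hp0 ((hFp k).sub (hFp l))
    simp only [Pi.sub_apply] at h2
    rw [h2] at h1
    have b1 : (r k / 4) ^ p ≤ (r N / 4) ^ p :=
      Real.rpow_le_rpow (by have := hr0 k; positivity) (by linarith [hra hk]) hp0.le
    have b2 : (r l / 4) ^ p ≤ (r N / 4) ^ p :=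
      Real.rpow_le_rpow (by have := hr0 l; positivity) (by linarith [hra hl]) hp0.le
    have h3 : (2 : ℝ) ^ p * ((pEnergy Ω p (w k) + pEnergy Ω p (w l)) / 2 - m) ≤ (r N / 2) ^ p := by
      have : r N / 2 = 2 * (r N / 4) := by ring
      rw [this, Real.mul_rpow (by norm_num) (by have := hr0 N; positivity)]
      refine mul_le_mul_of_nonneg_left ?_ (by positivity)
      linarith [hwe k, hwe l]
    exact (Real.rpow_le_rpow_iff ENNReal.toReal_nonneg (by have := hr0 N; positivity) hp0).1
      (h1.trans h3)
  obtain ⟨G, hG, hGlim⟩ := Lp.cauchy_complete_eLpNorm hp1 hFp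
    (B := fun N => ENNReal.ofReal (r N)) (by
      rw [← ENNReal.ofReal_tsum_of_nonneg (fun k => (hr0 k).le) summable_geometric_two]
      exact ENNReal.ofReal_ne_top)
    (fun N k l hk hl => by
      rw [← ENNReal.ofReal_toReal ((hFp k).sub (hFp l)).2.ne]
      exact (ENNReal.ofReal_lt_ofReal_iff (hr0 N)).2
        ((hcau N k l hk hl).trans_lt (by linarith [hr0 N])))
  -- Differences of competitors vanish on the boundary, so convergence of gradients upgrades to
  -- uniform convergence of the functions.
  obtain ⟨M, hM0, hM⟩ := exists_sup_bound hn hΩ hb (by linarith) hnp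
  have hsup : ∀ N k l, N ≤ k → N ≤ l → ∀ x ∈ closure Ω, |w k x - w l x| ≤ M * r N := by
    intro N k l hk hl x hx
    have := hM (w k - w l) (F k - F l) ((hw k).1.1.sub (hw l).1.1)
      (sub_boundary_zero (hw k).2 (hw l).2)
      ((hw k).1.hasWeakGradient.sub (hw l).1.hasWeakGradient) ((hFp k).sub (hFp l)) x hx
    refine this.trans (mul_le_mul_of_nonneg_left ?_ hM0)
    exact (hcau N k l hk hl).trans (by linarith [hr0 N])
  have huc : UniformCauchySeqOn w atTop (closure Ω) := by
    rw [Metric.uniformCauchySeqOn_iff]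
    intro ε hε
    have : Tendsto (fun N => M * r N) atTop (𝓝 0) := by simpa using hrlim.const_mul M
    obtain ⟨N, hN⟩ := (this.eventually_lt_const hε).exists
    exact ⟨N, fun k hk l hl x hx => (hsup N k l hk hl x hx).trans_lt hN⟩
  have hlim : ∀ x, ∃ y, x ∈ closure Ω → Tendsto (fun k => w k x) atTop (𝓝 y) := by
    intro x
    by_cases hx : x ∈ closure Ω
    · obtain ⟨y, hy⟩ := cauchySeq_tendsto_of_complete (huc.cauchySeq hx)
      exact ⟨y, fun _ => hy⟩
    · exact ⟨0, fun h => absurd h hx⟩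
  choose u hu using hlim
  have hunif := huc.tendstoUniformlyOn_of_tendsto hu
  have hcont : ContinuousOn u (closure Ω) :=
    hunif.continuousOn (Frequently.of_forall fun k => (hw k).1.1)
  have hL1 : Tendsto (fun k => eLpNorm (F k - G) 1 (volume.restrict Ω)) atTop (𝓝 0) := by
    have hc : (volume.restrict Ω univ : ℝ≥0∞) ^
        (1 / (1 : ℝ≥0∞).toReal - 1 / (ENNReal.ofReal p).toReal) ≠ ⊤ := by
      refine ENNReal.rpow_ne_top_of_nonneg ?_ (measure_ne_top _ _)
      rw [ENNReal.toReal_ofReal hp0.le, ENNReal.toReal_one, div_one, sub_nonneg,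
        div_le_one hp0]
      linarith
    have h2 := ENNReal.Tendsto.mul_const hGlim (Or.inr hc)
    rw [zero_mul] at h2
    exact tendsto_of_tendsto_of_tendsto_of_le_of_le tendsto_const_nhds h2 (fun _ => zero_le)
      fun k => eLpNorm_le_eLpNorm_mul_rpow_measure_univ hp1 ((hFp k).sub hG).1
  have hwg : HasWeakGradient Ω u G := HasWeakGradient.of_tendstoUniformlyOn hΩ
    (fun k => (hw k).1.hasWeakGradient) (hcont.mono subset_closure)
    (hunif.mono subset_closure) (fun k => (hFp k).integrable hp1) (hG.integrable hp1) hL1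
  refine ⟨u, ⟨memCSobolev_of_hasWeakGradient hΩ hb hcont hwg hG, fun x hx => ?_⟩, fun v hv => ?_⟩
  · refine tendsto_nhds_unique (hu x (frontier_subset_closure hx)) ?_
    exact tendsto_const_nhds.congr fun k => ((hw k).2 hx).symm
  · refine le_trans ?_ (hml v hv)
    rw [pEnergy_eq hΩ hwg, integral_norm_rpow_eq hp0 hG]
    set a : ℕ → ℝ := fun k =>
      (eLpNorm (F k - G) (ENNReal.ofReal p) (volume.restrict Ω)).toReal with ha
    have halim : Tendsto a atTop (𝓝 0) := by
      have := (ENNReal.tendsto_toReal ENNReal.zero_ne_top).comp hGlim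
      rwa [ENNReal.toReal_zero] at this
    -- Convergence of the gradients is strong, so the triangle inequality suffices to bound the
    -- energy of the limit.
    have hle : ∀ k, (eLpNorm G (ENNReal.ofReal p) (volume.restrict Ω)).toReal ≤
        (m + (r k / 4) ^ p) ^ p⁻¹ + a k := by
      intro k
      have h1 : eLpNorm G (ENNReal.ofReal p) (volume.restrict Ω) ≤
          eLpNorm (F k) (ENNReal.ofReal p) (volume.restrict Ω) +
          eLpNorm (F k - G) (ENNReal.ofReal p) (volume.restrict Ω) := by
        have := eLpNorm_sub_le (hFp k).1 ((hFp k).sub hG).1 hp1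
        rwa [sub_sub_cancel] at this
      have h2 := ENNReal.toReal_mono (ENNReal.add_ne_top.2 ⟨(hFp k).2.ne, ((hFp k).sub hG).2.ne⟩) h1
      rw [ENNReal.toReal_add (hFp k).2.ne ((hFp k).sub hG).2.ne] at h2
      refine h2.trans (add_le_add ?_ le_rfl)
      rw [Real.le_rpow_inv_iff_of_pos ENNReal.toReal_nonneg (by have := hr0 k; positivity) hp0,
        ← pEnergy_eq_rpow hΩ hp0 (hw k).1]
      exact (hwe k).le
    have hlim2 : Tendsto (fun k => (m + (r k / 4) ^ p) ^ p⁻¹ + a k) atTop (𝓝 (m ^ p⁻¹)) := by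
      have e1 : Tendsto (fun k => (r k / 4) ^ p) atTop (𝓝 0) := by
        have := (hrlim.div_const 4).rpow_const (p := p) (Or.inr hp0.le)
        simpa [Real.zero_rpow hp0.ne'] using this
      have e2 := ((e1.const_add m).rpow_const (p := p⁻¹) (Or.inr (by positivity))).add halim
      simpa using e2
    have h3 := ge_of_tendsto' hlim2 hle
    exact (Real.le_rpow_inv_iff_of_pos ENNReal.toReal_nonneg hm0 hp0).1 h3

end Minimizers

/-! ### The `p`-Laplace equation -/

section Equation

variable {n : ℕ} {Ω : Set (EuclideanSpace ℝ (Fin n))} {g u v : EuclideanSpace ℝ (Fin n) → ℝ}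
  {G H : EuclideanSpace ℝ (Fin n) → EuclideanSpace ℝ (Fin n)} {p : ℝ}

theorem memLp_pField {α : Type*} [MeasurableSpace α] {μ : Measure α} {G : α → (𝔼 n)} (hp : 2 ≤ p)
    (hG : MemLp G (ENNReal.ofReal p) μ) :
    MemLp (fun x => pField p (G x)) (ENNReal.ofReal (p / (p - 1))) μ := by
  have h := hG.norm_rpow_div (ENNReal.ofReal (p - 1))
  rw [ENNReal.toReal_ofReal (by linarith), ← ENNReal.ofReal_div_of_pos (by linarith)] at h
  refine h.of_le ((continuous_pField hp).comp_aestronglyMeasurable hG.1) (ae_of_all _ fun x => ?_)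
  rw [norm_pField hp, Real.norm_of_nonneg (by positivity)]

theorem holderConjugate_ofReal (hp : 2 ≤ p) :
    (ENNReal.ofReal (p / (p - 1))).HolderConjugate (ENNReal.ofReal p) :=
  (Real.HolderConjugate.conjExponent (show 1 < p by linarith)).symm.ennrealOfReal

theorem integrable_inner_pField {α : Type*} [MeasurableSpace α] {μ : Measure α} {G H : α → (𝔼 n)}
    (hp : 2 ≤ p) (hG : MemLp G (ENNReal.ofReal p) μ) (hH : MemLp H (ENNReal.ofReal p) μ) :
    Integrable (fun x => inner ℝ (pField p (G x)) (H x)) μ := by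
  have := holderConjugate_ofReal hp
  exact (integrable_inner_and_norm_integral_le (memLp_pField hp hG) hH).1

/-- `G` satisfies `∫ ⟨|G|^{p-2} G, ∇η⟩ = 0` for all test functions. -/
def IsPHarmonicField (Ω : Set (𝔼 n)) (p : ℝ) (G : (𝔼 n) → (𝔼 n)) : Prop :=
  ∀ η : (𝔼 n) → ℝ, IsTestFunction Ω η → ∫ x in Ω, inner ℝ (pField p (G x)) (gradient η x) = 0

theorem IsPHarmonicField.mono {D : Set (𝔼 n)} (h : IsPHarmonicField Ω p G)
    (hD : D ⊆ Ω) : IsPHarmonicField D p G := fun η hη => by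
  rw [← h η (hη.mono hD)]
  have h0 : ∀ x ∉ D, (inner ℝ (pField p (G x)) (gradient η x) : ℝ) = 0 := fun x hx => by
    have : gradient η x = 0 := by
      rw [← norm_eq_zero, norm_gradient]
      by_contra h0
      exact hx (hη.2.2 (support_fderiv_subset ℝ (f := η) (fun h2 => h0 (by rw [h2, norm_zero]))))
    rw [this, inner_zero_right]
  rw [setIntegral_eq_integral_of_forall_compl_eq_zero h0,
    setIntegral_eq_integral_of_forall_compl_eq_zero fun x hx => h0 x fun h' => hx (hD h')]

theorem IsPHarmonicField.integral_eq_zero (hΩ : IsOpen Ω) (hb : Bornology.IsBounded Ω) (hp : 2 ≤ p)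
    (h : IsPHarmonicField Ω p G) (hG : MemLp G (ENNReal.ofReal p) (volume.restrict Ω))
    {w : (𝔼 n) → ℝ} (hw : ContinuousOn w (closure Ω)) (hw0 : ∀ x ∈ frontier Ω, w x = 0)
    (hwH : HasWeakGradient Ω w H) (hH : MemLp H (ENNReal.ofReal p) (volume.restrict Ω)) :
    ∫ x in Ω, inner ℝ (pField p (G x)) (H x) = 0 := by
  have := holderConjugate_ofReal hp
  exact integral_inner_eq_zero hΩ hb (by simpa using (by linarith : (1 : ℝ) ≤ p))
    ENNReal.ofReal_ne_top (memLp_pField hp hG) h hw hw0 hwH hH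

theorem IsPLaplaceSolution.isPHarmonicField (h : IsPLaplaceSolution Ω p g u) :
    IsPHarmonicField Ω p (weakGrad Ω u) := h.2

/-- Integrate `rpow_convexity`: the linear term vanishes because `v - u` is zero on the boundary
and, by density, a legitimate test function. -/
theorem IsPLaplaceSolution.isPMinimizer (hΩ : IsOpen Ω) (hb : Bornology.IsBounded Ω) (hp : 2 ≤ p)
    (h : IsPLaplaceSolution Ω p g u) : IsPMinimizer Ω p g u := by
  refine ⟨h.1, fun v hv => ?_⟩
  have hp0 : 0 < p := by linarith
  have hu := h.1.1.memLp hΩ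
  have hv' := hv.1.memLp hΩ
  have h0 := h.isPHarmonicField.integral_eq_zero hΩ hb hp hu (hv.1.1.sub h.1.1.1)
    (sub_boundary_zero hv.2 h.1.2) (hv.1.hasWeakGradient.sub h.1.1.hasWeakGradient) (hv'.sub hu)
  have i1 := integrable_norm_rpow_ofReal hp0 hu
  have i2 := integrable_norm_rpow_ofReal hp0 hv'
  have i3 := (integrable_inner_pField hp hu (hv'.sub hu)).const_mul p
  calc pEnergy Ω p u = ∫ x in Ω, (‖weakGrad Ω u x‖ ^ p +
        p * inner ℝ (pField p (weakGrad Ω u x)) ((weakGrad Ω v - weakGrad Ω u) x)) := by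
        rw [integral_add i1 i3, integral_const_mul, h0, mul_zero, add_zero]; rfl
    _ ≤ pEnergy Ω p v := integral_mono (i1.add i3) i2 fun x => rpow_convexity hp _ _

theorem IsTestFunction.eq_zero_of_mem_frontier (hΩ : IsOpen Ω) {η : (𝔼 n) → ℝ}
    (hη : IsTestFunction Ω η) {x : 𝔼 n} (hx : x ∈ frontier Ω) : η x = 0 := by
  refine image_eq_zero_of_notMem_tsupport fun h => ?_
  rw [hΩ.frontier_eq] at hx
  exact hx.2 (hη.2.2 h)

/-- The energy is never differentiated. The tangent inequality at the perturbed point `u + tη`,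
combined with minimality of `u`, makes the integral with the perturbed field nonnegative for `t >
0`; then `t → 0`. Equality follows by using `-η` as well. -/
theorem IsPMinimizer.integral_nonneg (hΩ : IsOpen Ω) (hb : Bornology.IsBounded Ω) (hp : 2 ≤ p)
    (h : IsPMinimizer Ω p g u) {η : (𝔼 n) → ℝ} (hη : IsTestFunction Ω η) :
    0 ≤ ∫ x in Ω, inner ℝ (pField p (weakGrad Ω u x)) (gradient η x) := by
  have hp0 : 0 < p := by linarith
  have hu := h.1.1.memLp hΩ
  set G := weakGrad Ω u with hG
  have hH : MemLp (gradient η) (ENNReal.ofReal p) (volume.restrict Ω) := memLp_gradient hη _ _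
  have hGt : ∀ t : ℝ, MemLp (G + t • gradient η) (ENNReal.ofReal p) (volume.restrict Ω) :=
    fun t => hu.add (hH.const_smul t)
  have hpos : ∀ t : ℝ, 0 < t →
      0 ≤ ∫ x in Ω, inner ℝ (pField p ((G + t • gradient η) x)) (gradient η x) := by
    intro t ht
    have hw : HasWeakGradient Ω (u + t • η) (G + t • gradient η) :=
      h.1.1.hasWeakGradient.add ((HasWeakGradient.of_contDiff hη.1).const_smul t)
    have hadm : IsAdmissible Ω (ENNReal.ofReal p) g (u + t • η) := by
      refine ⟨memCSobolev_of_hasWeakGradient hΩ hb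
        (h.1.1.1.add (hη.1.continuous.const_smul t).continuousOn) hw (hGt t), fun x hx => ?_⟩
      simp [h.1.2 hx, hη.eq_zero_of_mem_frontier hΩ hx]
    have h1 := h.2 _ hadm
    rw [pEnergy_eq hΩ hw] at h1
    have i1 := integrable_norm_rpow_ofReal hp0 (hGt t)
    have i2 := integrable_norm_rpow_ofReal hp0 hu
    have i3 := (integrable_inner_pField hp (hGt t) hH).const_mul (p * t)
    have h2 : ∫ x in Ω, ‖(G + t • gradient η) x‖ ^ p ≤ ∫ x in Ω, (‖G x‖ ^ p +
        p * t * inner ℝ (pField p ((G + t • gradient η) x)) (gradient η x)) := by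
      refine integral_mono i1 (i2.add i3) fun x => ?_
      have := rpow_convexity hp ((G + t • gradient η) x) (G x)
      have e : G x - (G + t • gradient η) x = -(t • gradient η x) := by simp
      rw [e, inner_neg_right, inner_smul_right] at this
      dsimp only
      linarith
    rw [integral_add i2 i3, integral_const_mul] at h2
    have h3 : 0 ≤ p * t * ∫ x in Ω, inner ℝ (pField p ((G + t • gradient η) x)) (gradient η x) := by
      have : pEnergy Ω p u = ∫ x in Ω, ‖G x‖ ^ p := rfl
      linarith
    exact nonneg_of_mul_nonneg_right h3 (by positivity)
  have hlim : Tendsto (fun k : ℕ => ∫ x in Ω,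
      inner ℝ (pField p ((G + (1 / ((k : ℝ) + 1)) • gradient η) x)) (gradient η x)) atTop
      (𝓝 (∫ x in Ω, inner ℝ (pField p (G x)) (gradient η x))) := by
    have hs : MemLp (fun x => ‖G x‖ + ‖gradient η x‖) (ENNReal.ofReal p) (volume.restrict Ω) :=
      hu.norm.add hH.norm
    refine tendsto_integral_of_dominated_convergence
      (fun x => ‖‖G x‖ + ‖gradient η x‖‖ ^ p) (fun k => ?_)
      (integrable_norm_rpow_ofReal hp0 hs) (fun k => ?_) ?_
    · exact (integrable_inner_pField hp (hGt _) hH).1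
    · refine ae_of_all _ fun x => ?_
      refine (norm_inner_le_norm _ _).trans ?_
      rw [norm_pField hp, Real.norm_of_nonneg (by positivity)]
      have b1 : ‖(G + (1 / ((k : ℝ) + 1)) • gradient η) x‖ ≤ ‖G x‖ + ‖gradient η x‖ := by
        refine (norm_add_le _ _).trans (add_le_add le_rfl ?_)
        rw [Pi.smul_apply, norm_smul, Real.norm_of_nonneg (by positivity)]
        refine mul_le_of_le_one_left (norm_nonneg _) ?_
        rw [div_le_one (by positivity)]
        linarith [Nat.cast_nonneg (α := ℝ) k]
      calc _ ≤ (‖G x‖ + ‖gradient η x‖) ^ (p - 1) * (‖G x‖ + ‖gradient η x‖) := by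
            refine mul_le_mul (Real.rpow_le_rpow (norm_nonneg _) b1 (by linarith))
              (by linarith [norm_nonneg (G x)]) (norm_nonneg _) (by positivity)
        _ = _ := by
            have h0 : 0 ≤ ‖G x‖ + ‖gradient η x‖ := by positivity
            conv_lhs => rw [← Real.rpow_one (‖G x‖ + ‖gradient η x‖), ← Real.rpow_mul h0,
              ← Real.rpow_add_of_nonneg h0 (by linarith) zero_le_one]
            congr 1; ring
    · refine ae_of_all _ fun x => ?_
      have h1 : Tendsto (fun k : ℕ => (G + (1 / ((k : ℝ) + 1)) • gradient η) x) atTop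
          (𝓝 (G x)) := by
        have := ((tendsto_one_div_add_atTop_nhds_zero_nat (𝕜 := ℝ)).smul_const
          (gradient η x)).const_add (G x)
        rwa [zero_smul, add_zero] at this
      exact (((continuous_pField hp).tendsto _).comp h1).inner tendsto_const_nhds
  exact ge_of_tendsto' hlim fun k => hpos _ (by positivity)

theorem IsPMinimizer.isPLaplaceSolution (hΩ : IsOpen Ω) (hb : Bornology.IsBounded Ω) (hp : 2 ≤ p)
    (h : IsPMinimizer Ω p g u) : IsPLaplaceSolution Ω p g u := by
  refine ⟨h.1, fun η hη => ?_⟩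
  have h1 := h.integral_nonneg hΩ hb hp hη
  have h2 := h.integral_nonneg hΩ hb hp hη.neg
  have e : ∀ x, gradient (-η) x = -gradient η x := fun x => by
    ext i
    simp [gradient_apply, fderiv_neg]
  simp only [e, inner_neg_right, integral_neg] at h2
  exact le_antisymm (neg_nonneg.1 h2) h1

/-- Comparison principle: the difference of two solutions is bounded by its boundary values. -/
theorem abs_sub_le_of_isPHarmonicField (hn : 1 ≤ n) (hΩ : IsOpen Ω) (hb : Bornology.IsBounded Ω)
    (hp : 2 ≤ p) (hu : ContinuousOn u (closure Ω)) (hv : ContinuousOn v (closure Ω))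
    (huG : HasWeakGradient Ω u G) (hvH : HasWeakGradient Ω v H)
    (hG : MemLp G (ENNReal.ofReal p) (volume.restrict Ω))
    (hH : MemLp H (ENNReal.ofReal p) (volume.restrict Ω))
    (hGp : IsPHarmonicField Ω p G) (hHp : IsPHarmonicField Ω p H) {m : ℝ} (hm : 0 < m)
    (huv : ∀ x ∈ frontier Ω, |u x - v x| ≤ m) : ∀ x ∈ closure Ω, |u x - v x| ≤ m := by
  obtain ⟨C, hC⟩ := exists_abs_deriv_trunc_le
  -- `T(u - v)` vanishes on the boundary, so it may be tested in both equations. As `T' ≥ 0` and the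
  -- field is monotone, the difference is a nonnegative integrand of zero integral. Hence `T(u - v)`
  -- has zero gradient and vanishes, which means `|u - v| ≤ m`.
  set T := trunc m with hT
  have hzc : ContinuousOn (fun x => u x - v x) (closure Ω) := hu.sub hv
  have hz : HasWeakGradient Ω (fun x => u x - v x) (G - H) := huG.sub hvH
  have hTz := hz.comp hΩ (hzc.mono subset_closure) (contDiff_trunc m) (hC m hm)
  have hTc : ContinuousOn (fun x => T (u x - v x)) (closure Ω) :=
    (contDiff_trunc m).continuous.comp_continuousOn hzc
  have hT0 : ∀ x ∈ frontier Ω, T (u x - v x) = 0 := fun x hx => trunc_eq_zero hm (huv x hx)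
  have hTm : MemLp (fun x => deriv T (u x - v x) • (G - H) x) (ENNReal.ofReal p)
      (volume.restrict Ω) := by
    refine (hG.sub hH).of_le_mul (c := C) ?_ (ae_of_all _ fun x => ?_)
    · exact ((((contDiff_trunc m).continuous_deriv (by simp)).comp_continuousOn
        (hzc.mono subset_closure)).aestronglyMeasurable hΩ.measurableSet).smul (hG.1.sub hH.1)
    · rw [norm_smul]
      exact mul_le_mul_of_nonneg_right (hC m hm _) (norm_nonneg _)
  have a1 := hGp.integral_eq_zero hΩ hb hp hG hTc hT0 hTz hTm
  have a2 := hHp.integral_eq_zero hΩ hb hp hH hTc hT0 hTz hTm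
  have i1 := integrable_inner_pField hp hG hTm
  have i2 := integrable_inner_pField hp hH hTm
  have e : ∀ x, (inner ℝ (pField p (G x)) (deriv T (u x - v x) • (G - H) x) : ℝ) -
      inner ℝ (pField p (H x)) (deriv T (u x - v x) • (G - H) x) =
      deriv T (u x - v x) * inner ℝ (pField p (G x) - pField p (H x)) (G x - H x) := fun x => by
    rw [← inner_sub_left, inner_smul_right, Pi.sub_apply]
  have a3 : ∫ x in Ω, ((inner ℝ (pField p (G x)) (deriv T (u x - v x) • (G - H) x) : ℝ) -
      inner ℝ (pField p (H x)) (deriv T (u x - v x) • (G - H) x)) = 0 := by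
    rw [integral_sub i1 i2, a1, a2, sub_zero]
  have a4 := (integral_eq_zero_iff_of_nonneg (fun x => by
    rw [Pi.zero_apply, Pi.sub_apply, e]
    exact mul_nonneg (deriv_trunc_nonneg hm _) (pField_inner_nonneg hp _ _)) (i1.sub i2)).1 a3
  have a5 : (fun x => deriv T (u x - v x) • (G - H) x) =ᵐ[volume.restrict Ω] 0 := by
    filter_upwards [a4] with x hx
    rw [Pi.zero_apply, Pi.sub_apply, e] at hx
    rcases mul_eq_zero.1 hx with h0 | h0
    · simp [h0]
    · simp [eq_of_pField_inner_eq_zero hp h0]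
  intro x hx
  exact abs_le_of_trunc_eq_zero hm
    (eq_zero_of_weakGradient_eq_zero hn hΩ hb hTc hT0 hTz a5 x hx)

end Equation

/-! ### Lower semicontinuity of the supremum norm of the gradient -/

/-- Almost minimal elements of a decreasing sequence of convex sets in an inner product space form
a Cauchy sequence. -/
theorem exists_cauchySeq_of_antitone {V : Type*} [NormedAddCommGroup V] [InnerProductSpace ℝ V]
    {S : ℕ → Set V} (hS : Antitone S) (hne : ∀ k, (S k).Nonempty)
    (hmid : ∀ k, ∀ x ∈ S k, ∀ y ∈ S k, (1 / 2 : ℝ) • (x + y) ∈ S k) {R : ℝ}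
    (hR : ∀ k, ∀ x ∈ S k, ‖x‖ ≤ R) : ∃ x : ℕ → V, (∀ k, x k ∈ S k) ∧ CauchySeq x := by
  set d : ℕ → ℝ := fun k => sInf (norm '' S k) with hd
  have hbd : ∀ k, BddBelow (norm '' S k) := fun k => ⟨0, by
    rintro _ ⟨x, -, rfl⟩
    exact norm_nonneg x⟩
  have hdle : ∀ k, ∀ x ∈ S k, d k ≤ ‖x‖ := fun k x hx => csInf_le (hbd k) ⟨x, hx, rfl⟩
  have hd0 : ∀ k, 0 ≤ d k := fun k => le_csInf ((hne k).image _) (by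
    rintro _ ⟨x, -, rfl⟩
    exact norm_nonneg x)
  have hmono : Monotone d := fun k l hkl =>
    csInf_le_csInf (hbd k) ((hne l).image _) (image_mono (hS hkl))
  have hbdd : BddAbove (range d) := ⟨R, by
    rintro _ ⟨k, rfl⟩
    obtain ⟨x, hx⟩ := hne k
    exact (hdle k x hx).trans (hR k x hx)⟩
  set D := ⨆ k, d k with hD
  have hdD : ∀ k, d k ≤ D := fun k => le_ciSup hbdd k
  have hlim : Tendsto d atTop (𝓝 D) := tendsto_atTop_ciSup hmono hbdd
  have hex : ∀ k : ℕ, ∃ x ∈ S k, ‖x‖ < d k + 1 / ((k : ℝ) + 1) := by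
    intro k
    obtain ⟨_, ⟨x, hx, rfl⟩, hlt⟩ := exists_lt_of_csInf_lt ((hne k).image norm)
      (lt_add_of_pos_right (d k) (show 0 < 1 / ((k : ℝ) + 1) by positivity))
    exact ⟨x, hx, hlt⟩
  choose x hxS hx using hex
  refine ⟨x, hxS, ?_⟩
  set e : ℕ → ℝ := fun k => 1 / ((k : ℝ) + 1) with he
  have helim : Tendsto e atTop (𝓝 0) := tendsto_one_div_add_atTop_nhds_zero_nat
  have heanti : ∀ {k l : ℕ}, k ≤ l → e l ≤ e k := fun h => Nat.one_div_le_one_div h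
  -- Parallelogram law: past `N` the norms are at most `D + e N`, while midpoints lie in `S N` and
  -- so have norm at least `d N`. Both bounds tend to `D`.
  refine cauchySeq_of_le_tendsto_0 (fun N => √(4 * (D + e N) ^ 2 - 4 * d N ^ 2)) ?_ ?_
  · intro k l N hk hl
    rw [dist_eq_norm]
    refine Real.le_sqrt_of_sq_le ?_
    have h1 := parallelogram_law_with_norm ℝ (x k) (x l)
    have h2 := hdle N _ (hmid N _ (hS hk (hxS k)) _ (hS hl (hxS l)))
    rw [norm_smul, Real.norm_of_nonneg (by norm_num)] at h2
    have h3 : ‖x k‖ ≤ D + e N := (hx k).le.trans (add_le_add (hdD k) (heanti hk))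
    have h4 : ‖x l‖ ≤ D + e N := (hx l).le.trans (add_le_add (hdD l) (heanti hl))
    have h5 : ‖x k‖ ^ 2 ≤ (D + e N) ^ 2 := pow_le_pow_left₀ (norm_nonneg _) h3 2
    have h6 : ‖x l‖ ^ 2 ≤ (D + e N) ^ 2 := pow_le_pow_left₀ (norm_nonneg _) h4 2
    have h7 : (2 * d N) ^ 2 ≤ ‖x k + x l‖ ^ 2 :=
      pow_le_pow_left₀ (by linarith [hd0 N]) (by linarith) 2
    nlinarith
  · have h1 := ((((helim.const_add D).pow 2).const_mul 4).sub ((hlim.pow 2).const_mul 4)).sqrt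
    simpa using h1

/-- The supremum norm is controlled by normalized `L^m` norms. -/
theorem eLpNorm_top_le_of_forall_nat {α F : Type*} [MeasurableSpace α] {μ : Measure α}
    [IsFiniteMeasure μ] [NormedAddCommGroup F] {f : α → F} (hf : AEStronglyMeasurable f μ)
    {K : ℝ≥0∞} (h : ∀ m : ℕ, 2 ≤ m → eLpNorm f m μ ≤ μ univ ^ (1 / (m : ℝ)) * K) :
    eLpNorm f ⊤ μ ≤ K := by
  refine le_of_forall_gt_imp_ge_of_dense fun c hc => ?_
  by_cases hct : c = ⊤
  · simp [hct]
  have hc0 : c ≠ 0 := (lt_of_le_of_lt zero_le hc).ne'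
  set a := μ {x | c ≤ ‖f x‖ₑ} with ha
  -- Chebyshev's inequality at exponent `m`; as `c > K`, the right side tends to 0.
  have key : ∀ m : ℕ, 2 ≤ m → a ≤ μ univ * (K / c) ^ m := by
    intro m hm
    have hm0 : (m : ℝ) ≠ 0 := by positivity
    have h1 := mul_meas_ge_le_pow_eLpNorm' μ (p := (m : ℝ≥0∞)) (by simp; omega)
      (ENNReal.natCast_ne_top m) hf c
    rw [ENNReal.toReal_natCast, ENNReal.rpow_natCast, ENNReal.rpow_natCast] at h1
    have h2 := h1.trans (pow_le_pow_left₀ zero_le (h m hm) m)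
    have h3 : (μ univ ^ (1 / (m : ℝ)) * K) ^ m = μ univ * K ^ m := by
      rw [mul_pow, ← ENNReal.rpow_natCast, ← ENNReal.rpow_mul, one_div_mul_cancel hm0,
        ENNReal.rpow_one]
    rw [h3] at h2
    rw [ENNReal.div_eq_inv_mul, mul_pow, ← ENNReal.inv_pow, mul_left_comm,
      ← ENNReal.div_eq_inv_mul, ENNReal.le_div_iff_mul_le (Or.inl (pow_ne_zero _ hc0))
      (Or.inl (ENNReal.pow_ne_top hct)), mul_comm]
    exact h2
  have hlt : K / c < 1 := (ENNReal.div_lt_iff (Or.inl hc0) (Or.inl hct)).2 (by rwa [one_mul])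
  have hlim : Tendsto (fun m : ℕ => μ univ * (K / c) ^ m) atTop (𝓝 0) := by
    have := ENNReal.Tendsto.const_mul (ENNReal.tendsto_pow_atTop_nhds_zero_of_lt_one hlt)
      (Or.inr (measure_ne_top μ univ))
    rwa [mul_zero] at this
  have ha0 : a = 0 := le_antisymm
    (ge_of_tendsto hlim ((eventually_ge_atTop 2).mono key)) zero_le
  rw [eLpNorm_exponent_top]
  refine eLpNormEssSup_le_of_ae_enorm_bound ?_
  rw [ae_iff]
  refine measure_mono_null (fun x hx => ?_) ha0
  exact (not_le.1 hx).le

section Lsc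

variable {n : ℕ} {D : Set (EuclideanSpace ℝ (Fin n))} {w : EuclideanSpace ℝ (Fin n) → ℝ}

/-- A uniform limit of functions whose gradients have controlled `L^m` norms, for more and more
exponents `m`, has a bounded gradient. -/
theorem exists_hasWeakGradient_of_approx (hD : IsOpen D) (hb : Bornology.IsBounded D)
    (hw : ContinuousOn w D) {K : ℝ≥0∞} (hK : K ≠ ⊤)
    (h : ∀ k : ℕ, ∃ (f : (𝔼 n) → ℝ) (F : (𝔼 n) → (𝔼 n)), (∀ x ∈ D, |f x - w x| ≤ 1 / ((k : ℝ) + 1)) ∧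
      HasWeakGradient D f F ∧ ∀ m : ℕ, 2 ≤ m → m ≤ k + 2 →
        eLpNorm F m (volume.restrict D) ≤ volume.restrict D univ ^ (1 / (m : ℝ)) * K) :
    ∃ G, HasWeakGradient D w G ∧ MemLp G ⊤ (volume.restrict D) ∧
      eLpNorm G ⊤ (volume.restrict D) ≤ K := by
  have := isFiniteMeasure_restrict hb
  set μ : Measure (𝔼 n) := volume.restrict D with hμ
  have hAfin : ∀ m : ℕ, μ univ ^ (1 / (m : ℝ)) * K ≠ ⊤ := fun m =>
    ENNReal.mul_ne_top (ENNReal.rpow_ne_top_of_nonneg (by positivity) (measure_ne_top _ _)) hK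
  -- All constraints are stable under midpoints and tighten with `k`, so
  -- `exists_cauchySeq_of_antitone` selects gradients converging strongly in `L²`. The range `m ≤ k
  -- + 2` makes the exponent 2 available at every stage, which puts the fields in `L²` with a
  -- uniform bound.
  set S : ℕ → Set (Lp (𝔼 n) 2 μ) := fun k => {F | ∃ f : (𝔼 n) → ℝ,
    (∀ x ∈ D, |f x - w x| ≤ 1 / ((k : ℝ) + 1)) ∧ HasWeakGradient D f F ∧
    ∀ m : ℕ, 2 ≤ m → m ≤ k + 2 → eLpNorm F m μ ≤ μ univ ^ (1 / (m : ℝ)) * K} with hSdef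
  have hanti : Antitone S := by
    rintro k l hkl F ⟨f, h1, h2, h3⟩
    exact ⟨f, fun x hx => (h1 x hx).trans (Nat.one_div_le_one_div hkl), h2,
      fun m hm hmk => h3 m hm (by omega)⟩
  have hne : ∀ k, (S k).Nonempty := by
    intro k
    obtain ⟨f, F, h1, h2, h3⟩ := h k
    have hF2 : MemLp F 2 μ := ⟨h2.2.1.aestronglyMeasurable, by
      have := h3 2 le_rfl (by omega)
      exact (this.trans_lt (hAfin 2).lt_top)⟩
    refine ⟨hF2.toLp F, f, h1, h2.congr hD.measurableSet (fun _ _ => rfl) hF2.coeFn_toLp.symm,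
      fun m hm hmk => ?_⟩
    rw [eLpNorm_congr_ae hF2.coeFn_toLp]
    exact h3 m hm hmk
  have hmid : ∀ k, ∀ F ∈ S k, ∀ H ∈ S k, (1 / 2 : ℝ) • (F + H) ∈ S k := by
    rintro k F ⟨f, f1, f2, f3⟩ H ⟨g, g1, g2, g3⟩
    have hcoe : (((1 / 2 : ℝ) • (F + H) : Lp (𝔼 n) 2 μ) : (𝔼 n) → (𝔼 n)) =ᵐ[μ]
        (1 / 2 : ℝ) • ((F : (𝔼 n) → (𝔼 n)) + H) := by
      filter_upwards [Lp.coeFn_smul (1 / 2 : ℝ) (F + H), Lp.coeFn_add F H] with x h1 h2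
      rw [h1, Pi.smul_apply, h2, Pi.smul_apply]
    refine ⟨(1 / 2 : ℝ) • (f + g), fun x hx => ?_,
      ((f2.add g2).const_smul _).congr hD.measurableSet (fun _ _ => rfl) hcoe.symm,
      fun m hm hmk => ?_⟩
    · have e : ((1 / 2 : ℝ) • (f + g)) x - w x = (1 / 2) * (f x - w x) + (1 / 2) * (g x - w x) := by
        simp only [Pi.smul_apply, Pi.add_apply, smul_eq_mul]; ring
      rw [e]
      have a1 := abs_le.1 (f1 x hx)
      have a2 := abs_le.1 (g1 x hx)
      rw [abs_le]
      constructor <;> linarith [a1.1, a1.2, a2.1, a2.2]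
    · rw [eLpNorm_congr_ae hcoe, eLpNorm_const_smul]
      have hm1 : (1 : ℝ≥0∞) ≤ m := by exact_mod_cast (by omega : 1 ≤ m)
      have h1 := (eLpNorm_add_le (Lp.aestronglyMeasurable F) (Lp.aestronglyMeasurable H) hm1).trans
        (add_le_add (f3 m hm hmk) (g3 m hm hmk))
      have h2 : ‖(1 / 2 : ℝ)‖ₑ = 2⁻¹ := by
        rw [Real.enorm_of_nonneg (by norm_num), one_div, ENNReal.ofReal_inv_of_pos two_pos,
          ENNReal.ofReal_ofNat]
      rw [h2]
      calc _ ≤ 2⁻¹ * (μ univ ^ (1 / (m : ℝ)) * K + μ univ ^ (1 / (m : ℝ)) * K) := by gcongr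
        _ = μ univ ^ (1 / (m : ℝ)) * K := by
            rw [← two_mul, ← mul_assoc, ENNReal.inv_mul_cancel two_ne_zero ENNReal.ofNat_ne_top,
              one_mul]
  have hR : ∀ k, ∀ F ∈ S k, ‖F‖ ≤ (μ univ ^ (1 / ((2 : ℕ) : ℝ)) * K).toReal := by
    rintro k F ⟨f, -, -, f3⟩
    rw [Lp.norm_def]
    have := f3 2 le_rfl (by omega)
    exact ENNReal.toReal_mono (hAfin 2) this
  obtain ⟨F, hFS, hcau⟩ := exists_cauchySeq_of_antitone hanti hne hmid hR
  obtain ⟨G, hG⟩ := cauchySeq_tendsto_of_complete hcau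
  choose f f1 f2 f3 using hFS
  have hlim2 := (Lp.tendsto_Lp_iff_tendsto_eLpNorm' F G).1 hG
  have hGmem : MemLp (G : (𝔼 n) → (𝔼 n)) 2 μ := Lp.memLp G
  have hFmem : ∀ k, MemLp (F k : (𝔼 n) → (𝔼 n)) 2 μ := fun k => Lp.memLp (F k)
  have hlim1 : Tendsto (fun k => eLpNorm ((F k : (𝔼 n) → (𝔼 n)) - (G : (𝔼 n) → (𝔼 n))) 1 μ) atTop (𝓝 0) := by
    have hc : (μ univ) ^ (1 / (1 : ℝ≥0∞).toReal - 1 / (2 : ℝ≥0∞).toReal) ≠ ⊤ :=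
      ENNReal.rpow_ne_top_of_nonneg (by norm_num) (measure_ne_top _ _)
    have h2 := ENNReal.Tendsto.mul_const hlim2 (Or.inr hc)
    rw [zero_mul] at h2
    exact tendsto_of_tendsto_of_tendsto_of_le_of_le tendsto_const_nhds h2 (fun _ => zero_le)
      fun k => eLpNorm_le_eLpNorm_mul_rpow_measure_univ one_le_two ((hFmem k).sub hGmem).1
  have hunif : TendstoUniformlyOn f w atTop D := by
    rw [Metric.tendstoUniformlyOn_iff]
    intro ε hε
    filter_upwards [(tendsto_one_div_add_atTop_nhds_zero_nat (𝕜 := ℝ)).eventually_lt_const hε]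
      with k hk x hx
    rw [dist_comm, Real.dist_eq]
    exact (f1 k x hx).trans_lt hk
  have hwG : HasWeakGradient D w G := HasWeakGradient.of_tendstoUniformlyOn hD f2 hw hunif
    (fun k => (hFmem k).integrable one_le_two) (hGmem.integrable one_le_two) hlim1
  -- An a.e. convergent subsequence lets Fatou carry each `L^m` bound to the limit, since every
  -- fixed `m` is eventually in range.
  obtain ⟨ns, hns, hae⟩ := (tendstoInMeasure_of_tendsto_eLpNorm two_ne_zero
    (fun k => (hFmem k).1) hGmem.1 hlim2).exists_seq_tendsto_ae
  have hle : eLpNorm (G : (𝔼 n) → (𝔼 n)) ⊤ μ ≤ K := by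
    refine eLpNorm_top_le_of_forall_nat hGmem.1 fun m hm => ?_
    refine (Lp.eLpNorm_lim_le_liminf_eLpNorm (fun k => (hFmem (ns k)).1) _ hae).trans ?_
    refine liminf_le_of_frequently_le' (Eventually.frequently ?_)
    filter_upwards [eventually_ge_atTop m] with k hk
    exact f3 (ns k) m hm (by have := hns.id_le k; simp only [id] at this; omega)
  exact ⟨G, hwG, ⟨hGmem.1, hle.trans_lt hK.lt_top⟩, hle⟩

end Lsc

/-! ### The limit `p → ∞` -/

section Limit

variable {n : ℕ} {Ω D : Set (EuclideanSpace ℝ (Fin n))} {g u v : EuclideanSpace ℝ (Fin n) → ℝ}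
  {p : ℝ}

theorem MemCSobolev.of_top (hΩ : IsOpen Ω) (hb : Bornology.IsBounded Ω)
    (h : MemCSobolev Ω (⊤ : ℝ≥0∞) u) (q : ℝ≥0∞) : MemCSobolev Ω q u := by
  have := isFiniteMeasure_restrict hb
  exact memCSobolev_of_hasWeakGradient hΩ hb h.1 h.hasWeakGradient
    ((h.memLp hΩ).mono_exponent le_top)

theorem IsPMinimizer.eLpNorm_le (hΩ : IsOpen Ω) (hb : Bornology.IsBounded Ω) (hp : 0 < p)
    (hg : MemCSobolev Ω (⊤ : ℝ≥0∞) g) (h : IsPMinimizer Ω p g u) :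
    eLpNorm (weakGrad Ω u) (ENNReal.ofReal p) (volume.restrict Ω) ≤
      eLpNorm (weakGrad Ω g) ⊤ (volume.restrict Ω) * volume.restrict Ω univ ^ (1 / p) := by
  have hgp := hg.of_top hΩ hb (ENNReal.ofReal p)
  have h1 := h.2 g ⟨hgp, fun _ _ => rfl⟩
  rw [pEnergy_eq_rpow hΩ hp h.1.1, pEnergy_eq_rpow hΩ hp hgp,
    Real.rpow_le_rpow_iff ENNReal.toReal_nonneg ENNReal.toReal_nonneg hp,
    ENNReal.toReal_le_toReal (h.1.1.memLp hΩ).2.ne (hgp.memLp hΩ).2.ne] at h1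
  refine h1.trans ?_
  have := eLpNorm_le_eLpNorm_mul_rpow_measure_univ (μ := volume.restrict Ω)
    (le_top (a := ENNReal.ofReal p)) (hgp.memLp hΩ).1
  rwa [ENNReal.toReal_ofReal hp.le, ENNReal.toReal_top, div_zero, sub_zero] at this

/-- Comparison with the competitor `g`, then Hölder from `p` down to `r`. The powers of the volume
add up to `1 / r`, so the bound does not depend on `p`. -/
theorem IsPMinimizer.eLpNorm_le_of_le (hΩ : IsOpen Ω) (hb : Bornology.IsBounded Ω)
    (hg : MemCSobolev Ω (⊤ : ℝ≥0∞) g) (h : IsPMinimizer Ω p g u) {r : ℝ} (hr : 0 < r)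
    (hrp : r ≤ p) :
    eLpNorm (weakGrad Ω u) (ENNReal.ofReal r) (volume.restrict Ω) ≤
      volume.restrict Ω univ ^ (1 / r) * eLpNorm (weakGrad Ω g) ⊤ (volume.restrict Ω) := by
  have hp : 0 < p := hr.trans_le hrp
  have h1 := eLpNorm_le_eLpNorm_mul_rpow_measure_univ (μ := volume.restrict Ω)
    (ENNReal.ofReal_le_ofReal hrp) (h.1.1.memLp hΩ).1
  rw [ENNReal.toReal_ofReal hp.le, ENNReal.toReal_ofReal hr.le] at h1
  refine h1.trans ((mul_le_mul_left (h.eLpNorm_le hΩ hb hp hg) _).trans_eq ?_)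
  rw [mul_assoc, ← ENNReal.rpow_add_of_nonneg _ _ (by positivity)
    (sub_nonneg.2 (one_div_le_one_div_of_le hr hrp)), mul_comm]
  congr 2
  ring

/-- The limit of `p`-minimizers competes, in every open subset, with all bounded Sobolev functions
with the same boundary values. -/
theorem exists_hasWeakGradient_le_of_limit (hn : 1 ≤ n) (hΩ : IsOpen Ω)
    (hb : Bornology.IsBounded Ω) {q : ℕ → ℝ} (hq : ∀ k, (n : ℝ) < q k ∧ 2 ≤ q k)
    (hqlim : Tendsto q atTop atTop) {w : ℕ → (𝔼 n) → ℝ} (hw : ∀ k, IsPMinimizer Ω (q k) g (w k))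
    (hwu : TendstoUniformlyOn w u atTop (closure Ω)) (hD : IsOpen D) (hDΩ : D ⊆ Ω)
    (hv : IsAdmissible D (⊤ : ℝ≥0∞) u v) :
    ∃ G, HasWeakGradient D u G ∧ MemLp G ⊤ (volume.restrict D) ∧
      eLpNorm G ⊤ (volume.restrict D) ≤ eLpNorm (weakGrad D v) ⊤ (volume.restrict D) := by
  have hbD : Bornology.IsBounded D := hb.subset hDΩ
  have hcl : closure D ⊆ closure Ω := closure_mono hDΩ
  have hu : ContinuousOn u (closure Ω) :=
    hwu.continuousOn (Frequently.of_forall fun k => (hw k).1.1.1)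
  refine exists_hasWeakGradient_of_approx hD hbD (hu.mono (hDΩ.trans subset_closure))
    (hv.1.memLp hD).2.ne fun k => ?_
  set ε : ℝ := 1 / ((k : ℝ) + 1) with hε
  have hε0 : 0 < ε := by positivity
  obtain ⟨j, hj1, hj2⟩ := ((Metric.tendstoUniformlyOn_iff.1 hwu (ε / 2) (by positivity)).and
    (hqlim.eventually_ge_atTop ((k : ℝ) + 2))).exists
  -- The minimizer `w j` does not have the boundary values of `v` on `D`, so an auxiliary minimizer
  -- that does is introduced. It carries the gradient bound, while comparison with `w j` keeps it
  -- close to `u`.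
  obtain ⟨f, hf⟩ := exists_isPMinimizer hn hD hbD (hq j).2 (hq j).1
    ⟨v, hv.1.of_top hD hbD (ENNReal.ofReal (q j)), fun _ _ => rfl⟩
  have hdist : ∀ x ∈ closure D, |w j x - u x| ≤ ε / 2 := fun x hx => by
    have := hj1 x (hcl hx)
    rw [dist_comm, Real.dist_eq] at this
    exact this.le
  have hwj := (hw j).1.1
  have hcomp := abs_sub_le_of_isPHarmonicField hn hD hbD (hq j).2 (hwj.1.mono hcl) hf.1.1.1
    (hwj.hasWeakGradient.mono hDΩ) hf.1.1.hasWeakGradient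
    ((hwj.memLp hΩ).mono_measure (Measure.restrict_mono_set _ hDΩ)) (hf.1.1.memLp hD)
    (((hw j).isPLaplaceSolution hΩ hb (hq j).2).isPHarmonicField.mono hDΩ)
    (hf.isPLaplaceSolution hD hbD (hq j).2).isPHarmonicField (half_pos hε0)
    (fun x hx => by
      rw [hf.1.2 hx, hv.2 hx]
      exact hdist x (frontier_subset_closure hx))
  refine ⟨f, weakGrad D f, fun x hx => ?_, hf.1.1.hasWeakGradient, fun m hm hmk => ?_⟩
  · have a1 := abs_le.1 (hcomp x (subset_closure hx))
    have a2 := abs_le.1 (hdist x (subset_closure hx))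
    rw [abs_le]
    constructor <;> linarith [a1.1, a1.2, a2.1, a2.2]
  · have hmq : (m : ℝ) ≤ q j := le_trans (by exact_mod_cast hmk) hj2
    have := hf.eLpNorm_le_of_le hD hbD hv.1 (by positivity) hmq
    rwa [ENNReal.ofReal_natCast] at this

/-- A version of the Arzelà–Ascoli theorem for uniformly Hölder continuous functions. -/
theorem exists_subseq_tendstoUniformlyOn {X : Type*} [PseudoMetricSpace X] {K : Set X}
    (hK : IsCompact K) {f : ℕ → X → ℝ} {C R a : ℝ} (ha : 0 < a)
    (hf : ∀ k x y, |f k x - f k y| ≤ C * dist x y ^ a) (hR : ∀ k x, |f k x| ≤ R) :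
    ∃ (s : ℕ → ℕ) (h : X → ℝ), StrictMono s ∧ TendstoUniformlyOn (fun j => f (s j)) h atTop K := by
  have hKc : CompactSpace K := isCompact_iff_compactSpace.1 hK
  have hmod : Tendsto (fun t : ℝ => C * t ^ a) (𝓝 0) (𝓝 0) := by
    have := (Real.continuousAt_rpow_const (0 : ℝ) a (Or.inr ha.le)).tendsto.const_mul C
    rwa [Real.zero_rpow ha.ne', mul_zero] at this
  have heq : Equicontinuous fun k (x : K) => f k x :=
    Metric.equicontinuous_of_continuity_modulus _ hmod _ fun x y k => hf k x y
  let φ : ℕ → BoundedContinuousFunction K ℝ := fun k =>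
    BoundedContinuousFunction.mkOfCompact ⟨fun x : K => f k x, heq.continuous k⟩
  have hcomp : IsCompact (closure (range φ)) := by
    refine BoundedContinuousFunction.arzela_ascoli (Icc (-R) R) isCompact_Icc _ ?_ ?_
    · rintro _ x ⟨k, rfl⟩
      exact abs_le.1 (hR k x)
    · refine Metric.equicontinuous_of_continuity_modulus _ hmod _ ?_
      rintro x y ⟨_, k, rfl⟩
      exact hf k x y
  obtain ⟨h, -, s, hs, hlim⟩ := hcomp.tendsto_subseq
    (x := φ) (fun k => subset_closure (mem_range_self k))
  rw [BoundedContinuousFunction.tendsto_iff_tendstoUniformly] at hlim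
  classical
  refine ⟨s, fun x => if hx : x ∈ K then h ⟨x, hx⟩ else 0, hs, ?_⟩
  rw [tendstoUniformlyOn_iff_tendstoUniformly_comp_coe]
  convert hlim using 1
  · ext x y
    rfl
  · ext x
    simp

/-- Sequences of minimizers for exponents tending to infinity are precompact. -/
theorem exists_subseq_of_isPMinimizer (hn : 1 ≤ n) (hΩ : IsOpen Ω) (hb : Bornology.IsBounded Ω)
    (hg : MemCSobolev Ω (⊤ : ℝ≥0∞) g) {q : ℕ → ℝ} (hqlim : Tendsto q atTop atTop)
    {w : ℕ → (𝔼 n) → ℝ} (hw : ∀ k, IsPMinimizer Ω (q k) g (w k)) :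
    ∃ (s : ℕ → ℕ) (u : (𝔼 n) → ℝ), StrictMono s ∧
      TendstoUniformlyOn (fun j => w (s j)) u atTop (closure Ω) := by
  have := isFiniteMeasure_restrict hb
  -- One exponent above `n` is fixed so that the Morrey constants do not vary along the sequence;
  -- the shift by `k₀` discards the terms with exponent below `r`.
  set r : ℝ := (n : ℝ) + 1 with hr
  have hr0 : 0 < r := by positivity
  have hr1 : 1 ≤ r := by linarith [Nat.cast_nonneg (α := ℝ) n]
  obtain ⟨M, hM0, hM⟩ := exists_morrey_zero n hr1 (lt_add_one _)
  obtain ⟨M', hM'0, hM'⟩ := exists_sup_bound hn hΩ hb hr1 (lt_add_one _)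
  obtain ⟨k₀, hk₀⟩ := eventually_atTop.1 (hqlim.eventually_ge_atTop r)
  set N : ℝ≥0∞ := volume.restrict Ω univ ^ (1 / r) *
    eLpNorm (weakGrad Ω g) ⊤ (volume.restrict Ω) with hN
  have hNt : N ≠ ⊤ := ENNReal.mul_ne_top
    (ENNReal.rpow_ne_top_of_nonneg (by positivity) (measure_ne_top _ _)) (hg.memLp hΩ).2.ne
  have hgr := hg.of_top hΩ hb (ENNReal.ofReal r)
  have hgmin : eLpNorm (weakGrad Ω g) (ENNReal.ofReal r) (volume.restrict Ω) ≤ N := by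
    have := eLpNorm_le_eLpNorm_mul_rpow_measure_univ (μ := volume.restrict Ω)
      (le_top (a := ENNReal.ofReal r)) (hgr.memLp hΩ).1
    rwa [ENNReal.toReal_ofReal hr0.le, ENNReal.toReal_top, div_zero, sub_zero, mul_comm] at this
  have hr1' : 1 ≤ ENNReal.ofReal r := by simpa using hr1
  have hwr : ∀ k, eLpNorm (weakGrad Ω (w (k + k₀))) (ENNReal.ofReal r) (volume.restrict Ω) ≤ N :=
    fun k => (hw _).eLpNorm_le_of_le hΩ hb hg hr0 (hk₀ _ (by omega))
  have hmem : ∀ k, MemLp (weakGrad Ω (w (k + k₀))) (ENNReal.ofReal r) (volume.restrict Ω) :=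
    fun k => ⟨((hw _).1.1.memLp hΩ).1, (hwr k).trans_lt hNt.lt_top⟩
  have hbd : ∀ k, (eLpNorm (weakGrad Ω (w (k + k₀)) - weakGrad Ω g) (ENNReal.ofReal r)
      (volume.restrict Ω)).toReal ≤ (N + N).toReal := fun k =>
    ENNReal.toReal_mono (ENNReal.add_ne_top.2 ⟨hNt, hNt⟩)
      ((eLpNorm_sub_le (hmem k).1 (hgr.memLp hΩ).1 hr1').trans (add_le_add (hwr k) hgmin))
  have hc : ∀ k, ContinuousOn (w (k + k₀) - g) (closure Ω) := fun k => (hw _).1.1.1.sub hg.1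
  have h0 : ∀ k, ∀ x ∈ frontier Ω, (w (k + k₀) - g) x = 0 := fun k =>
    sub_boundary_zero (hw _).1.2 fun _ _ => rfl
  have hgrad : ∀ k, HasWeakGradient Ω (w (k + k₀) - g) (weakGrad Ω (w (k + k₀)) - weakGrad Ω g) :=
    fun k => (hw _).1.1.hasWeakGradient.sub hg.hasWeakGradient
  have hmem' := fun k => (hmem k).sub (hgr.memLp hΩ)
  have ha : 0 < 1 - (n : ℝ) / r := by
    rw [sub_pos, div_lt_one hr0]; exact lt_add_one _
  -- Compactness is applied to `w - g` extended by zero, which is uniformly Hölder on the whole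
  -- space; `g`, merely continuous up to the boundary, is added back afterwards.
  obtain ⟨s, h, hs, hlim⟩ := exists_subseq_tendstoUniformlyOn hb.isCompact_closure
    (f := fun k => Ω.indicator (w (k + k₀) - g)) (C := M * (N + N).toReal)
    (R := M' * (N + N).toReal) ha
    (fun k x y => by
      refine (hM Ω _ _ hΩ hb (hc k) (h0 k) (hgrad k) (hmem' k) x y).trans ?_
      rw [dist_eq_norm, mul_right_comm]
      exact mul_le_mul_of_nonneg_right (mul_le_mul_of_nonneg_left (hbd k) hM0) (by positivity))
    (fun k x => by
      by_cases hx : x ∈ Ω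
      · rw [indicator_of_mem hx]
        exact (hM' _ _ (hc k) (h0 k) (hgrad k) (hmem' k) x (subset_closure hx)).trans
          (mul_le_mul_of_nonneg_left (hbd k) hM'0)
      · rw [indicator_of_notMem hx, abs_zero]
        positivity)
  refine ⟨fun j => s j + k₀, fun x => h x + g x, fun i j hij => by
    have := hs hij
    show s i + k₀ < s j + k₀
    omega, ?_⟩
  rw [Metric.tendstoUniformlyOn_iff] at hlim ⊢
  intro ε hε
  filter_upwards [hlim ε hε] with j hj x hx
  have h1 := hj x hx
  have h2 : Ω.indicator (w (s j + k₀) - g) x = w (s j + k₀) x - g x := by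
    by_cases hxΩ : x ∈ Ω
    · rw [indicator_of_mem hxΩ]; rfl
    · rw [indicator_of_notMem hxΩ]
      have hxf : x ∈ frontier Ω := by rw [hΩ.frontier_eq]; exact ⟨hx, hxΩ⟩
      exact (h0 (s j) x hxf).symm
  rw [h2, Real.dist_eq] at h1
  rw [Real.dist_eq]
  convert h1 using 2
  ring

/-- If the boundary data is Lipschitz, so is every bounded Sobolev extension of it. -/
theorem exists_lipschitzOnWith (hΩ : IsOpen Ω) (hb : Bornology.IsBounded Ω)
    (hg : MemCSobolev Ω (⊤ : ℝ≥0∞) g) (hu : MemCSobolev Ω (⊤ : ℝ≥0∞) u)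
    (hug : EqOn u g (frontier Ω)) (h : ∃ K, LipschitzOnWith K g Ω) :
    ∃ K, LipschitzOnWith K u Ω := by
  obtain ⟨K, hK⟩ := h
  have hm := (hu.memLp hΩ).sub (hg.memLp hΩ)
  have hi := MemLp.integrableOn_of_isBounded hb le_top hm
  have hw0 := sub_boundary_zero hug (fun _ _ => rfl : EqOn g g (frontier Ω))
  -- Extended by zero, `u - g` has a bounded weak gradient on a convex domain, the whole space, and
  -- is therefore globally Lipschitz whatever the geometry of Ω.
  have hw := (hu.hasWeakGradient.sub hg.hasWeakGradient).indicator hΩ hb (hu.1.sub hg.1) hw0 hi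
  have hm' : MemLp (Ω.indicator (weakGrad Ω u - weakGrad Ω g)) ⊤ volume :=
    (memLp_indicator_iff_restrict hΩ.measurableSet).2 hm
  set L : ℝ := (eLpNorm (Ω.indicator (weakGrad Ω u - weakGrad Ω g)) ⊤ volume).toReal with hL
  have hae : ∀ᵐ x, ‖Ω.indicator (weakGrad Ω u - weakGrad Ω g) x‖ ≤ L := by
    filter_upwards [ae_le_eLpNormEssSup (μ := volume)
      (f := Ω.indicator (weakGrad Ω u - weakGrad Ω g))] with x hx
    rw [← eLpNorm_exponent_top] at hx
    have := ENNReal.toReal_mono hm'.2.ne hx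
    rwa [toReal_enorm] at this
  have hlip := abs_sub_le_of_weakGradient_bounded (continuous_indicator_zero (hu.1.sub hg.1) hw0)
    (hasCompactSupport_indicator hb _) hw (hi.integrable_indicator hΩ.measurableSet) hae
  refine ⟨K + L.toNNReal, LipschitzOnWith.of_dist_le_mul fun x hx y hy => ?_⟩
  have h1 := hlip x y
  rw [indicator_of_mem hx, indicator_of_mem hy] at h1
  have h2 := hK.dist_le_mul x hx y hy
  rw [NNReal.coe_add, Real.coe_toNNReal _ ENNReal.toReal_nonneg, add_mul]
  rw [Real.dist_eq] at h2 ⊢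
  rw [dist_eq_norm] at h2 ⊢
  have e : u x - u y = (g x - g y) + ((u - g) x - (u - g) y) := by
    simp only [Pi.sub_apply]; ring
  rw [e]
  exact (abs_add_le _ _).trans (add_le_add h2 h1)

end Limit

end InfLaplace

/-! ### Assembly of the main theorem. -/

theorem mainTheorem3 (n : ℕ) (hn : 1 ≤ n) (Ω : Set (EuclideanSpace ℝ (Fin n)))
    (hΩ : InfLaplace.IsDomain Ω) (hb : Bornology.IsBounded Ω)
    (g : EuclideanSpace ℝ (Fin n) → ℝ) (hg : InfLaplace.MemCSobolev Ω (⊤ : ℝ≥0∞) g) :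
    ∃ U : ℝ → EuclideanSpace ℝ (Fin n) → ℝ,
      (∀ p : ℝ, (n : ℝ) < p → 2 ≤ p →
        InfLaplace.IsPMinimizer Ω p g (U p) ∧ InfLaplace.IsPLaplaceSolution Ω p g (U p) ∧
        (∀ w, InfLaplace.IsPMinimizer Ω p g w → EqOn w (U p) (closure Ω)) ∧
        (∀ w, InfLaplace.IsPLaplaceSolution Ω p g w → EqOn w (U p) (closure Ω))) ∧
      ∀ q : ℕ → ℝ, (∀ k, (n : ℝ) < q k ∧ 2 ≤ q k) → Tendsto q atTop atTop →
        ∃ (s : ℕ → ℕ) (u : EuclideanSpace ℝ (Fin n) → ℝ), StrictMono s ∧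
          TendstoUniformlyOn (fun j => U (q (s j))) u atTop (closure Ω) ∧
          InfLaplace.MemCSobolev Ω (⊤ : ℝ≥0∞) u ∧
          EqOn u g (frontier Ω) ∧
          ((∃ K, LipschitzOnWith K g Ω) → ∃ K, LipschitzOnWith K u Ω) ∧
          InfLaplace.IsAbsoluteMinimizer Ω u := by
  have hΩo := hΩ.1
  have hex : ∀ p : ℝ, ∃ u, (n : ℝ) < p → 2 ≤ p → InfLaplace.IsPMinimizer Ω p g u := by
    intro p
    by_cases h : (n : ℝ) < p ∧ 2 ≤ p
    · obtain ⟨u, hu⟩ := InfLaplace.exists_isPMinimizer hn hΩo hb h.2 h.1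
        ⟨g, hg.of_top hΩo hb _, fun _ _ => rfl⟩
      exact ⟨u, fun _ _ => hu⟩
    · exact ⟨g, fun h1 h2 => absurd ⟨h1, h2⟩ h⟩
  choose U hU using hex
  refine ⟨U, fun p hnp hp => ⟨hU p hnp hp, (hU p hnp hp).isPLaplaceSolution hΩo hb hp,
    fun w hw => hw.eqOn hn hΩo hb hp (hU p hnp hp),
    fun w hw => (hw.isPMinimizer hΩo hb hp).eqOn hn hΩo hb hp (hU p hnp hp)⟩,
    fun q hq hqlim => ?_⟩
  have hmin : ∀ k, InfLaplace.IsPMinimizer Ω (q k) g (U (q k)) := fun k =>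
    hU _ (hq k).1 (hq k).2
  obtain ⟨s, u, hs, hunif⟩ := InfLaplace.exists_subseq_of_isPMinimizer hn hΩo hb hg hqlim hmin
  have hcont : ContinuousOn u (closure Ω) :=
    hunif.continuousOn (Frequently.of_forall fun j => (hmin (s j)).1.1.1)
  have hbdry : EqOn u g (frontier Ω) := fun x hx =>
    tendsto_nhds_unique (hunif.tendsto_at (frontier_subset_closure hx))
      (tendsto_const_nhds.congr fun j => ((hmin (s j)).1.2 hx).symm)
  have hlim : ∀ (D : Set (EuclideanSpace ℝ (Fin n))) (v : EuclideanSpace ℝ (Fin n) → ℝ),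
      IsOpen D → D ⊆ Ω → InfLaplace.IsAdmissible D (⊤ : ℝ≥0∞) u v →
      ∃ G, InfLaplace.HasWeakGradient D u G ∧ MemLp G ⊤ (volume.restrict D) ∧
        eLpNorm G ⊤ (volume.restrict D) ≤
          eLpNorm (InfLaplace.weakGrad D v) ⊤ (volume.restrict D) := fun D v hD hDΩ hv =>
    InfLaplace.exists_hasWeakGradient_le_of_limit hn hΩo hb (fun j => hq (s j))
      (hqlim.comp hs.tendsto_atTop) (fun j => hmin (s j)) hunif hD hDΩ hv
  -- The case `D = Ω`, `v = g` shows that `u` itself has a bounded gradient.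
  obtain ⟨G₀, hG₀, hG₀m, -⟩ := hlim Ω g hΩo Subset.rfl ⟨hg, hbdry.symm⟩
  have hu : InfLaplace.MemCSobolev Ω (⊤ : ℝ≥0∞) u :=
    InfLaplace.memCSobolev_of_hasWeakGradient hΩo hb hcont hG₀ hG₀m
  refine ⟨s, u, hs, hunif, hu, hbdry, InfLaplace.exists_lipschitzOnWith hΩo hb hg hu hbdry,
    fun D hD hDΩ v hv => ?_⟩
  obtain ⟨G, hG, -, hle⟩ := hlim D v hD.1 hDΩ hv
  -- The gradient taken in Ω is also a weak gradient in `D`, so uniqueness identifies it a.e. with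
  -- the bounded `G`.
  rwa [eLpNorm_congr_ae ((hu.hasWeakGradient.mono hDΩ).ae_eq hD.1 hG)]
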